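/- Conventions. Let $\mathrm{Sch}$ be the category of schemes with the étale topology. A presheaf of groupoids on a category $\mathcal C$ is a pseudofunctor $\mathcal C^{op}\to\mathrm{Grpds}$, and a stack on a site is a presheaf of groupoids satisfying descent. For presheaves of groupoids $\mathscr X,\mathscr Y$, let $\mathrm{Mor}(\mathscr X,\mathscr Y)$ be the groupoid of pseudonatural transformations and modifications. Algebraic stacks are understood in the sense of Laumon and Moret-Bailly: étale stacks with representable, separated and quasi-compact diagonal that admit a smooth surjective morphism from a scheme. A property $P$ of schemes is smooth-local if, for every covering $(S_i\to S)$ by jointly surjective smooth morphisms, $S$ has $P$ if and only if every $S_i$ has $P$. For such a $P$, let $\mathrm{Sch}_P\subset\mathrm{Sch}$ be the full subcategory of schemes with property $P$; an algebraic stack has property $P$ if it admits a smooth surjective morphism from a scheme with property $P$. If $\mathcal D\subset\mathcal C$ is a full subcategory of a site and $\mathscr F$ is a presheaf of groupoids on $\mathcal D$, the sheafified left Kan extension of $\mathscr F$ is the stack associated with the left Kan extension of $\mathscr F$ along $\mathcal D^{op}\to\mathcal C^{op}$ (that is, with the value at $\mathscr F$ of the left adjoint of the restriction of presheaves of groupoids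 from $\mathcal C$ to $\mathcal D$; groupoids are allowed to be large enough for it to exist). Proposition. (1) Let $P$ be a smooth-local property of schemes, let $\mathscr X$ be an algebraic stack with property $P$, and denote by $\mathscr X_P$ the restriction of $\mathscr X$ to $\mathrm{Sch}_P^{op}$. Then (a) for every stack $\mathscr Y:\mathrm{Sch}^{op}\to\mathrm{Grpds}$, the restriction functor $\mathrm{Mor}(\mathscr X,\mathscr Y)\to\mathrm{Mor}(\mathscr X_P,\mathscr Y_P)$ is an equivalence; (b) $\mathscr X$ is the sheafified left Kan extension of $\mathscr X_P$ to $\mathrm{Sch}^{op}$, with unit the identity $\mathscr X_P\to\mathscr X_P$. (2) Let $p$ be a prime. For stacks $\mathscr X$ on the category $\mathrm{Sch}_{\mathbb F_p}$ of $\mathbb F_p$-schemes with the étale topology, let $\mathscr X_{\mathrm{Sm}}$ be the restriction of $\mathscr X$ to the full subcategory $\mathrm{Sm}_{\mathbb F_p}$ of smooth $\mathbb F_p$-schemes. Then (a) the functor $\mathscr X\mapsto\mathscr X_{\mathrm{Sm}}$ is fully faithful on the $(2,1)$-category of smooth algebraic stacks over $\mathbb F_p$: if $\mathscr X,\mathscr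 Y$ are smooth algebraic stacks over $\mathbb F_p$, then $\mathrm{Mor}(\mathscr X,\mathscr Y)\to\mathrm{Mor}(\mathscr X_{\mathrm{Sm}},\mathscr Y_{\mathrm{Sm}})$ is an equivalence; (b) every smooth algebraic stack $\mathscr X$ over $\mathbb F_p$ is the sheafified left Kan extension of $\mathscr X_{\mathrm{Sm}}$ to $\mathrm{Sch}_{\mathbb F_p}^{op}$, with unit the identity of $\mathscr X_{\mathrm{Sm}}$. -/

import Mathlib

open CategoryTheory Opposite Limits AlgebraicGeometry
open scoped CategoryTheory.Bicategory CategoryTheory.Pseudofunctor.StrongTrans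

universe w w' v u v₁ u₁ v₂ u₂ v₃ u₃

noncomputable section

namespace StackyYoneda

/-! ### Restriction of pseudofunctors, strong transformations and modifications -/

section Precomposition

variable {A : Type u₁} [Bicategory.{v₁, w} A] {B : Type u₂} [Bicategory.{v₂, w'} B]
  {C : Type u₃} [Bicategory.{v₃, v} C]

/-- Precomposition of a strong transformation with a pseudofunctor. -/
def precompTrans (H : A ⥤ᵖ B) {F G : B ⥤ᵖ C} (η : F ⟶ G) : H.comp F ⟶ H.comp G where
  app a := η.app (H.obj a)
  naturality f := η.naturality (H.map f)
  naturality_naturality β := η.naturality_naturality (H.map₂ β)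
  naturality_id a := by
    change (η.naturality (H.map (𝟙 a))).hom ≫
        η.app (H.obj a) ◁ (G.map₂ (H.mapId a).hom ≫ (G.mapId (H.obj a)).hom) =
      (F.map₂ (H.mapId a).hom ≫ (F.mapId (H.obj a)).hom) ▷ η.app (H.obj a) ≫
        (λ_ (η.app (H.obj a))).hom ≫ (ρ_ (η.app (H.obj a))).inv
    rw [Bicategory.whiskerLeft_comp, ← η.naturality_naturality_assoc, η.naturality_id,
      Bicategory.comp_whiskerRight, Category.assoc]
  naturality_comp {a b c} f g := by
    change (η.naturality (H.map (f ≫ g))).hom ≫ η.app (H.obj a) ◁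
        (G.map₂ (H.mapComp f g).hom ≫ (G.mapComp (H.map f) (H.map g)).hom) =
      (F.map₂ (H.mapComp f g).hom ≫ (F.mapComp (H.map f) (H.map g)).hom) ▷ η.app (H.obj c) ≫
        (α_ (F.map (H.map f)) (F.map (H.map g)) (η.app (H.obj c))).hom ≫
        F.map (H.map f) ◁ (η.naturality (H.map g)).hom ≫
        (α_ (F.map (H.map f)) (η.app (H.obj b)) (G.map (H.map g))).inv ≫
        (η.naturality (H.map f)).hom ▷ G.map (H.map g) ≫
        (α_ (η.app (H.obj a)) (G.map (H.map f)) (G.map (H.map g))).hom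
    rw [Bicategory.whiskerLeft_comp, ← η.naturality_naturality_assoc, η.naturality_comp,
      Bicategory.comp_whiskerRight, Category.assoc]

/-- Precomposition with a pseudofunctor, as a functor between categories of strong
transformations (with modifications as morphisms). -/
def precompFunctor (H : A ⥤ᵖ B) (F G : B ⥤ᵖ C) : (F ⟶ G) ⥤ (H.comp F ⟶ H.comp G) where
  obj η := precompTrans H η
  map Γ := ⟨{ app a := Γ.as.app (H.obj a)
              naturality f := Γ.as.naturality (H.map f) }⟩

end Precomposition


/-! ### Presheaves and stacks of groupoids -/

section Presheaves

variable {C : Type u₁} [Category.{v₁} C] {D : Type u₂} [Category.{v₂} D]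

/-- Presheaves of categories on `C`: pseudofunctors `Cᵒᵖ ⥤ᵖ Cat`. For two of them `𝒳`, `𝒴`, the
category `𝒳 ⟶ 𝒴` is the category of strong (= pseudonatural) transformations and
modifications. -/
abbrev PreStk (C : Type u₁) [Category.{v₁} C] : Type _ :=
  LocallyDiscrete Cᵒᵖ ⥤ᵖ Cat.{w, w'}

/-- The values of `𝒳` are groupoids. -/
def IsGroupoidValued (𝒳 : PreStk.{w, w'} C) : Prop :=
  ∀ S : C, IsGroupoid (𝒳.obj (.mk (op S)))

/-- `𝒳` is a stack (= sheaf) of groupoids for the topology `J`. -/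
structure IsGroupoidStack (J : GrothendieckTopology C) (𝒳 : PreStk.{w, w'} C) : Prop where
  isGroupoidValued : IsGroupoidValued 𝒳
  isStack : 𝒳.IsStack J

/-- The pullback of `x ∈ 𝒳(S)` along `f : T ⟶ S`. -/
abbrev pull (𝒳 : PreStk.{w, w'} C) {S T : C} (f : T ⟶ S) (x : 𝒳.obj (.mk (op S))) :
    𝒳.obj (.mk (op T)) :=
  (𝒳.map f.op.toLoc).toFunctor.obj x

/-- The restriction of a presheaf of categories along `ι : D ⥤ C`. -/
abbrev restrict (ι : D ⥤ C) (𝒳 : PreStk.{w, w'} C) : PreStk.{w, w'} D :=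
  ι.op.toPseudofunctor.comp 𝒳

/-- The restriction functor `Mor(𝒳, 𝒴) ⥤ Mor(𝒳|_D, 𝒴|_D)`. -/
abbrev restrictMor (ι : D ⥤ C) (𝒳 𝒴 : PreStk.{w, w'} C) :
    (𝒳 ⟶ 𝒴) ⥤ (restrict ι 𝒳 ⟶ restrict ι 𝒴) :=
  precompFunctor ι.op.toPseudofunctor 𝒳 𝒴

/-- `η : 𝓕 ⟶ 𝒦|_D` exhibits `𝒦` as the left Kan extension of `𝓕` along `Dᵒᵖ ⥤ Cᵒᵖ` among presheaves
of groupoids, i.e. as the value at `𝓕` of the left adjoint of the restriction: for every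
presheaf of groupoids `𝒢` on `C`, the functor `Mor(𝒦, 𝒢) ⥤ Mor(𝓕, 𝒢|_D)` induced by `η` is an
equivalence. -/
structure IsLeftKanExtension (ι : D ⥤ C) {𝓕 : PreStk.{w, w'} D} {𝒦 : PreStk.{w, w'} C}
    (η : 𝓕 ⟶ restrict ι 𝒦) : Prop where
  isGroupoidValued : IsGroupoidValued 𝒦
  isEquivalence (𝒢 : PreStk.{w, w'} C) (h𝒢 : IsGroupoidValued 𝒢) :
    (restrictMor ι 𝒦 𝒢 ⋙ Bicategory.precomp (restrict ι 𝒢) η).IsEquivalence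

/-- `θ : 𝒦 ⟶ ℒ` exhibits `ℒ` as the stack associated with `𝒦` (the sheafification of `𝒦`), i.e. as
the value at `𝒦` of the left adjoint of the inclusion of stacks of groupoids into
presheaves of groupoids. -/
structure IsStackification (J : GrothendieckTopology C) {𝒦 ℒ : PreStk.{w, w'} C}
    (θ : 𝒦 ⟶ ℒ) : Prop where
  isGroupoidStack : IsGroupoidStack J ℒ
  isEquivalence (𝒴 : PreStk.{w, w'} C) (h𝒴 : IsGroupoidStack J 𝒴) :
    (Bicategory.precomp 𝒴 θ).IsEquivalence

/-- `η : 𝓕 ⟶ ℒ|_D` exhibits `ℒ` as the sheafified left Kan extension of `𝓕` along `Dᵒᵖ ⥤ Cᵒᵖ`: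
there is a left Kan extension `𝒦` of `𝓕`, and `ℒ` is the stack associated with `𝒦`, in such a way
that `η` is isomorphic to the composite `𝓕 ⟶ 𝒦|_D ⟶ ℒ|_D`. -/
def IsSheafifiedLeftKanExtension (J : GrothendieckTopology C) (ι : D ⥤ C)
    {𝓕 : PreStk.{w, w'} D} {ℒ : PreStk.{w, w'} C} (η : 𝓕 ⟶ restrict ι ℒ) : Prop :=
  ∃ (𝒦 : PreStk.{w, w'} C) (η₀ : 𝓕 ⟶ restrict ι 𝒦) (θ : 𝒦 ⟶ ℒ),
    IsLeftKanExtension ι η₀ ∧ IsStackification J θ ∧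
      Nonempty (η₀ ≫ (restrictMor ι 𝒦 ℒ).obj θ ≅ η)

end Presheaves

/-! ### Algebraic spaces and algebraic stacks

The objects of the category `C` are thought of as schemes via a functor `U : C ⥤ Scheme`. It will be
the identity of `Scheme`, the functor `Over S ⥤ Scheme`, or `Over T ⥤ C ⥤ Scheme` for such a `C`;
all these functors respect fiber products. The topology `J` will be the étale topology. A section
`v ∈ F(V)` of a presheaf `F` is the same as a morphism `V ⟶ F`. -/

section Algebraic

variable {C : Type u₁} [Category.{v₁} C] (U : C ⥤ Scheme.{u}) (J : GrothendieckTopology C)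

/-- The object `W`, with `a : W ⟶ V` and `b : W ⟶ T`, represents the fiber product `V ×_F T` of
`v : V ⟶ F` and `t : T ⟶ F`. -/
structure IsFiberProduct (F : Cᵒᵖ ⥤ Type w) {V T W : C} (v : F.obj (op V)) (t : F.obj (op T))
    (a : W ⟶ V) (b : W ⟶ T) : Prop where
  comm : F.map a.op v = F.map b.op t
  existsUnique (Z : C) (a' : Z ⟶ V) (b' : Z ⟶ T) (h : F.map a'.op v = F.map b'.op t) :
    ∃! l : Z ⟶ W, l ≫ a = a' ∧ l ≫ b = b'

/-- `v : V ⟶ F` is schematic, étale and surjective. -/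
def IsEtaleAtlas (F : Cᵒᵖ ⥤ Type w) {V : C} (v : F.obj (op V)) : Prop :=
  ∀ (T : C) (t : F.obj (op T)), ∃ (W : C) (a : W ⟶ V) (b : W ⟶ T),
    IsFiberProduct F v t a b ∧ Etale (U.map b) ∧ Surjective (U.map b)

/-- The diagonal `F ⟶ F × F` is schematic and has the property `Q`: for `s t : T ⟶ F`, the locus
`s = t` in `T` is represented by some `i : E ⟶ T` with the property `Q`. -/
def DiagonalHas (Q : MorphismProperty Scheme.{u}) (F : Cᵒᵖ ⥤ Type w) : Prop :=
  ∀ (T : C) (s t : F.obj (op T)), ∃ (E : C) (i : E ⟶ T), Q (U.map i) ∧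
    F.map i.op s = F.map i.op t ∧
    ∀ (Z : C) (f : Z ⟶ T), F.map f.op s = F.map f.op t → ∃! l : Z ⟶ E, l ≫ i = f

/-- Algebraic spaces (in the sense of Laumon and Moret-Bailly, so quasi-separated): sheaves of sets
with a schematic and quasi-compact diagonal and with an étale atlas. -/
structure IsAlgebraicSpace (F : Cᵒᵖ ⥤ Type w) : Prop where
  isSheaf : Presieve.IsSheaf J F
  diagonal : DiagonalHas U @QuasiCompact F
  atlas : ∃ (V : C) (v : F.obj (op V)), IsEtaleAtlas U F v

/-- An algebraic space `F` is separated (over the final object of `C`, if there is one). -/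
def IsSeparatedSpace (F : Cᵒᵖ ⥤ Type w) : Prop :=
  DiagonalHas U @IsClosedImmersion F

/-- An algebraic space `F` is quasi-compact. -/
def IsQuasiCompactSpace (F : Cᵒᵖ ⥤ Type w) : Prop :=
  ∃ (V : C) (v : F.obj (op V)), CompactSpace (U.obj V) ∧ IsEtaleAtlas U F v

variable [HasBinaryProducts C]

/-- `v : V ⟶ 𝒳` is smooth and surjective: for every `t : T ⟶ 𝒳`, the fiber product `V ×_𝒳 T`, which is
the sheaf `Isom(pr₁^* v, pr₂^* t)` over `V × T`, has an étale atlas `W` such that the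
composite `W ⟶ V ×_𝒳 T ⟶ T` is smooth and surjective. -/
def IsSmoothAtlas (𝒳 : PreStk.{w, w'} C) {V : C} (v : 𝒳.obj (.mk (op V))) : Prop :=
  ∀ (T : C) (t : 𝒳.obj (.mk (op T))), ∃ (W : Over (V ⨯ T))
    (α : (𝒳.presheafHom (pull 𝒳 prod.fst v) (pull 𝒳 prod.snd t)).obj (op W)),
      IsEtaleAtlas (Over.forget (V ⨯ T) ⋙ U)
        (𝒳.presheafHom (pull 𝒳 prod.fst v) (pull 𝒳 prod.snd t)) α ∧
      Smooth (U.map (W.hom ≫ prod.snd)) ∧ Surjective (U.map (W.hom ≫ prod.snd))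

/-- Algebraic stacks in the sense of Laumon and Moret-Bailly: stacks of groupoids whose diagonal is
representable, separated and quasi-compact (i.e. for all `x y : T ⟶ 𝒳` with `T` affine, `Isom(x, y)`
is an algebraic space, separated and quasi-compact over `T`), and which admit a smooth
surjective morphism from a scheme. -/
structure IsAlgebraicStack (𝒳 : PreStk.{w, w'} C) : Prop where
  isGroupoidStack : IsGroupoidStack J 𝒳
  diagonal (T : C) (hT : IsAffine (U.obj T)) (x y : 𝒳.obj (.mk (op T))) :
    IsAlgebraicSpace (Over.forget T ⋙ U) (J.over T) (𝒳.presheafHom x y) ∧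
    IsSeparatedSpace (Over.forget T ⋙ U) (𝒳.presheafHom x y) ∧
    IsQuasiCompactSpace (Over.forget T ⋙ U) (𝒳.presheafHom x y)
  atlas : ∃ (V : C) (v : 𝒳.obj (.mk (op V))), IsSmoothAtlas U 𝒳 v

/-- The algebraic stack `𝒳` has the (smooth-local) property `P`: it has a smooth atlas by a scheme
with the property `P`. -/
def HasProperty (P : ObjectProperty C) (𝒳 : PreStk.{w, w'} C) : Prop :=
  ∃ (V : C) (v : 𝒳.obj (.mk (op V))), IsSmoothAtlas U 𝒳 v ∧ P V

end Algebraic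

/-- A property `P` of schemes is smooth-local: for every smooth covering `(S_i ⟶ S)`, the scheme `S`
has the property `P` if and only if all `S_i` have it. -/
def IsSmoothLocal (P : ObjectProperty Scheme.{u}) : Prop :=
  ∀ (S : Scheme.{u}) (𝒮 : Scheme.Cover.{u} (Scheme.precoverage @Smooth) S),
    P S ↔ ∀ i, P (𝒮.X i)

/-! ### Stacks on the category of all schemes -/

/-- Presheaves of categories on the category of schemes. -/
abbrev SchPreStk : Type _ := PreStk.{w, w'} Scheme.{u}

/-- Stacks of groupoids on the category of schemes, for the étale topology. -/
abbrev IsStk (𝒴 : SchPreStk.{w, w', u}) : Prop :=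
  IsGroupoidStack Scheme.etaleTopology 𝒴

/-- Algebraic stacks (over `ℤ`) with the property `P`. -/
def IsAlgStk (P : ObjectProperty Scheme.{u}) (𝒳 : SchPreStk.{w, w', u}) : Prop :=
  IsAlgebraicStack (𝟭 Scheme.{u}) Scheme.etaleTopology 𝒳 ∧ HasProperty (𝟭 Scheme.{u}) P 𝒳

/-! ### Stacks over `𝔽_p` -/

/-- `Spec 𝔽_p`. -/
abbrev specF (p : ℕ) : Scheme.{u} := Spec (.of (ULift.{u} (ZMod p)))

/-- The category of `𝔽_p`-schemes. -/
abbrev SchF (p : ℕ) : Type _ := Over (specF.{u} p)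

/-- The étale topology on the category of `𝔽_p`-schemes. -/
abbrev etaleF (p : ℕ) : GrothendieckTopology (SchF.{u} p) :=
  Scheme.etaleTopology.over (specF p)

/-- Smoothness over `𝔽_p`. -/
def smF (p : ℕ) : ObjectProperty (SchF.{u} p) := fun X => Smooth X.hom

/-- Smooth algebraic stacks over `𝔽_p`. -/
def IsSmoothAlgStkF (p : ℕ) (𝒳 : PreStk.{w, w'} (SchF.{u} p)) : Prop :=
  IsAlgebraicStack (Over.forget (specF p)) (etaleF p) 𝒳 ∧
    HasProperty (Over.forget (specF p)) (smF p) 𝒳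

end StackyYoneda

end

open StackyYoneda

/-! A morphism from `𝒳` to a presheaf of groupoids `𝒴` is the same as a functor from the total
category of `𝒳` to that of `𝒴` over the base category, that is, a section (`toSec`). Preservation of
cartesian arrows is automatic, because every arrow over a presheaf of groupoids is cartesian. Under
this dictionary, restriction to a subcategory `D` becomes restriction of sections to the total
category of `𝒳|_D` (`toSecCompPre`). Statement (a) thus says that a section defined over `D`
extends, uniquely up to unique isomorphism, whenever `𝒴` is a stack (`isEquivalence_pre`).

The extension is descent along a smooth atlas `v : V ⟶ 𝒳` with `V` in `D`. For `t : T ⟶ 𝒳`, the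
fiber product `V ×_𝒳 T` has an étale atlas `W`, and `W ⟶ T` is smooth and surjective. Smooth
morphisms have sections étale locally (`exists_etale_factorization`), so `W ⟶ T` is an étale
covering, and over `W` a section is the pullback of its value at `v`. If `T` lies in `D`, so does
`W`. The fiber product with `W` over `V ×_𝒳 T` of an object of `D` is étale over that object, hence
lies in `D` again. These facts are recorded abstractly by `IsAtlas`; since `V ×_𝒳 T` itself need not
be representable, all gluing is phrased with `W` and such étale refinements.

A morphism of sections is moved from `v` to every object mapping to `v` and glued along charts
(`faithful_pre`, `full_pre`). For a section over `D`, the values on the charts `W` of objects of `D`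
produce identifications between pullbacks of the value at `v` over arbitrary test objects
(`TransportSystem`). These identifications form descent data, hence a value at every object of `𝒳`
(`Chart`), and arrows compatible with transport exist uniquely, which gives functoriality
(`essSurj_pre`).

For (b), the left Kan extension is written down explicitly: its value at `T` is the free groupoid on
the category of arrows from `T` to the image of an object of the total category of `𝓕`. It
represents sections over that category (`freeStk.isEquivalence_preSec_taut`), which are the
morphisms from `𝓕`. The identity of `𝒳|_D` then yields a comparison from the Kan extension to `𝒳`,
and (a) together with two-out-of-three shows that it is a stackification. -/

noncomputable section

namespace StackyYoneda

/-! ### Smooth surjections are étale coverings. -/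

section EtaleLocalSections

open Polynomial in
/-- A nonzero polynomial over an algebraically closed field does not vanish at all `m`-th roots of
unity if `m` is invertible and exceeds its degree. -/
lemma exists_pow_eq_one_eval_ne_zero {L : Type*} [Field L] [IsAlgClosed L] {g : L[X]} (hg : g ≠ 0)
    {m : ℕ} (hm : (m : L) ≠ 0) (hgm : g.natDegree < m) : ∃ z : L, z ^ m = 1 ∧ g.eval z ≠ 0 := by
  classical
  by_contra! h
  have hsep : (X ^ m - 1 : L[X]).Separable := by
    simpa using separable_X_pow_sub_C (1 : L) hm one_ne_zero
  have hcard : Fintype.card ((X ^ m - 1 : L[X]).rootSet L) = (X ^ m - 1 : L[X]).natDegree :=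
    card_rootSet_eq_natDegree hsep (IsAlgClosed.splits _)
  have hdeg : (X ^ m - 1 : L[X]).natDegree = m := by
    simpa using natDegree_X_pow_sub_C (R := L) (n := m) (r := 1)
  have hsub : (X ^ m - 1 : L[X]).rootSet L ⊆ g.rootSet L := by
    intro z hz
    rw [mem_rootSet] at hz ⊢
    refine ⟨hg, ?_⟩
    have := h z (by simpa [sub_eq_zero] using hz.2)
    simpa [coe_aeval_eq_eval] using this
  have h1 : Fintype.card ((X ^ m - 1 : L[X]).rootSet L) ≤ Fintype.card (g.rootSet L) :=
    Set.card_le_card hsub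
  have h2 : Fintype.card (g.rootSet L) ≤ g.natDegree := by
    have : Fintype.card (g.rootSet L) = (g.aroots L).toFinset.card := Fintype.card_coe _
    rw [this]
    refine (Multiset.toFinset_card_le _).trans ?_
    simpa [aroots] using card_roots' (g.map (algebraMap L L))
  omega

open Polynomial in
/-- Étale locally, a polynomial with nonzero reduction takes an invertible value. -/
lemma exists_etale_isUnit_aeval_polynomial {A : Type u} [CommRing A] (p : Ideal A) [p.IsPrime]
    (g : A[X]) (hg : g.map (Ideal.Quotient.mk p) ≠ 0) :
    ∃ (B : Type u) (_ : CommRing B) (_ : Algebra A B) (b : B), Algebra.Etale A B ∧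
      IsUnit (aeval b g) ∧ ∃ q : PrimeSpectrum B, q.asIdeal.comap (algebraMap A B) = p := by
  set g' := g.map (Ideal.Quotient.mk p)
  -- Two consecutive integers cannot both vanish in `A ⧸ p`, so one of `deg + 1` and `deg + 2`
  -- works.
  obtain ⟨m, hm, hgm⟩ : ∃ m : ℕ, (m : A ⧸ p) ≠ 0 ∧ g'.natDegree < m := by
    by_cases h : ((g'.natDegree + 1 : ℕ) : A ⧸ p) = 0
    · refine ⟨g'.natDegree + 2, fun h' => one_ne_zero (α := A ⧸ p) ?_, by omega⟩
      have : ((g'.natDegree + 2 : ℕ) : A ⧸ p) = ((g'.natDegree + 1 : ℕ) : A ⧸ p) + 1 := by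
        push_cast; ring
      rw [this, h, zero_add] at h'
      exact h'
    · exact ⟨_, h, by omega⟩
  obtain ⟨k, rfl⟩ : ∃ k, m = k + 1 := ⟨m - 1, by omega⟩
  -- The algebra adjoins an `m`-th root of unity `X` and inverts `m * g(X)`. Inverting `m` makes `X
  -- ^ m - 1` étale: `X * f' - m * f = m`, and multiplying by `g` gives `cond`.
  let P : StandardEtalePair A :=
    { f := X ^ (k + 1) - 1
      monic_f := by simpa using monic_X_pow_sub_C (1 : A) (Nat.succ_ne_zero k)
      g := C ((k + 1 : ℕ) : A) * g
      cond := by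
        refine ⟨X * g, - C ((k + 1 : ℕ) : A) * g, 1, ?_⟩
        simp only [derivative_sub, derivative_X_pow, derivative_one, Nat.add_sub_cancel]
        ring }
  -- A prime over `p` is the kernel of a map to a geometric point at `p`, sending `X` to a root of
  -- unity where `g` does not vanish. Passing to an algebraic closure handles finite residue fields.
  let L := AlgebraicClosure (FractionRing (A ⧸ p))
  let φ : A →+* L := (algebraMap (FractionRing (A ⧸ p)) L).comp
    ((algebraMap (A ⧸ p) (FractionRing (A ⧸ p))).comp (Ideal.Quotient.mk p))
  have hinj : Function.Injective ((algebraMap (FractionRing (A ⧸ p)) L).comp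
      (algebraMap (A ⧸ p) (FractionRing (A ⧸ p)))) :=
    (algebraMap (FractionRing (A ⧸ p)) L).injective.comp
      (IsFractionRing.injective (A ⧸ p) (FractionRing (A ⧸ p)))
  have hφ : RingHom.ker φ = p := by
    change RingHom.ker (((algebraMap (FractionRing (A ⧸ p)) L).comp
      (algebraMap (A ⧸ p) (FractionRing (A ⧸ p)))).comp (Ideal.Quotient.mk p)) = p
    rw [RingHom.ker_comp_of_injective _ hinj, Ideal.mk_ker]
  have hgL : g.map φ = g'.map ((algebraMap (FractionRing (A ⧸ p)) L).comp
      (algebraMap (A ⧸ p) (FractionRing (A ⧸ p)))) := by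
    rw [Polynomial.map_map]; rfl
  have hmL : ((k + 1 : ℕ) : L) ≠ 0 := by
    rw [← map_natCast ((algebraMap (FractionRing (A ⧸ p)) L).comp
      (algebraMap (A ⧸ p) (FractionRing (A ⧸ p))))]
    exact (map_ne_zero_iff _ hinj).mpr hm
  obtain ⟨z, hz, hz'⟩ := exists_pow_eq_one_eval_ne_zero (g := g.map φ)
    (by rw [hgL]; exact (Polynomial.map_ne_zero_iff hinj).mpr hg) hmL
    (by rw [hgL, natDegree_map_eq_of_injective hinj]; exact hgm)
  let : Algebra A L := φ.toAlgebra
  have hmap : P.HasMap z := by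
    refine ⟨by simp [P, hz], ?_⟩
    have : aeval z g = (g.map φ).eval z := by
      rw [Polynomial.eval_map]; rfl
    simp only [P, map_mul, this, map_natCast]
    exact (IsUnit.mk0 (G₀ := L) _ hmL).mul (IsUnit.mk0 (G₀ := L) _ hz')
  refine ⟨P.Ring, inferInstance, inferInstance, P.X, inferInstance, ?_,
    ⟨RingHom.ker (P.lift z hmap), RingHom.ker_isPrime _⟩, ?_⟩
  · have := P.hasMap_X.2
    simp only [P, map_mul] at this
    exact isUnit_of_mul_isUnit_right this
  · refine (RingHom.comap_ker _ _).trans ?_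
    have : ((P.lift z hmap : P.Ring →+* L).comp (algebraMap A P.Ring)) = φ :=
      (P.lift z hmap).comp_algebraMap
    exact (congrArg RingHom.ker this).trans hφ

/-- Étale locally, a polynomial in several variables with nonzero reduction takes an invertible
value. -/
lemma exists_etale_isUnit_aeval {A : Type u} [CommRing A] (p : Ideal A) [p.IsPrime]
    {σ : Type*} (h : MvPolynomial σ A) (hh : h.map (Ideal.Quotient.mk p) ≠ 0) :
    ∃ (B : Type u) (_ : CommRing B) (_ : Algebra A B) (b : σ → B), Algebra.Etale A B ∧
      IsUnit (MvPolynomial.aeval b h) ∧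
        ∃ q : PrimeSpectrum B, q.asIdeal.comap (algebraMap A B) = p := by
  -- Polynomials in one variable over `A ⧸ p` form an infinite domain, so a nonzero polynomial takes
  -- a nonzero value there. Lifting the coefficients of `s` reduces to the one-variable case.
  obtain ⟨s, hs⟩ : ∃ s : σ → Polynomial (A ⧸ p),
      MvPolynomial.eval₂ Polynomial.C s (h.map (Ideal.Quotient.mk p)) ≠ 0 := by
    by_contra! hc
    have : (h.map (Ideal.Quotient.mk p)).map (Polynomial.C (R := A ⧸ p)) = 0 := by
      refine MvPolynomial.funext fun s => ?_
      rw [MvPolynomial.eval_map, hc, map_zero]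
    exact hh ((map_eq_zero_iff _ (MvPolynomial.map_injective _ Polynomial.C_injective)).mp this)
  choose t ht using fun i => Polynomial.map_surjective _ (Ideal.Quotient.mk_surjective (I := p)) (s i)
  obtain ⟨B, _, _, b, hB, hb, hq⟩ := exists_etale_isUnit_aeval_polynomial p
    (MvPolynomial.aeval t h) (by
      convert hs
      rw [MvPolynomial.aeval_def, ← Polynomial.coe_mapRingHom, MvPolynomial.hom_eval₂,
        MvPolynomial.eval₂_map]
      congr 1
      · ext a; simp
      · funext i; exact ht i)
  refine ⟨B, inferInstance, inferInstance, fun i => Polynomial.aeval b (t i), hB, ?_, hq⟩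
  have : (MvPolynomial.aeval fun i => Polynomial.aeval b (t i)) =
      (Polynomial.aeval b).comp (MvPolynomial.aeval (R := A) t) := by
    ext i; simp
  rw [this]
  exact hb

/-- Smooth morphisms have sections étale locally around the image of any point. -/
lemma exists_etale_factorization {X Y : Scheme.{u}} (f : X ⟶ Y) [Smooth f] (x : X) :
    ∃ (Z : Scheme.{u}) (g : Z ⟶ X), Etale (g ≫ f) ∧ f x ∈ Set.range (g ≫ f) := by
  obtain ⟨U, hU, V, hV, hx, e, hf⟩ := Smooth.exists_isStandardSmooth f x
  obtain ⟨n, φ, hφ, hφ'⟩ := RingHom.IsStandardSmooth.exists_etale_mvPolynomial hf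
  have : Etale (Spec.map (CommRingCat.ofHom φ)) :=
    (HasRingHomProperty.Spec_iff (P := @Etale)).mpr hφ'
  let a := Spec.map (CommRingCat.ofHom φ)
  let c := Spec.map (CommRingCat.ofHom (MvPolynomial.C (σ := Fin n) (R := Γ(Y, U))))
  have hac : a ≫ c = Spec.map (f.appLE U V e) := by
    rw [← Spec.map_comp, ← CommRingCat.ofHom_comp, hφ]; rfl
  obtain ⟨q, rfl⟩ : x ∈ Set.range hV.fromSpec := by rw [hV.range_fromSpec]; exact hx
  -- The étale map `a` to affine space is open, so its image contains a basic open set `D(h)` around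
  -- the image of `q`. As `h` does not vanish at a point over `p`, its reduction modulo `p` is
  -- nonzero.
  obtain ⟨_, ⟨h, rfl⟩, hqh, hh⟩ :=
    PrimeSpectrum.isTopologicalBasis_basic_opens.exists_subset_of_mem_open
      (Set.mem_range_self (f := a) q) a.isOpenMap.isOpen_range
  let p : Ideal Γ(Y, U) := q.asIdeal.comap (f.appLE U V e).hom
  have : p.IsPrime := q.isPrime.comap _
  have hp : h.map (Ideal.Quotient.mk p) ≠ 0 := by
    intro h0
    apply hqh
    have : h ∈ p.map (MvPolynomial.C (σ := Fin n)) := by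
      rw [← Ideal.mk_ker (I := p), ← MvPolynomial.ker_map]
      exact h0
    have hle : p.map (MvPolynomial.C (σ := Fin n)) ≤ q.asIdeal.comap φ := by
      rw [Ideal.map_le_iff_le_comap, Ideal.comap_comap, hφ]
    exact hle this
  obtain ⟨B, _, _, b, hB, hb, r, hr⟩ := exists_etale_isUnit_aeval p h hp
  -- This is an étale-local section of affine space landing in `D(h)`. Pulling back `a` along it
  -- gives a scheme étale over the base, whose fiber at `r` is nonempty.
  let s : Spec (.of B) ⟶ Spec (.of (MvPolynomial (Fin n) Γ(Y, U))) :=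
    Spec.map (CommRingCat.ofHom (MvPolynomial.aeval (R := Γ(Y, U)) b).toRingHom)
  have hsc : s ≫ c = Spec.map (CommRingCat.ofHom (algebraMap Γ(Y, U) B)) := by
    rw [← Spec.map_comp, ← CommRingCat.ofHom_comp]
    congr 2
    exact (MvPolynomial.aeval (R := Γ(Y, U)) b).comp_algebraMap
  have : Etale (Spec.map (CommRingCat.ofHom (algebraMap Γ(Y, U) B))) :=
    (HasRingHomProperty.Spec_iff (P := @Etale)).mpr (RingHom.etale_algebraMap.mpr hB)
  have hsr : s r ∈ Set.range a := hh fun hmem => r.isPrime.ne_top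
    (Ideal.eq_top_of_isUnit_mem _ hmem hb)
  obtain ⟨t, ht⟩ := hsr
  obtain ⟨z, hz, -⟩ := Scheme.Pullback.exists_preimage_pullback (f := s) (g := a) r t ht.symm
  have key : (pullback.snd s a ≫ hV.fromSpec) ≫ f = pullback.fst s a ≫
      Spec.map (CommRingCat.ofHom (algebraMap Γ(Y, U) B)) ≫ hU.fromSpec := by
    rw [Category.assoc, ← IsAffineOpen.SpecMap_appLE_fromSpec f hU hV e, ← hac, ← hsc,
      Category.assoc, Category.assoc, pullback.condition_assoc]
  refine ⟨pullback s a, pullback.snd s a ≫ hV.fromSpec, ?_, z, ?_⟩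
  · rw [key]
    infer_instance
  · rw [key, Scheme.Hom.comp_apply, hz, ← Scheme.Hom.comp_apply hV.fromSpec,
      ← IsAffineOpen.SpecMap_appLE_fromSpec f hU hV e, Scheme.Hom.comp_apply]
    exact congrArg hU.fromSpec (PrimeSpectrum.ext hr)

/-- Smooth surjective morphisms are coverings for the étale topology. -/
lemma generate_singleton_mem_etaleTopology {X Y : Scheme.{u}} (f : X ⟶ Y) [Smooth f]
    [Surjective f] : Sieve.generate (Presieve.singleton f) ∈ Scheme.etaleTopology Y := by
  choose s hs using f.surjective
  choose Z g hg hg' using fun y => exists_etale_factorization f (s y)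
  refine Scheme.mem_grothendieckTopology_iff.mpr ⟨Scheme.Cover.mkOfCovers Y Z (fun y => g y ≫ f)
    (fun y => ⟨y, ?_⟩) hg, ?_⟩
  · obtain ⟨z, hz⟩ := hg' y
    exact ⟨z, hz.trans (hs y)⟩
  · rintro _ _ ⟨y⟩
    exact ⟨X, g y, f, Presieve.singleton_self f, rfl⟩

end EtaleLocalSections

/-! ### Vertical and cartesian arrows in the total category. -/

section Total

variable {C : Type u₁} [Category.{v₁} C]

/-- The total category of a presheaf of categories. -/
abbrev Tot (𝒴 : PreStk.{w, w'} C) : Type _ := Pseudofunctor.CoGrothendieck 𝒴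

namespace Tot

variable {𝒴 : PreStk.{w, w'} C}

/-- The object of the total category given by `x ∈ 𝒴(S)`. -/
abbrev mk {S : C} (x : 𝒴.obj (.mk (op S))) : Tot 𝒴 := ⟨S, x⟩

/-- The morphism of the total category over `f` given by a morphism in the fiber. -/
abbrev homMk {a b : Tot 𝒴} (f : a.base ⟶ b.base) (α : a.fiber ⟶ pull 𝒴 f b.fiber) : a ⟶ b :=
  ⟨f, α⟩

/-- The unit constraint of a presheaf of categories. -/
def pullId {S : C} (x : 𝒴.obj (.mk (op S))) : x ≅ pull 𝒴 (𝟙 S) x :=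
  (Cat.Hom.toNatIso (𝒴.mapId (.mk (op S)))).symm.app x

/-- The composition constraint of a presheaf of categories. -/
def pullComp {S T Z : C} (f : T ⟶ S) (g : Z ⟶ T) (k : Z ⟶ S) (hk : g ≫ f = k)
    (y : 𝒴.obj (.mk (op S))) : pull 𝒴 g (pull 𝒴 f y) ≅ pull 𝒴 k y :=
  (Cat.Hom.toNatIso (𝒴.mapComp' f.op.toLoc g.op.toLoc k.op.toLoc (by rw [← hk]; rfl))).symm.app y

/-- Morphisms of a fiber, seen in the total category. -/
def vert {S : C} {x y : 𝒴.obj (.mk (op S))} (φ : x ⟶ y) : mk x ⟶ mk y :=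
  homMk (𝟙 S) (φ ≫ (pullId y).hom)

/-- The canonical morphism from a pullback. -/
def cart {S T : C} (f : T ⟶ S) (y : 𝒴.obj (.mk (op S))) : mk (pull 𝒴 f y) ⟶ mk y :=
  homMk f (𝟙 _)

@[simp] lemma vert_base {S : C} {x y : 𝒴.obj (.mk (op S))} (φ : x ⟶ y) :
    (vert φ).base = 𝟙 S := rfl

@[simp] lemma cart_base {S T : C} (f : T ⟶ S) (y : 𝒴.obj (.mk (op S))) :
    (cart f y).base = f := rfl

@[simp] lemma comp_base {a b c : Tot 𝒴} (f : a ⟶ b) (g : b ⟶ c) :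
    (f ≫ g).base = f.base ≫ g.base := rfl

lemma homMk_injective {a b : Tot 𝒴} {f : a.base ⟶ b.base} {α β : a.fiber ⟶ pull 𝒴 f b.fiber}
    (h : (homMk f α : a ⟶ b) = homMk f β) : α = β := by
  simpa using Pseudofunctor.CoGrothendieck.Hom.congr h

lemma vert_comp_homMk {S : C} {x y : 𝒴.obj (.mk (op S))} (φ : x ⟶ y) {b : Tot 𝒴}
    (f : S ⟶ b.base) (α : y ⟶ pull 𝒴 f b.fiber) :
    vert φ ≫ (homMk f α : mk y ⟶ b) = homMk f (φ ≫ α) := by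
  have h := Pseudofunctor.CoGrothendieck.Hom.congr (Category.id_comp (homMk f α : mk y ⟶ b))
  refine Pseudofunctor.CoGrothendieck.Hom.ext _ _ (Category.id_comp f) ?_
  refine (Category.assoc φ _ _).trans ((congrArg (φ ≫ ·) h).trans (Category.assoc _ _ _).symm)

lemma cart_comp_vert {S T : C} (f : T ⟶ S) {x y : 𝒴.obj (.mk (op S))} (φ : x ⟶ y) :
    cart f x ≫ vert φ =
      (homMk f ((𝒴.map f.op.toLoc).toFunctor.map φ) : mk (pull 𝒴 f x) ⟶ mk y) := by
  have h := Pseudofunctor.CoGrothendieck.Hom.congr (Category.comp_id (cart f y))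
  refine Pseudofunctor.CoGrothendieck.Hom.ext _ _ (Category.comp_id f) ?_
  have h1 : (cart f x ≫ vert φ).fiber =
    (𝒴.map f.op.toLoc).toFunctor.map φ ≫ (cart f y ≫ 𝟙 _).fiber := by
    refine (Category.id_comp _).trans ?_
    refine Eq.trans ?_ (congrArg (_ ≫ ·) (Category.id_comp _).symm)
    refine Eq.trans ?_ (Category.assoc _ _ _)
    exact congrArg (· ≫ _) ((𝒴.map f.op.toLoc).toFunctor.map_comp φ (pullId y).hom)
  rw [h1]
  refine (congrArg (_ ≫ ·) h).trans ?_
  exact congrArg (_ ≫ ·) (Category.id_comp _)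

lemma vert_comp_cart {S T : C} (f : T ⟶ S) {x : 𝒴.obj (.mk (op T))} {y : 𝒴.obj (.mk (op S))}
    (φ : x ⟶ pull 𝒴 f y) : vert φ ≫ cart f y = (homMk f φ : mk x ⟶ mk y) := by
  refine (vert_comp_homMk (b := mk y) φ f (𝟙 _)).trans ?_
  exact congrArg (fun t => (homMk f t : mk x ⟶ mk y)) (Category.comp_id φ)

lemma vert_map_comp_cart {S T : C} (f : T ⟶ S) {x y : 𝒴.obj (.mk (op S))} (φ : x ⟶ y) :
    vert ((𝒴.map f.op.toLoc).toFunctor.map φ) ≫ cart f y = cart f x ≫ vert φ := by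
  rw [vert_comp_cart, cart_comp_vert]

lemma vert_map_comp_cart_assoc {S T : C} (f : T ⟶ S) {x y : 𝒴.obj (.mk (op S))} (φ : x ⟶ y)
    {c : Tot 𝒴} (h : mk y ⟶ c) :
    vert ((𝒴.map f.op.toLoc).toFunctor.map φ) ≫ cart f y ≫ h = cart f x ≫ vert φ ≫ h := by
  rw [← Category.assoc, vert_map_comp_cart, Category.assoc]

@[simp] lemma vert_id {S : C} (x : 𝒴.obj (.mk (op S))) : vert (𝟙 x) = 𝟙 (mk x) := by
  unfold vert
  rw [Category.id_comp]
  rfl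

@[simp]
lemma vert_comp {S : C} {x y z : 𝒴.obj (.mk (op S))} (φ : x ⟶ y) (ψ : y ⟶ z) :
    vert (φ ≫ ψ) = vert φ ≫ vert ψ := by
  conv_rhs => rw [vert.eq_def ψ, vert_comp_homMk]
  rw [vert, Category.assoc]

@[simp]
lemma vert_comp_assoc {S : C} {x y z : 𝒴.obj (.mk (op S))} (φ : x ⟶ y) (ψ : y ⟶ z)
    {c : Tot 𝒴} (h : mk z ⟶ c) : vert (φ ≫ ψ) ≫ h = vert φ ≫ vert ψ ≫ h := by
  rw [vert_comp, Category.assoc]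

lemma vert_injective {S : C} {x y : 𝒴.obj (.mk (op S))} {φ ψ : x ⟶ y} (h : vert φ = vert ψ) :
    φ = ψ := by
  exact (cancel_mono (pullId y).hom).mp (homMk_injective h)

/-- Used to turn coherence identities in the fibers into ordinary commutative diagrams of the total
category, where the pseudofunctor constraints are absorbed into composition. -/
lemma eq_of_vert_comp_cart {S T : C} {f : T ⟶ S} {x : 𝒴.obj (.mk (op T))}
    {y : 𝒴.obj (.mk (op S))} {φ ψ : x ⟶ pull 𝒴 f y} (h : vert φ ≫ cart f y = vert ψ ≫ cart f y) :
    φ = ψ := by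
  rw [vert_comp_cart, vert_comp_cart] at h
  exact homMk_injective h

lemma vert_fiber_comp_cart {a b : Tot 𝒴} (m : a ⟶ b) {f : a.base ⟶ b.base} (hf : m.base = f) :
    vert (x := a.fiber) (y := pull 𝒴 f b.fiber) (m.fiber ≫ eqToHom (by rw [hf])) ≫
      cart f b.fiber = m := by
  subst hf
  rw [eqToHom_refl, Category.comp_id, vert_comp_cart]; rfl

/-- The fiber component of a morphism over `f`. -/
def fiberOver {a b : Tot 𝒴} (m : a ⟶ b) (f : a.base ⟶ b.base) (hf : m.base = f) :
    a.fiber ⟶ pull 𝒴 f b.fiber :=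
  m.fiber ≫ eqToHom (by rw [hf])

@[simp]
lemma vert_fiberOver_comp_cart {a b : Tot 𝒴} (m : a ⟶ b) (f : a.base ⟶ b.base) (hf : m.base = f) :
    vert (fiberOver m f hf) ≫ cart f b.fiber = m :=
  vert_fiber_comp_cart m hf

-- The composition constraint is characterized by the cartesian arrows; this is how `pullComp` gets
-- eliminated.
@[simp]
lemma vert_pullComp_hom_comp_cart {S T Z : C} (f : T ⟶ S) (g : Z ⟶ T) (k : Z ⟶ S)
    (hk : g ≫ f = k) (y : 𝒴.obj (.mk (op S))) :
    vert (pullComp f g k hk y).hom ≫ cart k y = cart g (pull 𝒴 f y) ≫ cart f y := by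
  subst hk
  rw [vert_comp_cart]
  refine Pseudofunctor.CoGrothendieck.Hom.ext _ _ rfl ?_
  refine Eq.trans ?_ (Category.comp_id _).symm
  refine Eq.trans ?_ (Category.id_comp _).symm
  refine Eq.trans ?_ (congrArg (· ≫ _) ((𝒴.map g.op.toLoc).toFunctor.map_id (pull 𝒴 f y)).symm)
  refine Eq.trans ?_ (Category.id_comp _).symm
  exact congrArg (fun t => t.inv.toNatTrans.app y) (𝒴.mapComp'_eq_mapComp f.op.toLoc g.op.toLoc)

@[simp]
lemma vert_pullComp_hom_comp_cart_assoc {S T Z : C} (f : T ⟶ S) (g : Z ⟶ T) (k : Z ⟶ S)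
    (hk : g ≫ f = k) (y : 𝒴.obj (.mk (op S))) {c : Tot 𝒴} (h : mk y ⟶ c) :
    vert (pullComp f g k hk y).hom ≫ cart k y ≫ h = cart g (pull 𝒴 f y) ≫ cart f y ≫ h := by
  rw [← Category.assoc, vert_pullComp_hom_comp_cart, Category.assoc]

@[simp]
lemma vert_pullComp_inv_comp_cart {S T Z : C} (f : T ⟶ S) (g : Z ⟶ T) (k : Z ⟶ S)
    (hk : g ≫ f = k) (y : 𝒴.obj (.mk (op S))) :
    vert (pullComp f g k hk y).inv ≫ cart g (pull 𝒴 f y) ≫ cart f y = cart k y := by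
  rw [← vert_pullComp_hom_comp_cart f g k hk, ← vert_comp_assoc, Iso.inv_hom_id, vert_id,
    Category.id_comp]

@[simp]
lemma vert_pullComp_inv_comp_cart_assoc {S T Z : C} (f : T ⟶ S) (g : Z ⟶ T) (k : Z ⟶ S)
    (hk : g ≫ f = k) (y : 𝒴.obj (.mk (op S))) {c : Tot 𝒴} (h : mk y ⟶ c) :
    vert (pullComp f g k hk y).inv ≫ cart g (pull 𝒴 f y) ≫ cart f y ≫ h = cart k y ≫ h := by
  rw [← vert_pullComp_inv_comp_cart f g k hk]
  simp only [Category.assoc]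

@[simp]
lemma vert_pullId_hom_comp_cart {S : C} (y : 𝒴.obj (.mk (op S))) :
    vert (pullId y).hom ≫ cart (𝟙 S) y = 𝟙 (mk y) := by
  rw [vert_comp_cart]; rfl

section Groupoid

variable (h𝒴 : IsGroupoidValued 𝒴)
include h𝒴

/-- The uniqueness half of the fact that every arrow is cartesian: fiber components are invertible
and can be cancelled. -/
lemma hom_ext_of_comp {a b c : Tot 𝒴} (g : b ⟶ c) {l l' : a ⟶ b} (hb : l.base = l'.base)
    (h : l ≫ g = l' ≫ g) : l = l' := by
  have h1 : ∀ m : a ⟶ b, (m ≫ g) = (homMk (m.base ≫ g.base) (m.fiber ≫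
    (𝒴.map m.base.op.toLoc).toFunctor.map g.fiber ≫
      (𝒴.mapComp g.base.op.toLoc m.base.op.toLoc).inv.toNatTrans.app c.fiber) : a ⟶ c) :=
    fun _ => rfl
  obtain ⟨k, α⟩ := l
  obtain ⟨k', β⟩ := l'
  obtain rfl : k = k' := hb
  have h2 := homMk_injective h
  have := h𝒴 a.base
  have h3 := IsGroupoid.all_isIso ((𝒴.map k.op.toLoc).toFunctor.map g.fiber ≫
      (𝒴.mapComp g.base.op.toLoc k.op.toLoc).inv.toNatTrans.app c.fiber)
  congr 1
  exact (cancel_mono _).mp h2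

/-- The existence half: the lift is obtained by inverting the pullback of the vertical part of `g`.
-/
lemma exists_lift {a b c : Tot 𝒴} (g : b ⟶ c) (h : a ⟶ c) (k : a.base ⟶ b.base)
    (hk : k ≫ g.base = h.base) : ∃ l : a ⟶ b, l.base = k ∧ l ≫ g = h := by
  have := h𝒴 a.base
  have := IsGroupoid.all_isIso ((𝒴.map k.op.toLoc).toFunctor.map (fiberOver g g.base rfl))
  refine ⟨vert (fiberOver h (k ≫ g.base) hk.symm ≫
    (pullComp g.base k (k ≫ g.base) rfl c.fiber).inv ≫
      inv ((𝒴.map k.op.toLoc).toFunctor.map (fiberOver g g.base rfl))) ≫ cart k b.fiber,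
    Category.id_comp k, ?_⟩
  have h1 : vert (inv ((𝒴.map k.op.toLoc).toFunctor.map (fiberOver g g.base rfl))) ≫
      cart k b.fiber ≫ g = cart k _ ≫ cart g.base c.fiber := by
    have h0 : cart k b.fiber ≫ g =
        vert ((𝒴.map k.op.toLoc).toFunctor.map (fiberOver g g.base rfl)) ≫
          cart k _ ≫ cart g.base c.fiber := by
      rw [vert_map_comp_cart_assoc, vert_fiberOver_comp_cart]
    rw [h0, ← vert_comp_assoc, IsIso.inv_hom_id, vert_id, Category.id_comp]
  rw [vert_comp, vert_comp]
  simp only [Category.assoc]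
  rw [h1, vert_pullComp_inv_comp_cart]
  exact vert_fiberOver_comp_cart h (k ≫ g.base) hk.symm

end Groupoid

end Tot

end Total

/-! ### Descent for stacks, in terms of the total category. -/

section Gluing

variable {C : Type u₁} [Category.{v₁} C]

namespace Tot

variable {𝒴 : PreStk.{w, w'} C}

/-- The morphism `f` is a covering for the topology `J`. -/
def IsCovering (J : GrothendieckTopology C) {S T : C} (f : T ⟶ S) : Prop :=
  Sieve.generate (Presieve.singleton f) ∈ J S

lemma IsCovering.ofArrows_mem {J : GrothendieckTopology C} {S T : C} {f : T ⟶ S}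
    (hf : IsCovering J f) : Sieve.ofArrows (fun _ : Unit => T) (fun _ : Unit => f) ∈ J S := by
  rw [Sieve.ofArrows, Presieve.ofArrows_pUnit]
  exact hf

variable {J : GrothendieckTopology C} (h𝒴 : IsGroupoidStack J 𝒴)
include h𝒴

/-- Replaces an arbitrary arrow by the cartesian one over the same base, to which the descent
property of the stack applies directly. -/
lemma exists_comp_eq_cart {a' a : Tot 𝒴} (u : a' ⟶ a) :
    ∃ l : mk (pull 𝒴 u.base a.fiber) ⟶ a', l.base = 𝟙 _ ∧ l ≫ u = cart u.base a.fiber ∧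
      vert (fiberOver u u.base rfl) ≫ l = 𝟙 _ := by
  obtain ⟨l, hl, hl'⟩ := exists_lift h𝒴.isGroupoidValued u (cart u.base a.fiber) (𝟙 _)
    (Category.id_comp _)
  refine ⟨l, hl, hl', hom_ext_of_comp h𝒴.isGroupoidValued u ?_ ?_⟩
  · exact (Category.id_comp _).trans hl
  · rw [Category.assoc, hl', Category.id_comp]
    exact vert_fiberOver_comp_cart u u.base rfl

/-- Morphisms of the total category of a stack are determined locally. -/
lemma hom_ext_of_isCovering {a' a b : Tot 𝒴} (u : a' ⟶ a) (hu : IsCovering J u.base)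
    {m m' : a ⟶ b} (hb : m.base = m'.base) (h : u ≫ m = u ≫ m') : m = m' := by
  have := h𝒴.isStack
  have hff := 𝒴.fullyFaithfulToDescentData (J := J) _ hu.ofArrows_mem
  obtain ⟨l, -, hl, -⟩ := exists_comp_eq_cart h𝒴 u
  have key : fiberOver m m.base rfl = fiberOver m' m.base hb.symm := by
    apply hff.map_injective
    ext i
    apply eq_of_vert_comp_cart (f := u.base)
    refine (vert_map_comp_cart u.base _).trans (Eq.trans ?_ (vert_map_comp_cart u.base _).symm)
    refine hom_ext_of_comp h𝒴.isGroupoidValued (cart m.base b.fiber) (by rfl) ?_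
    rw [Category.assoc, Category.assoc]
    refine (congrArg (cart u.base a.fiber ≫ ·) (vert_fiberOver_comp_cart m m.base rfl)).trans
      (Eq.trans ?_ (congrArg (cart u.base a.fiber ≫ ·)
        (vert_fiberOver_comp_cart m' m.base hb.symm)).symm)
    change cart u.base a.fiber ≫ m = cart u.base a.fiber ≫ m'
    rw [← hl, Category.assoc, Category.assoc, h]
  rw [← vert_fiberOver_comp_cart m m.base rfl, key]
  exact vert_fiberOver_comp_cart m' m.base hb.symm

/-- Morphisms of the total category of a stack can be glued. -/
lemma exists_desc {a' a b : Tot 𝒴} (u : a' ⟶ a) (hu : IsCovering J u.base) (f : a.base ⟶ b.base)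
    (n : a' ⟶ b) (hn : n.base = u.base ≫ f)
    (h : ∀ (z : Tot 𝒴) (k₁ k₂ : z ⟶ a'), k₁ ≫ u = k₂ ≫ u → k₁ ≫ n = k₂ ≫ n) :
    ∃ m : a ⟶ b, m.base = f ∧ u ≫ m = n := by
  have := h𝒴.isStack
  have hff := 𝒴.fullyFaithfulToDescentData (J := J) _ hu.ofArrows_mem
  obtain ⟨l, hl₀, hl, hl'⟩ := exists_comp_eq_cart h𝒴 u
  have hln : (l ≫ n).base = u.base ≫ f := by
    rw [comp_base, hl₀, hn]; exact Category.id_comp _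
  -- `φ` is the vertical part of `n` after `a'` has been identified with the pullback of `a`. The
  -- hypothesis `h` on parallel pairs becomes its compatibility with the canonical descent data.
  let φ : pull 𝒴 u.base a.fiber ⟶ pull 𝒴 u.base (pull 𝒴 f b.fiber) :=
    fiberOver (l ≫ n) (u.base ≫ f) hln ≫ (pullComp f u.base (u.base ≫ f) rfl b.fiber).inv
  have hφ : vert φ ≫ cart u.base _ ≫ cart f b.fiber = l ≫ n := by
    rw [vert_comp, Category.assoc, vert_pullComp_inv_comp_cart]
    exact vert_fiberOver_comp_cart (l ≫ n) (u.base ≫ f) hln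
  let Φ : (𝒴.toDescentData (fun _ : Unit => u.base)).obj a.fiber ⟶
      (𝒴.toDescentData (fun _ : Unit => u.base)).obj (pull 𝒴 f b.fiber) :=
    { hom := fun _ => φ
      comm := fun Y q i₁ i₂ f₁ f₂ hf₁ hf₂ => by
        change (𝒴.map f₁.op.toLoc).toFunctor.map φ ≫
          (pullComp u.base f₁ q hf₁ (pull 𝒴 f b.fiber)).hom ≫
            (pullComp u.base f₂ q hf₂ (pull 𝒴 f b.fiber)).inv =
          ((pullComp u.base f₁ q hf₁ a.fiber).hom ≫ (pullComp u.base f₂ q hf₂ a.fiber).inv) ≫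
            (𝒴.map f₂.op.toLoc).toFunctor.map φ
        apply eq_of_vert_comp_cart
        refine hom_ext_of_comp h𝒴.isGroupoidValued (cart u.base _ ≫ cart f b.fiber) (by rfl) ?_
        simp only [vert_comp, Category.assoc, vert_pullComp_inv_comp_cart_assoc,
          vert_pullComp_hom_comp_cart_assoc, vert_map_comp_cart_assoc]
        rw [hφ]
        have := h _ (cart f₁ _ ≫ l) (vert (pullComp u.base f₁ q hf₁ a.fiber).hom ≫
          vert (pullComp u.base f₂ q hf₂ a.fiber).inv ≫ cart f₂ _ ≫ l) (by
            simp only [Category.assoc]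
            rw [hl, vert_pullComp_inv_comp_cart, vert_pullComp_hom_comp_cart])
        simpa only [Category.assoc] using this }
  obtain ⟨m₀, hm₀⟩ := hff.map_surjective Φ
  have hm₀' : (𝒴.map u.base.op.toLoc).toFunctor.map m₀ = φ :=
    congrArg (fun t => Pseudofunctor.DescentData.Hom.hom t ()) hm₀
  refine ⟨vert m₀ ≫ cart f b.fiber, Category.id_comp f, ?_⟩
  have h1 : cart u.base a.fiber ≫ vert m₀ ≫ cart f b.fiber = l ≫ n := by
    rw [← vert_map_comp_cart_assoc, hm₀', hφ]
  have h2 : u = vert (fiberOver u u.base rfl) ≫ cart u.base a.fiber :=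
    (vert_fiberOver_comp_cart u u.base rfl).symm
  calc u ≫ vert m₀ ≫ cart f b.fiber
      = vert (fiberOver u u.base rfl) ≫ cart u.base a.fiber ≫ vert m₀ ≫ cart f b.fiber := by
        conv_lhs => rw [h2]
        exact Category.assoc _ _ _
    _ = n := by
        rw [h1, ← Category.assoc]
        exact (congrArg (· ≫ n) hl').trans (Category.id_comp n)

/-- Descent is effective in the total category of a stack. -/
lemma exists_descent {X T : C} (u : X ⟶ T) (hu : IsCovering J u) (x : 𝒴.obj (.mk (op X)))
    (τ : ∀ {z : Tot 𝒴} (k : z ⟶ mk x) (f : z.base ⟶ X), k.base ≫ u = f ≫ u → (z ⟶ mk x))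
    (τ_base : ∀ {z : Tot 𝒴} (k : z ⟶ mk x) (f : z.base ⟶ X) (h : k.base ≫ u = f ≫ u),
      (τ k f h).base = f)
    (τ_comp : ∀ {z' z : Tot 𝒴} (l : z' ⟶ z) (k : z ⟶ mk x) (f : z.base ⟶ X)
      (h : k.base ≫ u = f ≫ u) (k' : z' ⟶ mk x) (f' : z'.base ⟶ X) (h' : k'.base ≫ u = f' ≫ u),
      k' = l ≫ k → f' = l.base ≫ f → τ k' f' h' = l ≫ τ k f h)
    (τ_self : ∀ {z : Tot 𝒴} (k : z ⟶ mk x), τ k k.base rfl = k)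
    (τ_trans : ∀ {z : Tot 𝒴} (k : z ⟶ mk x) (f f' : z.base ⟶ X) (h : k.base ≫ u = f ≫ u)
      (h' : (τ k f h).base ≫ u = f' ≫ u) (h'' : k.base ≫ u = f' ≫ u),
      τ (τ k f h) f' h' = τ k f' h'') :
    ∃ (y : 𝒴.obj (.mk (op T))) (m : mk x ⟶ mk y), m.base = u ∧
      ∀ {z : Tot 𝒴} (k : z ⟶ mk x) (f : z.base ⟶ X) (h : k.base ≫ u = f ≫ u),
        τ k f h ≫ m = k ≫ m := by
  have := h𝒴.isStack
  have hes := 𝒴.isEquivalence_toDescentData (J := J) _ hu.ofArrows_mem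
  have hc : ∀ {Y : C} {q : Y ⟶ T} {f₁ f₂ : Y ⟶ X}, f₁ ≫ u = q → f₂ ≫ u = q →
    (cart (𝒴 := 𝒴) f₁ x).base ≫ u = f₂ ≫ u := fun h h' => h.trans h'.symm
  have hv : ∀ {Y : C} {q : Y ⟶ T} {f₁ f₂ : Y ⟶ X} (hf₁ : f₁ ≫ u = q) (hf₂ : f₂ ≫ u = q),
    vert (fiberOver (τ (cart f₁ x) f₂ (hc hf₁ hf₂)) f₂ (τ_base _ _ _)) ≫ cart f₂ x =
      τ (cart f₁ x) f₂ (hc hf₁ hf₂) := fun _ _ => vert_fiberOver_comp_cart _ _ _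
  -- `τ k f` regards the source of `k`, a pullback of `x`, as a pullback along `f` instead. The
  -- gluing isomorphism for `(f₁, f₂)` is therefore the vertical part of `τ (cart f₁ x) f₂`;
  -- `τ_comp`, `τ_self` and `τ_trans` are stability under base change, normalization and the cocycle
  -- condition.
  let D : 𝒴.DescentData (fun _ : Unit => u) :=
    { obj := fun _ => x
      hom := fun Y q i₁ i₂ f₁ f₂ hf₁ hf₂ =>
        fiberOver (τ (cart f₁ x) f₂ (hc hf₁ hf₂)) f₂ (τ_base _ _ _)
      pullHom_hom := fun Y' Y g q q' hq i₁ i₂ f₁ f₂ hf₁ hf₂ gf₁ gf₂ hgf₁ hgf₂ => by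
        change (pullComp f₁ g gf₁ hgf₁ x).inv ≫ (𝒴.map g.op.toLoc).toFunctor.map
          (fiberOver (τ (cart f₁ x) f₂ (hc hf₁ hf₂)) f₂ (τ_base _ _ _)) ≫
            (pullComp f₂ g gf₂ hgf₂ x).hom = _
        apply eq_of_vert_comp_cart
        simp only [vert_comp, Category.assoc, vert_pullComp_hom_comp_cart,
          vert_map_comp_cart_assoc]
        rw [hv hf₁ hf₂]
        refine Eq.trans ?_ (hv (q := q') (by rw [← hgf₁, Category.assoc, hf₁, hq])
          (by rw [← hgf₂, Category.assoc, hf₂, hq])).symm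
        rw [← Category.assoc]
        refine (τ_comp _ _ _ _ _ _ _ ?_ ?_).symm
        · rw [Category.assoc, vert_pullComp_inv_comp_cart]
        · rw [← hgf₂]
          exact congrArg (· ≫ f₂) (Category.id_comp g).symm
      hom_self := fun Y q i g hg => by
        apply eq_of_vert_comp_cart
        rw [hv hg hg, vert_id, Category.id_comp]
        exact τ_self (cart g x)
      hom_comp := fun Y q i₁ i₂ i₃ f₁ f₂ f₃ hf₁ hf₂ hf₃ => by
        apply eq_of_vert_comp_cart
        rw [hv hf₁ hf₃, vert_comp, Category.assoc, hv hf₂ hf₃,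
          ← τ_trans (cart f₁ x) f₂ f₃ (hc hf₁ hf₂) (by rw [τ_base, hf₂, hf₃]) (hc hf₁ hf₃)]
        refine (τ_comp _ _ _ _ _ _ _ ?_ ?_).symm
        · rw [hv hf₁ hf₂]
        · exact (Category.id_comp f₃).symm }
  obtain ⟨y, ⟨e⟩⟩ := hes.essSurj.mem_essImage D
  let α : x ⟶ pull 𝒴 u y := e.inv.hom ()
  refine ⟨y, vert α ≫ cart u y, Category.id_comp u, fun {z} k f h => ?_⟩
  -- For cartesian `k` the claim is the compatibility of `α` with descent data; every other `k`
  -- differs from a cartesian arrow by a vertical one, which `τ_comp` moves out.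
  have hcart : ∀ {Y : C} (f₁ f₂ : Y ⟶ X) (hf : f₁ ≫ u = f₂ ≫ u),
      τ (cart f₁ x) f₂ hf ≫ vert α ≫ cart u y = cart f₁ x ≫ vert α ≫ cart u y := by
    intro Y f₁ f₂ hf
    have hcomm : (𝒴.map f₁.op.toLoc).toFunctor.map α ≫ (pullComp u f₁ (f₂ ≫ u) hf y).hom ≫
        (pullComp u f₂ (f₂ ≫ u) rfl y).inv =
        fiberOver (τ (cart f₁ x) f₂ (hc hf rfl)) f₂ (τ_base _ _ _) ≫
          (𝒴.map f₂.op.toLoc).toFunctor.map α :=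
      e.inv.comm (f₂ ≫ u) (i₁ := ()) (i₂ := ()) f₁ f₂ hf rfl
    have := congrArg (fun t => vert t ≫ cart f₂ _ ≫ cart u y) hcomm
    simp only [vert_comp, Category.assoc, vert_pullComp_inv_comp_cart,
      vert_pullComp_hom_comp_cart, vert_map_comp_cart_assoc] at this
    rw [this, ← Category.assoc (vert (fiberOver _ _ _)), hv hf rfl]
  have hk : k = vert (fiberOver k k.base rfl) ≫ cart k.base x :=
    (vert_fiberOver_comp_cart k k.base rfl).symm
  rw [τ_comp (vert (fiberOver k k.base rfl)) (cart k.base x) f h k f h hk (Category.id_comp f).symm,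
    Category.assoc, hcart k.base f h, ← Category.assoc]
  exact congrArg (· ≫ vert α ≫ cart u y) hk.symm

end Tot

end Gluing

/-! ### Sections over a category lying over the base. -/

section Sections

variable {C : Type u₁} [Category.{v₁} C] {A : Type u₂} [Category.{v₂} A]

/-- Cartesian sections over `π : A ⥤ C` of a presheaf of categories `𝒴` on `C`. -/
structure Sec (π : A ⥤ C) (𝒴 : PreStk.{w, w'} C) where
  /-- the value of the section -/
  fib (a : A) : 𝒴.obj (.mk (op (π.obj a)))
  /-- the action on morphisms -/
  map {a b : A} (f : a ⟶ b) : Tot.mk (fib a) ⟶ Tot.mk (fib b)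
  map_base {a b : A} (f : a ⟶ b) : (map f).base = π.map f
  map_id (a : A) : map (𝟙 a) = 𝟙 _
  map_comp {a b c : A} (f : a ⟶ b) (g : b ⟶ c) : map (f ≫ g) = map f ≫ map g

namespace Sec

attribute [simp] map_base map_id
attribute [simp] map_comp

variable {π : A ⥤ C} {𝒴 : PreStk.{w, w'} C}

/-- Morphisms of sections. -/
@[ext]
structure Hom (y y' : Sec π 𝒴) where
  /-- the components -/
  app (a : A) : Tot.mk (y.fib a) ⟶ Tot.mk (y'.fib a)
  app_base (a : A) : (app a).base = 𝟙 _
  naturality {a b : A} (f : a ⟶ b) : y.map f ≫ app b = app a ≫ y'.map f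

attribute [simp] Hom.app_base
lemma Hom.naturality_assoc {y y' : Sec π 𝒴} (φ : Hom y y') {a b : A} (f : a ⟶ b) {c : Tot 𝒴}
    (h : Tot.mk (y'.fib b) ⟶ c) : y.map f ≫ φ.app b ≫ h = φ.app a ≫ y'.map f ≫ h := by
  rw [← Category.assoc, φ.naturality, Category.assoc]

instance : Category (Sec π 𝒴) where
  Hom := Hom
  id y :=
    { app _ := 𝟙 _
      app_base _ := rfl
      naturality _ := by rw [Category.id_comp, Category.comp_id] }
  comp φ ψ :=
    { app a := φ.app a ≫ ψ.app a
      app_base a := by rw [Tot.comp_base, φ.app_base, ψ.app_base]; exact Category.comp_id _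
      naturality f := by
        rw [φ.naturality_assoc, ψ.naturality, Category.assoc] }
  id_comp _ := Hom.ext (funext fun _ => Category.id_comp _)
  comp_id _ := Hom.ext (funext fun _ => Category.comp_id _)
  assoc _ _ _ := Hom.ext (funext fun _ => Category.assoc _ _ _)

@[ext]
lemma hom_ext {y y' : Sec π 𝒴} {φ ψ : y ⟶ y'} (h : ∀ a, φ.app a = ψ.app a) : φ = ψ :=
  Hom.ext (funext h)

/-- Morphisms between sections of presheaves of groupoids are isomorphisms. -/
def isoOfHom (h𝒴 : IsGroupoidValued 𝒴) {y y' : Sec π 𝒴} (φ : y ⟶ y') : y ≅ y' := by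
  have h (a : A) : ∃ ψ : Tot.mk (y'.fib a) ⟶ Tot.mk (y.fib a), ψ.base = 𝟙 _ ∧
      ψ ≫ φ.app a = 𝟙 _ :=
    Tot.exists_lift h𝒴 (φ.app a) (𝟙 _) (𝟙 _) (by rw [φ.app_base]; exact Category.comp_id _)
  choose ψ hψ hψ' using h
  have hψ'' (a : A) : φ.app a ≫ ψ a = 𝟙 _ := by
    refine Tot.hom_ext_of_comp h𝒴 (φ.app a) ?_ ?_
    · rw [Tot.comp_base, hψ, φ.app_base]; exact Category.comp_id _
    · rw [Category.assoc, hψ', Category.comp_id, Category.id_comp]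
  exact
    { hom := φ
      inv :=
        { app := ψ
          app_base := hψ
          naturality := fun {a b} f => by
            calc y'.map f ≫ ψ b = (ψ a ≫ φ.app a) ≫ y'.map f ≫ ψ b := by
                  rw [hψ', Category.id_comp]
              _ = ψ a ≫ (φ.app a ≫ y'.map f) ≫ ψ b := by simp only [Category.assoc]
              _ = ψ a ≫ y.map f := by
                  rw [← φ.naturality, Category.assoc, hψ'', Category.comp_id] }
      hom_inv_id := hom_ext hψ''
      inv_hom_id := hom_ext hψ' }

/-- The restriction of sections. -/
def pre {B : Type u₃} [Category.{v₃} B] (j : B ⥤ A) (π : A ⥤ C) (𝒴 : PreStk.{w, w'} C) :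
    Sec π 𝒴 ⥤ Sec (j ⋙ π) 𝒴 where
  obj y :=
    { fib b := y.fib (j.obj b)
      map f := y.map (j.map f)
      map_base f := y.map_base (j.map f)
      map_id b := by rw [j.map_id]; exact y.map_id _
      map_comp f g := by rw [j.map_comp]; exact y.map_comp _ _ }
  map φ :=
    { app b := φ.app (j.obj b)
      app_base b := φ.app_base (j.obj b)
      naturality f := φ.naturality (j.map f) }

end Sec

end Sections

/-! ### Pairs of objects of `𝒳` and `𝒴` over the same base, with gluing relative to `𝒳`. -/

section Pairs

variable {C : Type u₁} [Category.{v₁} C]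

/-- Pairs of sections of two presheaves of categories over the same object. -/
structure Pair (𝒳 : PreStk.{v, u} C) (𝒴 : PreStk.{w, w'} C) where
  /-- the first component -/
  pt : Tot 𝒳
  /-- the second component -/
  fib : 𝒴.obj (.mk (op pt.base))

namespace Pair

variable {𝒳 : PreStk.{v, u} C} {𝒴 : PreStk.{w, w'} C}

/-- The second component of a pair, seen in the total category. -/
abbrev tot (a : Pair 𝒳 𝒴) : Tot 𝒴 := Tot.mk a.fib

/-- Morphisms of pairs. -/
@[ext]
structure Hom (a b : Pair 𝒳 𝒴) where
  /-- the first component -/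
  left : a.pt ⟶ b.pt
  /-- the second component -/
  right : a.tot ⟶ b.tot
  w : right.base = left.base

instance : Category (Pair 𝒳 𝒴) where
  Hom := Hom
  id a := ⟨𝟙 _, 𝟙 _, rfl⟩
  comp f g := ⟨f.left ≫ g.left, f.right ≫ g.right, by
    rw [Tot.comp_base, Tot.comp_base, f.w, g.w]⟩
  id_comp f := Hom.ext (Category.id_comp _) (Category.id_comp _)
  comp_id f := Hom.ext (Category.comp_id _) (Category.comp_id _)
  assoc f g h := Hom.ext (Category.assoc _ _ _) (Category.assoc _ _ _)

@[simp] lemma id_left (a : Pair 𝒳 𝒴) : Hom.left (𝟙 a) = 𝟙 _ := rfl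

@[simp] lemma comp_left {a b c : Pair 𝒳 𝒴} (f : a ⟶ b) (g : b ⟶ c) :
    (f ≫ g).left = f.left ≫ g.left := rfl

lemma hom_ext {a b : Pair 𝒳 𝒴} {f g : a ⟶ b} (h : f.left = g.left) (h' : f.right = g.right) :
    f = g :=
  Hom.ext h h'

/-- The pullback of a pair. -/
def pb {e : Tot 𝒳} (c : Pair 𝒳 𝒴) (f : e ⟶ c.pt) : Pair 𝒳 𝒴 := ⟨e, pull 𝒴 f.base c.fib⟩

/-- The canonical morphism from the pullback of a pair. -/
def pbHom {e : Tot 𝒳} (c : Pair 𝒳 𝒴) (f : e ⟶ c.pt) : c.pb f ⟶ c := ⟨f, Tot.cart f.base c.fib, rfl⟩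

section

variable (h𝒴 : IsGroupoidValued 𝒴)
include h𝒴

/-- Together with `exists_lift` this says that every arrow is cartesian for the projection of pairs
to the total category of `𝒳`. -/
lemma hom_ext_of_comp {a b c : Pair 𝒳 𝒴} (g : b ⟶ c) {l l' : a ⟶ b} (hl : l.left = l'.left)
    (h : l ≫ g = l' ≫ g) : l = l' :=
  hom_ext hl (Tot.hom_ext_of_comp h𝒴 g.right (by rw [l.w, l'.w, hl])
    (congrArg (fun t => t.right) h))

lemma exists_lift {a b c : Pair 𝒳 𝒴} (g : b ⟶ c) (h : a ⟶ c) (k : a.pt ⟶ b.pt)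
    (hk : k ≫ g.left = h.left) : ∃ l : a ⟶ b, l.left = k ∧ l ≫ g = h := by
  obtain ⟨l, hl, hl'⟩ := Tot.exists_lift h𝒴 g.right h.right k.base (by
    rw [g.w, h.w, ← hk]; rfl)
  exact ⟨⟨k, l, hl⟩, rfl, hom_ext hk hl'⟩

end

/-- A morphism of pairs is a covering for the topology `J`. -/
def IsCov (J : GrothendieckTopology C) {a b : Pair 𝒳 𝒴} (f : a ⟶ b) : Prop :=
  Tot.IsCovering J f.left.base

section

variable {J : GrothendieckTopology C} (h𝒳 : IsGroupoidValued 𝒳) (h𝒴 : IsGroupoidStack J 𝒴)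

include h𝒴 in
lemma hom_ext_of_isCov {a' a b : Pair 𝒳 𝒴} (u : a' ⟶ a) (hu : IsCov J u)
    {m m' : a ⟶ b} (hl : m.left = m'.left) (h : u ≫ m = u ≫ m') : m = m' := by
  refine hom_ext hl (Tot.hom_ext_of_isCovering h𝒴 u.right ?_ (by rw [m.w, m'.w, hl])
    (congrArg (fun t => t.right) h))
  rw [u.w]
  exact hu

include h𝒳

/-- Test objects for descent in `𝒴` carry no object of `𝒳`. Pulling back `a'.pt` along the first
arrow supplies one, and the second arrow then lifts because both agree over `e`. -/
lemma exists_pair_lift {a' : Pair 𝒳 𝒴} {e : Tot 𝒳} (p : a'.pt ⟶ e) {z : Tot 𝒴}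
    (k₁ : z ⟶ a'.tot) (f₂ : z.base ⟶ a'.pt.base) (h : k₁.base ≫ p.base = f₂ ≫ p.base) :
    ∃ (κ : Tot.mk (pull 𝒳 k₁.base a'.pt.fiber) ⟶ a'.pt), κ.base = f₂ ∧
      κ ≫ p = Tot.cart k₁.base a'.pt.fiber ≫ p :=
  Tot.exists_lift h𝒳 p (Tot.cart k₁.base a'.pt.fiber ≫ p) f₂ h.symm

include h𝒴

lemma exists_desc {a' a b : Pair 𝒳 𝒴} (u : a' ⟶ a) (hu : IsCov J u) (f : a.pt ⟶ b.pt)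
    (n : a' ⟶ b) (hn : n.left = u.left ≫ f)
    (h : ∀ (z : Pair 𝒳 𝒴) (k₁ k₂ : z ⟶ a'), k₁ ≫ u = k₂ ≫ u → k₁ ≫ n = k₂ ≫ n) :
    ∃ m : a ⟶ b, m.left = f ∧ u ≫ m = n := by
  obtain ⟨m, hm, hm'⟩ := Tot.exists_desc h𝒴 u.right (by rw [u.w]; exact hu) f.base n.right
    (by rw [n.w, hn, u.w]; rfl) (fun z k₁ k₂ hk => by
      obtain ⟨κ, hκ, hκ'⟩ := exists_pair_lift h𝒳 u.left k₁ k₂.base (by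
        rw [← u.w]; exact congrArg (fun t => t.base) hk)
      have := h ⟨Tot.mk (pull 𝒳 k₁.base a'.pt.fiber), z.fiber⟩
        ⟨Tot.cart k₁.base a'.pt.fiber, k₁, rfl⟩ ⟨κ, k₂, hκ.symm⟩ (hom_ext hκ'.symm hk)
      exact congrArg (fun t => t.right) this)
  exact ⟨⟨f, m, hm⟩, rfl, hom_ext hn.symm hm'⟩

lemma exists_descent {a : Pair 𝒳 𝒴} {e : Tot 𝒳} (u : a.pt ⟶ e) (hu : Tot.IsCovering J u.base)
    (τ : ∀ {z : Pair 𝒳 𝒴} (k : z ⟶ a) (f : z.pt ⟶ a.pt), k.left ≫ u = f ≫ u → (z ⟶ a))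
    (τ_left : ∀ {z : Pair 𝒳 𝒴} (k : z ⟶ a) (f : z.pt ⟶ a.pt) (h : k.left ≫ u = f ≫ u),
      (τ k f h).left = f)
    (τ_comp : ∀ {z' z : Pair 𝒳 𝒴} (l : z' ⟶ z) (k : z ⟶ a) (f : z.pt ⟶ a.pt)
      (h : k.left ≫ u = f ≫ u) (k' : z' ⟶ a) (f' : z'.pt ⟶ a.pt) (h' : k'.left ≫ u = f' ≫ u),
      k' = l ≫ k → f' = l.left ≫ f → τ k' f' h' = l ≫ τ k f h)
    (τ_self : ∀ {z : Pair 𝒳 𝒴} (k : z ⟶ a), τ k k.left rfl = k)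
    (τ_trans : ∀ {z : Pair 𝒳 𝒴} (k : z ⟶ a) (f f' : z.pt ⟶ a.pt) (h : k.left ≫ u = f ≫ u)
      (h' : (τ k f h).left ≫ u = f' ≫ u) (h'' : k.left ≫ u = f' ≫ u),
      τ (τ k f h) f' h' = τ k f' h'') :
    ∃ (y : 𝒴.obj (.mk (op e.base))) (m : a ⟶ ⟨e, y⟩), m.left = u ∧
      ∀ {z : Pair 𝒳 𝒴} (k : z ⟶ a) (f : z.pt ⟶ a.pt) (h : k.left ≫ u = f ≫ u),
        τ k f h ≫ m = k ≫ m := by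
  have hex {z : Tot 𝒴} (k : z ⟶ a.tot) (f : z.base ⟶ a.pt.base)
      (h : k.base ≫ u.base = f ≫ u.base) := exists_pair_lift h𝒳 u k f h
  let pt {z : Tot 𝒴} (k : z ⟶ a.tot) : Pair 𝒳 𝒴 :=
    ⟨Tot.mk (pull 𝒳 k.base a.pt.fiber), z.fiber⟩
  let ho {z : Tot 𝒴} (k : z ⟶ a.tot) : pt k ⟶ a := ⟨Tot.cart k.base a.pt.fiber, k, rfl⟩
  choose κ hκ hκ' using @hex
  -- The second component of `τ` does not depend on which object of `𝒳` completes the test object: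
  -- the given pair maps to the standard one `pt k'.right` by an arrow that is the identity on
  -- second components, and `τ_comp` applies.
  have key {z' : Pair 𝒳 𝒴} (k' : z' ⟶ a) (f : z'.pt.base ⟶ a.pt.base)
      (h : k'.right.base ≫ u.base = f ≫ u.base) (f' : z'.pt ⟶ a.pt) (hf' : f'.base = f)
      (h' : k'.left ≫ u = f' ≫ u) :
      (τ (ho k'.right) (κ k'.right f h) (hκ' _ _ _).symm).right = (τ k' f' h').right := by
    obtain ⟨l, hl, hl'⟩ := Tot.exists_lift h𝒳 (Tot.cart k'.right.base a.pt.fiber) k'.left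
      (𝟙 _) (by rw [Tot.cart_base, k'.w]; exact Category.id_comp _)
    let L : z' ⟶ pt k'.right := ⟨l, 𝟙 _, hl.symm⟩
    have := τ_comp L (ho k'.right) (κ k'.right f h) (hκ' _ _ _).symm k' f' h'
      (hom_ext hl'.symm (Category.id_comp _).symm) (by
        refine Tot.hom_ext_of_comp h𝒳 u ?_ ?_
        · rw [Tot.comp_base, hκ]
          change _ = l.base ≫ f
          rw [hl, hf']; exact (Category.id_comp _).symm
        · rw [Category.assoc, hκ']
          change _ = l ≫ _
          rw [← h', ← Category.assoc, hl'])
    rw [this]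
    exact (Category.id_comp _).symm
  obtain ⟨y, m, hm, hm'⟩ := Tot.exists_descent h𝒴 u.base hu a.fib
    (fun k f h => (τ (ho k) (κ k f h) (hκ' k f h).symm).right)
    (fun k f h => by rw [Hom.w, τ_left, hκ])
    (fun {z' z} l k f h k' f' h' e e' => by
      subst e
      obtain ⟨ℓ, hℓ, hℓ'⟩ := Tot.exists_lift h𝒳 (Tot.cart k.base a.pt.fiber)
        (Tot.cart (l ≫ k).base a.pt.fiber) l.base rfl
      have hkl : Tot.cart (l ≫ k).base a.pt.fiber ≫ u = (ℓ ≫ κ k f h) ≫ u := by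
        rw [Category.assoc, hκ', ← Category.assoc, hℓ']
      have h1 := key (ho (l ≫ k)) f' h' (ℓ ≫ κ k f h) (by
        rw [Tot.comp_base, hℓ, hκ, e']) hkl
      have h2 := τ_comp (⟨ℓ, l, hℓ.symm⟩ : pt (l ≫ k) ⟶ pt k) (ho k) (κ k f h)
        (hκ' k f h).symm (ho (l ≫ k)) (ℓ ≫ κ k f h) hkl (hom_ext hℓ'.symm rfl) rfl
      rw [h2] at h1
      exact h1)
    (fun {z} k => by
      have := key (ho k) k.base rfl (Tot.cart k.base a.pt.fiber) rfl rfl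
      rw [τ_self (ho k)] at this
      exact this)
    (fun {z} k f f' h h' h'' => by
      have h3 : (τ (ho k) (κ k f h) (hκ' k f h).symm).left ≫ u = κ k f' h'' ≫ u := by
        rw [τ_left, hκ', hκ']
      have := key (τ (ho k) (κ k f h) (hκ' k f h).symm) f' h' (κ k f' h'') (hκ _ _ _) h3
      rw [τ_trans (ho k) (κ k f h) (κ k f' h'') _ _ (hκ' _ _ _).symm] at this
      exact this)
  refine ⟨y, ⟨u, m, hm⟩, rfl, fun {z} k f h => hom_ext ?_ ?_⟩
  · rw [comp_left, comp_left, τ_left, h]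
  · have h4 : k.right.base ≫ u.base = f.base ≫ u.base := by
      rw [k.w]; exact congrArg (fun t => t.base) h
    have := hm' k.right f.base h4
    rw [key k f.base h4 f rfl h] at this
    exact this

end

end Pair

end Pairs

/-! ### Atlases, and full faithfulness of restriction. -/

section Atlases

variable {C : Type u₁} [Category.{v₁} C] {A : Type u₂} [Category.{v₂} A]
  {𝒳 : PreStk.{v, u} C} {𝒴 : PreStk.{w, w'} C}

/-- Pairs of morphisms to the targets of `p` and `q` lift locally through `(p, q)`. -/
def LocallyLifts (J : GrothendieckTopology C) {e x w : Tot 𝒳} (p : w ⟶ e) (q : w ⟶ x) : Prop :=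
  ∀ ⦃z : Tot 𝒳⦄ (f : z ⟶ e) (g : z ⟶ x), ∃ (z' : Tot 𝒳) (s : z' ⟶ z) (h : z' ⟶ w),
    Tot.IsCovering J s.base ∧ s ≫ f = h ≫ p ∧ s ≫ g = h ≫ q

/-- The object `v` is an atlas of `𝒳`, and the subcategory `j : A ⥤ Tot 𝒳` is closed under the
relevant fiber products. -/
structure IsAtlas (J : GrothendieckTopology C) (j : A ⥤ Tot 𝒳) (v : A) : Prop where
  exists_chart (e : Tot 𝒳) : ∃ (w : Tot 𝒳) (p : w ⟶ e) (q : w ⟶ j.obj v),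
    Tot.IsCovering J p.base ∧ LocallyLifts J p q
  exists_sub_chart (d : A) : ∃ (w : A) (p : w ⟶ d) (q : w ⟶ v),
    Tot.IsCovering J (j.map p).base ∧ LocallyLifts J (j.map p) (j.map q) ∧
    ∀ (a : A) (α : a ⟶ d) (β : a ⟶ v), ∃ (a' : A) (s : a' ⟶ a) (h : a' ⟶ w),
      s ≫ α = h ≫ p ∧ s ≫ β = h ≫ q ∧
      ∀ (z : Tot 𝒳) (k : z ⟶ j.obj a) (l : z ⟶ j.obj w), k ≫ j.map α = l ≫ j.map p →
        k ≫ j.map β = l ≫ j.map q → ∃ m : z ⟶ j.obj a', m ≫ j.map s = k ∧ m ≫ j.map h = l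

namespace Sec

/-- A section over the total category of `𝒳`, seen as a functor to pairs. -/
def pair (y : Sec (Pseudofunctor.CoGrothendieck.forget 𝒳) 𝒴) : Tot 𝒳 ⥤ Pair 𝒳 𝒴 where
  obj e := ⟨e, y.fib e⟩
  map u := ⟨u, y.map u, y.map_base u⟩
  map_id e := Pair.hom_ext rfl (y.map_id e)
  map_comp u u' := Pair.hom_ext rfl (y.map_comp u u')

/-- A section over a subcategory of the total category of `𝒳`, seen as a functor to pairs. -/
def subPair {j : A ⥤ Tot 𝒳} (y : Sec (j ⋙ Pseudofunctor.CoGrothendieck.forget 𝒳) 𝒴) :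
    A ⥤ Pair 𝒳 𝒴 where
  obj a := ⟨j.obj a, y.fib a⟩
  map u := ⟨j.map u, y.map u, y.map_base u⟩
  map_id e := Pair.hom_ext (j.map_id e) (y.map_id e)
  map_comp u u' := Pair.hom_ext (j.map_comp u u') (y.map_comp u u')

end Sec

section FullyFaithful

variable {J : GrothendieckTopology C} (h𝒳 : IsGroupoidValued 𝒳) (h𝒴 : IsGroupoidStack J 𝒴)
  {y y' : Sec (Pseudofunctor.CoGrothendieck.forget 𝒳) 𝒴}

include h𝒴

/-- Pullback of `M` along `f`, available because the value of `y'` at `f` is cartesian. In general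
it depends on `f`. -/
lemma existsUnique_transfer {x : Tot 𝒳} (M : y.pair.obj x ⟶ y'.pair.obj x) (hM : M.left = 𝟙 x)
    {Z : Tot 𝒳} (f : Z ⟶ x) : ∃! n : y.pair.obj Z ⟶ y'.pair.obj Z, n.left = 𝟙 Z ∧
      n ≫ y'.pair.map f = y.pair.map f ≫ M := by
  obtain ⟨n, hn, hn'⟩ := Pair.exists_lift h𝒴.isGroupoidValued (y'.pair.map f)
    (y.pair.map f ≫ M) (𝟙 Z) (by
      rw [Pair.comp_left, hM]
      exact (Category.id_comp f).trans (Category.comp_id f).symm)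
  refine ⟨n, ⟨hn, hn'⟩, fun n' h => ?_⟩
  exact Pair.hom_ext_of_comp h𝒴.isGroupoidValued (y'.pair.map f) (h.1.trans hn.symm)
    (h.2.trans hn'.symm)

lemma transfer_comp {x : Tot 𝒳} {M : y.pair.obj x ⟶ y'.pair.obj x}
    {Z Z' : Tot 𝒳} {f : Z ⟶ x} (t : Z' ⟶ Z) {n : y.pair.obj Z ⟶ y'.pair.obj Z}
    (hn : n.left = 𝟙 Z ∧ n ≫ y'.pair.map f = y.pair.map f ≫ M)
    {n' : y.pair.obj Z' ⟶ y'.pair.obj Z'}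
    (hn' : n'.left = 𝟙 Z' ∧ n' ≫ y'.pair.map (t ≫ f) = y.pair.map (t ≫ f) ≫ M) :
    y.pair.map t ≫ n = n' ≫ y'.pair.map t := by
  refine Pair.hom_ext_of_comp h𝒴.isGroupoidValued (y'.pair.map f) ?_ ?_
  · rw [Pair.comp_left, Pair.comp_left, hn.1, hn'.1]
    exact (Category.comp_id t).trans (Category.id_comp t).symm
  · rw [Category.assoc, hn.2, Category.assoc, ← Functor.map_comp, hn'.2, Functor.map_comp,
      Category.assoc]

lemma transfer_congr {x : Tot 𝒳} {M : y.pair.obj x ⟶ y'.pair.obj x}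
    {Z Z' : Tot 𝒳} {f g : Z ⟶ x} (t : Z' ⟶ Z) {n : y.pair.obj Z ⟶ y'.pair.obj Z}
    (hn : n.left = 𝟙 Z ∧ n ≫ y'.pair.map f = y.pair.map f ≫ M)
    (hn' : n.left = 𝟙 Z ∧ n ≫ y'.pair.map g = y.pair.map g ≫ M)
    {n₁ n₂ : y.pair.obj Z' ⟶ y'.pair.obj Z'}
    (hn₁ : n₁.left = 𝟙 Z' ∧ n₁ ≫ y'.pair.map (t ≫ f) = y.pair.map (t ≫ f) ≫ M)
    (hn₂ : n₂.left = 𝟙 Z' ∧ n₂ ≫ y'.pair.map (t ≫ g) = y.pair.map (t ≫ g) ≫ M) : n₁ = n₂ :=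
  Pair.hom_ext_of_comp h𝒴.isGroupoidValued (y'.pair.map t) (hn₁.1.trans hn₂.1.symm)
    ((transfer_comp h𝒴 t hn hn₁).symm.trans (transfer_comp h𝒴 t hn' hn₂))

/-- The component at `v` determines the component at every object over `v`, in particular at a chart
of `e`, and hence at `e` by descent. -/
lemma faithful_pre {j : A ⥤ Tot 𝒳} {v : A} (hv : IsAtlas J j v) :
    (Sec.pre j (Pseudofunctor.CoGrothendieck.forget 𝒳) 𝒴).Faithful where
  map_injective {y y'} φ ψ h := by
    let P (χ : y ⟶ y') (e : Tot 𝒳) : y.pair.obj e ⟶ y'.pair.obj e :=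
      ⟨𝟙 e, χ.app e, χ.app_base e⟩
    have hP (χ : y ⟶ y') {e e' : Tot 𝒳} (u : e ⟶ e') :
        P χ e ≫ y'.pair.map u = y.pair.map u ≫ P χ e' :=
      Pair.hom_ext ((Category.id_comp u).trans (Category.comp_id u).symm) (χ.naturality u).symm
    have hPv : P φ (j.obj v) = P ψ (j.obj v) :=
      Pair.hom_ext rfl (congrArg (fun t => Sec.Hom.app t v) h)
    refine Sec.hom_ext fun e => ?_
    obtain ⟨w, p, q, hp, -⟩ := hv.exists_chart e
    have hw : P φ w = P ψ w := by
      refine Pair.hom_ext_of_comp h𝒴.isGroupoidValued (y'.pair.map q) rfl ?_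
      rw [hP, hP, hPv]
    have he : P φ e = P ψ e := by
      refine Pair.hom_ext_of_isCov h𝒴 (y.pair.map p) hp rfl ?_
      rw [← hP, ← hP, hw]
    exact congrArg (fun t => t.right) he

include h𝒳

lemma full_pre {j : A ⥤ Tot 𝒳} {v : A} (hv : IsAtlas J j v) :
    (Sec.pre j (Pseudofunctor.CoGrothendieck.forget 𝒳) 𝒴).Full where
  map_surjective {y y'} m := by
    let P (a : A) : y.pair.obj (j.obj a) ⟶ y'.pair.obj (j.obj a) :=
      ⟨𝟙 _, m.app a, m.app_base a⟩
    have hP {a b : A} (u : a ⟶ b) :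
        P a ≫ y'.pair.map (j.map u) = y.pair.map (j.map u) ≫ P b :=
      Pair.hom_ext ((Category.id_comp _).trans (Category.comp_id _).symm) (m.naturality u).symm
    choose n hn hn' using fun (Z : Tot 𝒳) (f : Z ⟶ j.obj v) =>
      existsUnique_transfer h𝒴 (P v) rfl f
    have hnat {Z Z' : Tot 𝒳} (t : Z' ⟶ Z) (f : Z ⟶ j.obj v) :
        y.pair.map t ≫ n Z f = n Z' (t ≫ f) ≫ y'.pair.map t :=
      transfer_comp h𝒴 t (hn Z f) (hn Z' (t ≫ f))
    have hsub {a : A} (α : a ⟶ v) : n _ (j.map α) = P a := (hn' _ _ _ ⟨rfl, hP α⟩).symm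
    -- Locally, `(f, g)` factors through the chart `w` of `v` itself. As `w`, `p` and `q` come from
    -- `A`, both transfers at `w` are the given component of `m`.
    have hind {Z : Tot 𝒳} (f g : Z ⟶ j.obj v) : n Z f = n Z g := by
      obtain ⟨w, p, q, -, hl, -⟩ := hv.exists_sub_chart v
      obtain ⟨z, s, h, hs, h₁, h₂⟩ := hl f g
      refine Pair.hom_ext_of_isCov h𝒴 (y.pair.map s) hs ((hn _ _).1.trans (hn _ _).1.symm) ?_
      rw [hnat, hnat, h₁, h₂]
      congr 1
      have h₃ := hn _ (j.map q)
      rw [hsub, ← hsub p] at h₃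
      exact transfer_congr h𝒴 h (hn _ (j.map p)) h₃ (hn _ _) (hn _ _)
    -- The component at `e` is glued from the transfer on a chart. It is characterized by its
    -- restriction to every object mapping to both `e` and `v`, so it does not depend on the chart.
    have hex (e : Tot 𝒳) : ∃ α : y.pair.obj e ⟶ y'.pair.obj e, α.left = 𝟙 e ∧
        ∀ (Z : Tot 𝒳) (κ : Z ⟶ e) (f : Z ⟶ j.obj v),
          y.pair.map κ ≫ α = n Z f ≫ y'.pair.map κ := by
      obtain ⟨w, p, q, hp, hl⟩ := hv.exists_chart e
      obtain ⟨α, hα, hα'⟩ := Pair.exists_desc h𝒳 h𝒴 (b := y'.pair.obj e) (y.pair.map p) hp (𝟙 e)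
        (n w q ≫ y'.pair.map p) (by
          rw [Pair.comp_left, (hn _ _).1]
          exact (Category.id_comp p).trans (Category.comp_id p).symm) (fun z k₁ k₂ hk => by
            -- A test arrow need not come from the section `y`, but it differs from such an arrow
            -- only by one over the identity.
            have hfac (k : z ⟶ y.pair.obj w) : ∃ (l : z.pt ⟶ w) (c : z ⟶ y.pair.obj z.pt),
                k.left = l ∧ c.left = 𝟙 _ ∧ c ≫ y.pair.map l = k := by
              obtain ⟨c, hc⟩ := Pair.exists_lift h𝒴.isGroupoidValued (b := y.pair.obj z.pt)
                (y.pair.map (Y := w) k.left) k (𝟙 _) (Category.id_comp _)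
              exact ⟨_, c, rfl, hc⟩
            obtain ⟨l₁, c₁, hl₁, hc₁, rfl⟩ := hfac k₁
            obtain ⟨l₂, c₂, hl₂, hc₂, rfl⟩ := hfac k₂
            have hk' (l : z.pt ⟶ w) (c : z ⟶ y.pair.obj z.pt) :
                (c ≫ y.pair.map l) ≫ n w q ≫ y'.pair.map p =
                  c ≫ n z.pt (l ≫ q) ≫ y'.pair.map (l ≫ p) := by
              rw [Category.assoc, ← Category.assoc (y.pair.map l), hnat, Category.assoc,
                Functor.map_comp]
            have hlk : l₁ ≫ p = l₂ ≫ p := by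
              rw [← hl₁, ← hl₂]
              exact congrArg (fun t => t.left) hk
            have hc : c₁ = c₂ := by
              refine Pair.hom_ext_of_comp h𝒴.isGroupoidValued (y.pair.map (l₁ ≫ p))
                (hc₁.trans hc₂.symm) ?_
              conv_rhs => rw [hlk]
              rw [Functor.map_comp, Functor.map_comp, ← Category.assoc, hk, Category.assoc]
            rw [hk', hk', hc, hlk, hind (l₁ ≫ q) (l₂ ≫ q)])
      refine ⟨α, hα, fun Z κ f => ?_⟩
      obtain ⟨z, s, h, hs, h₁, h₂⟩ := hl κ f
      refine Pair.hom_ext_of_isCov h𝒴 (y.pair.map s) hs ?_ ?_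
      · rw [Pair.comp_left, Pair.comp_left, hα, (hn _ _).1]
        exact (Category.comp_id κ).trans (Category.id_comp κ).symm
      · rw [← Category.assoc, ← Functor.map_comp, h₁, Functor.map_comp, Category.assoc, hα',
          ← Category.assoc, hnat, Category.assoc, ← Functor.map_comp, ← h₁, ← h₂,
          Functor.map_comp, ← Category.assoc, ← hnat, Category.assoc]
    choose α hα hα' using hex
    have hcov (e : Tot 𝒳) : ∃ (w : Tot 𝒳) (p : w ⟶ e) (q : w ⟶ j.obj v),
        Tot.IsCovering J p.base := by
      obtain ⟨w, p, q, hp, -⟩ := hv.exists_chart e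
      exact ⟨w, p, q, hp⟩
    refine ⟨{ app := fun e => (α e).right
              app_base := fun e => by rw [(α e).w, hα]; rfl
              naturality := fun {e e'} u => ?_ }, ?_⟩
    · obtain ⟨w, p, q, hp⟩ := hcov e
      have : y.pair.map u ≫ α e' = α e ≫ y'.pair.map u := by
        refine Pair.hom_ext_of_isCov h𝒴 (y.pair.map p) hp ?_ ?_
        · rw [Pair.comp_left, Pair.comp_left, hα, hα]
          exact (Category.comp_id u).trans (Category.id_comp u).symm
        · rw [← Category.assoc, ← Functor.map_comp, hα' _ _ _ q, Functor.map_comp,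
            ← Category.assoc, ← hα' _ _ p q, Category.assoc]
      exact congrArg (fun t => t.right) this
    · refine Sec.hom_ext fun d => ?_
      obtain ⟨w, p, q, hp, -⟩ := hv.exists_sub_chart d
      have : α (j.obj d) = P d := by
        refine Pair.hom_ext_of_isCov h𝒴 (y.pair.map (j.map p)) hp (hα _) ?_
        rw [hα' _ _ _ (j.map q), hsub, hP]
      exact congrArg (fun t => t.right) this

end FullyFaithful

end Atlases

/-! ### Gluing isomorphisms coming from a section over the subcategory. -/

section Transport

variable {C : Type u₁} [Category.{v₁} C] {A : Type u₂} [Category.{v₂} A]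
  {𝒳 : PreStk.{v, u} C} {𝒴 : PreStk.{w, w'} C} {J : GrothendieckTopology C}

lemma Tot.IsCovering.pullback_fst [HasPullbacks C] {S T Z : C} {g : T ⟶ S}
    (hg : Tot.IsCovering J g) (f : Z ⟶ S) : Tot.IsCovering J (pullback.fst f g) := by
  refine J.superset_covering ?_ (J.pullback_stable f hg)
  rintro W h ⟨V, l, _, ⟨⟩, hl⟩
  exact ⟨_, pullback.lift h l hl.symm, _, ⟨⟩, pullback.lift_fst _ _ _⟩

namespace Pair

lemma exists_pullback [HasPullbacks C] (h𝒳 : IsGroupoidValued 𝒳) (h𝒴 : IsGroupoidValued 𝒴)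
    {x y z : Pair 𝒳 𝒴} (t : x ⟶ z) (s : y ⟶ z) (hs : IsCov J s) :
    ∃ (x' : Pair 𝒳 𝒴) (r : x' ⟶ x) (t' : x' ⟶ y), IsCov J r ∧ r ≫ t = t' ≫ s := by
  let c : Tot.mk (pull 𝒳 (pullback.fst t.left.base s.left.base) x.pt.fiber) ⟶ x.pt :=
    Tot.cart _ x.pt.fiber
  obtain ⟨k, -, hk⟩ := Tot.exists_lift h𝒳 s.left (c ≫ t.left)
    (pullback.snd t.left.base s.left.base) pullback.condition.symm
  obtain ⟨l, -, hl⟩ := Pair.exists_lift h𝒴 s (x.pbHom c ≫ t) k hk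
  exact ⟨_, x.pbHom c, l, Tot.IsCovering.pullback_fst hs _, hl.symm⟩

end Pair

lemma LocallyLifts.exists_pair {e x w : Tot 𝒳} {p : w ⟶ e} {q : w ⟶ x} (h : LocallyLifts J p q)
    {z : Pair 𝒳 𝒴} (f : z.pt ⟶ e) (g : z.pt ⟶ x) :
    ∃ (z' : Pair 𝒳 𝒴) (s : z' ⟶ z) (h : z'.pt ⟶ w), Pair.IsCov J s ∧
      s.left ≫ f = h ≫ p ∧ s.left ≫ g = h ≫ q := by
  obtain ⟨z', s, h, h₁, h₂, h₃⟩ := h f g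
  exact ⟨z.pb s, z.pbHom s, h, h₁, h₂, h₃⟩

/-- The properties of an atlas, for a functor to pairs. -/
structure IsPairAtlas (J : GrothendieckTopology C) (Y : A ⥤ Pair 𝒳 𝒴) (v : A) : Prop where
  exists_chart (e : Tot 𝒳) : ∃ (w : Tot 𝒳) (p : w ⟶ e) (q : w ⟶ (Y.obj v).pt),
    Tot.IsCovering J p.base ∧ LocallyLifts J p q
  exists_sub_chart (d : A) : ∃ (w : A) (p : w ⟶ d) (q : w ⟶ v),
    Pair.IsCov J (Y.map p) ∧ LocallyLifts J (Y.map p).left (Y.map q).left ∧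
    ∀ (a : A) (α : a ⟶ d) (β : a ⟶ v), ∃ (a' : A) (s : a' ⟶ a) (h : a' ⟶ w),
      s ≫ α = h ≫ p ∧ s ≫ β = h ≫ q ∧
      ∀ (z : Tot 𝒳) (k : z ⟶ (Y.obj a).pt) (l : z ⟶ (Y.obj w).pt),
        k ≫ (Y.map α).left = l ≫ (Y.map p).left → k ≫ (Y.map β).left = l ≫ (Y.map q).left →
          ∃ m : z ⟶ (Y.obj a').pt, m ≫ (Y.map s).left = k ∧ m ≫ (Y.map h).left = l

lemma IsAtlas.isPairAtlas {j : A ⥤ Tot 𝒳} {v : A} (h : IsAtlas J j v)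
    (y : Sec (j ⋙ Pseudofunctor.CoGrothendieck.forget 𝒳) 𝒴) : IsPairAtlas J y.subPair v :=
  ⟨h.exists_chart, h.exists_sub_chart⟩

namespace IsPairAtlas

variable {Y : A ⥤ Pair 𝒳 𝒴} {v : A}

/-- The morphism `t : z ⟶ Y v` is compatible with `k : z ⟶ Y d`: it agrees with all local
factorizations through the values of `Y`. -/
def Compatible {d : A} {z : Pair 𝒳 𝒴} (k : z ⟶ Y.obj d) (t : z ⟶ Y.obj v) : Prop :=
  ∀ ⦃z' : Pair 𝒳 𝒴⦄ (r : z' ⟶ z) (a : A) (n : z' ⟶ Y.obj a) (α : a ⟶ d) (β : a ⟶ v),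
    r ≫ k = n ≫ Y.map α → r.left ≫ t.left = n.left ≫ (Y.map β).left → r ≫ t = n ≫ Y.map β

lemma Compatible.comp {d : A} {z z' : Pair 𝒳 𝒴} {k : z ⟶ Y.obj d} {t : z ⟶ Y.obj v}
    (h : Compatible k t) (r : z' ⟶ z) : Compatible (r ≫ k) (r ≫ t) := by
  intro z₁ r₁ a n α β h₁ h₂
  rw [← Category.assoc]
  exact h (r₁ ≫ r) a n α β (by rw [Category.assoc, h₁])
    (by rw [← h₂]; exact Category.assoc _ _ _)

variable (hv : IsPairAtlas J Y v) (h𝒳 : IsGroupoidValued 𝒳) (h𝒴 : IsGroupoidStack J 𝒴)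
include hv h𝒴

/-- On a covering of `z` the arrows `k.left` and `t.left` lift to the chart of `d`, which belongs to
`A`; there compatibility prescribes the value. -/
lemma Compatible.eq {d : A} {z : Pair 𝒳 𝒴} {k : z ⟶ Y.obj d} {t t' : z ⟶ Y.obj v}
    (h : Compatible k t) (h' : Compatible k t') (hl : t.left = t'.left) : t = t' := by
  obtain ⟨w, p, q, hp, hl', -⟩ := hv.exists_sub_chart d
  obtain ⟨z', s, l, hs, h₁, h₂⟩ := hl'.exists_pair k.left t.left
  obtain ⟨n, rfl, hn'⟩ := Pair.exists_lift h𝒴.isGroupoidValued (Y.map p) (s ≫ k) l h₁.symm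
  refine Pair.hom_ext_of_isCov h𝒴 s hs hl ?_
  rw [h s w n p q hn'.symm h₂, h' s w n p q hn'.symm (by rw [← hl, h₂])]

include h𝒳

lemma exists_compatible [HasPullbacks C] {d : A} {z : Pair 𝒳 𝒴} (k : z ⟶ Y.obj d)
    (g : z.pt ⟶ (Y.obj v).pt) : ∃ t : z ⟶ Y.obj v, t.left = g ∧ Compatible k t := by
  obtain ⟨w, p, q, hp, hl, huniv⟩ := hv.exists_sub_chart d
  -- Two factorizations, through `a` and through the chart `w`, both pass through `a'`. This object
  -- lies in `A`, so functoriality of `Y` identifies the results.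
  have key {x : Pair 𝒳 𝒴} {a : A} (n : x ⟶ Y.obj a) (n' : x ⟶ Y.obj w) (α : a ⟶ d) (β : a ⟶ v)
      (h₁ : n' ≫ Y.map p = n ≫ Y.map α)
      (h₂ : n'.left ≫ (Y.map q).left = n.left ≫ (Y.map β).left) :
      n' ≫ Y.map q = n ≫ Y.map β := by
    obtain ⟨a', s, h, h₃, h₄, h₅⟩ := huniv a α β
    obtain ⟨m, hm, hm'⟩ := h₅ _ n.left n'.left (congrArg (fun t => t.left) h₁.symm) h₂.symm
    obtain ⟨M, rfl, rfl⟩ := Pair.exists_lift h𝒴.isGroupoidValued (Y.map s) n m hm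
    obtain rfl : M ≫ Y.map h = n' := by
      refine Pair.hom_ext_of_comp h𝒴.isGroupoidValued (Y.map p) hm' ?_
      rw [h₁, Category.assoc, ← Functor.map_comp, ← h₃, Functor.map_comp, Category.assoc]
    rw [Category.assoc, ← Functor.map_comp, ← h₄, Functor.map_comp, Category.assoc]
  -- Locally `t` has to be `n ≫ Y.map q`. Applying `key` with `a = w` shows agreement on overlaps.
  obtain ⟨z', s, l, hs, h₁, h₂⟩ := hl.exists_pair k.left g
  obtain ⟨n, rfl, hn⟩ := Pair.exists_lift h𝒴.isGroupoidValued (Y.map p) (s ≫ k) l h₁.symm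
  obtain ⟨t, rfl, ht⟩ := Pair.exists_desc h𝒳 h𝒴 s hs g (n ≫ Y.map q) h₂.symm (fun x k₁ k₂ hk => by
    rw [← Category.assoc, ← Category.assoc]
    refine key _ _ p q ?_ ?_
    · rw [Category.assoc, Category.assoc, hn, ← Category.assoc, hk, Category.assoc]
    · have := congrArg (fun t => t.left ≫ g) hk
      simp only [Pair.comp_left, Category.assoc] at this ⊢
      rw [← h₂, this])
  refine ⟨t, rfl, fun z₁ r a m α β hr hr' => ?_⟩
  -- Compatibility is local on the test object, and over the pullback of the covering `s` it is
  -- again `key`.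
  obtain ⟨z₂, ρ, r', hρ, hρ'⟩ := Pair.exists_pullback h𝒳 h𝒴.isGroupoidValued r s hs
  refine Pair.hom_ext_of_isCov h𝒴 ρ hρ hr' ?_
  rw [← Category.assoc, hρ', Category.assoc, ht, ← Category.assoc, ← Category.assoc]
  refine key _ _ α β ?_ ?_
  · rw [Category.assoc, hn, ← Category.assoc, ← hρ', Category.assoc, hr, Category.assoc]
  · have := congrArg (fun x => x.left ≫ t.left) hρ'
    simp only [Pair.comp_left, Category.assoc] at this ⊢
    rw [← h₂, ← this, hr']

end IsPairAtlas

/-- Transport of morphisms to the values of `Y`. -/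
structure TransportSystem (J : GrothendieckTopology C) (Y : A ⥤ Pair 𝒳 𝒴) (v : A) where
  /-- the transport -/
  tr {d : A} {z : Pair 𝒳 𝒴} (k : z ⟶ Y.obj d) (g : z.pt ⟶ (Y.obj v).pt) : z ⟶ Y.obj v
  tr_left {d : A} {z : Pair 𝒳 𝒴} (k : z ⟶ Y.obj d) (g : z.pt ⟶ (Y.obj v).pt) : (tr k g).left = g
  comp_tr {d : A} {z z' : Pair 𝒳 𝒴} (r : z' ⟶ z) (k : z ⟶ Y.obj d) (g : z.pt ⟶ (Y.obj v).pt) :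
    r ≫ tr k g = tr (r ≫ k) (r.left ≫ g)
  tr_map {d d' : A} {z : Pair 𝒳 𝒴} (k : z ⟶ Y.obj d) (u : d ⟶ d') (g : z.pt ⟶ (Y.obj v).pt) :
    tr (k ≫ Y.map u) g = tr k g
  tr_self {d : A} {z : Pair 𝒳 𝒴} (k : z ⟶ Y.obj d) (β : d ⟶ v) :
    tr k (k.left ≫ (Y.map β).left) = k ≫ Y.map β
  tr_tr {d : A} {z : Pair 𝒳 𝒴} (k : z ⟶ Y.obj d) (g g' : z.pt ⟶ (Y.obj v).pt) :
    tr (tr k g) g' = tr k g'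

lemma TransportSystem.tr_eq_self {Y : A ⥤ Pair 𝒳 𝒴} {v : A} (τ : TransportSystem J Y v)
    {z : Pair 𝒳 𝒴} (k : z ⟶ Y.obj v) (g : z.pt ⟶ (Y.obj v).pt) (h : k.left = g) : τ.tr k g = k := by
  subst h
  have := τ.tr_self k (𝟙 v)
  simpa using this

-- Existence of compatible arrows gives the transport, and their uniqueness gives its stability
-- under composition and its independence of `d`.
open IsPairAtlas in
lemma IsPairAtlas.nonempty_transportSystem [HasPullbacks C] {Y : A ⥤ Pair 𝒳 𝒴} {v : A}
    (hv : IsPairAtlas J Y v) (h𝒳 : IsGroupoidValued 𝒳) (h𝒴 : IsGroupoidStack J 𝒴) :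
    Nonempty (TransportSystem J Y v) := by
  choose tr hl hc using fun (d : A) (z : Pair 𝒳 𝒴) (k : z ⟶ Y.obj d) (g : z.pt ⟶ (Y.obj v).pt) =>
    hv.exists_compatible h𝒳 h𝒴 k g
  have hcomp {d : A} {z z' : Pair 𝒳 𝒴} (r : z' ⟶ z) (k : z ⟶ Y.obj d)
      (g : z.pt ⟶ (Y.obj v).pt) : r ≫ tr d z k g = tr d z' (r ≫ k) (r.left ≫ g) :=
    Compatible.eq hv h𝒴 ((hc _ _ _ _).comp r) (hc _ _ _ _) (by rw [hl, Pair.comp_left, hl])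
  have hself {d : A} {z : Pair 𝒳 𝒴} (k : z ⟶ Y.obj d) (β : d ⟶ v) :
      tr d z k (k.left ≫ (Y.map β).left) = k ≫ Y.map β := by
    have := hc d z k (k.left ≫ (Y.map β).left) (𝟙 z) d k (𝟙 d) β (by simp)
      (by rw [hl]; exact Category.id_comp _)
    rwa [Category.id_comp] at this
  have hmap {d d' : A} {z : Pair 𝒳 𝒴} (k : z ⟶ Y.obj d) (u : d ⟶ d')
      (g : z.pt ⟶ (Y.obj v).pt) : tr d' z (k ≫ Y.map u) g = tr d z k g := by
    refine Compatible.eq hv h𝒴 (fun z' r a n α β h₁ h₂ => ?_) (hc d z k g) (by rw [hl, hl])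
    refine hc d' z (k ≫ Y.map u) g r a n (α ≫ u) β ?_ h₂
    rw [← Category.assoc, h₁, Functor.map_comp, Category.assoc]
  refine ⟨⟨fun k g => tr _ _ k g, fun k g => hl _ _ k g, hcomp, hmap, hself,
    fun {d z} k g g' => ?_⟩⟩
  -- The cocycle identity is checked on a covering where `k` and `tr k g` are images of one arrow
  -- `n` into the value at the chart; both sides then become the transport of `n`.
  obtain ⟨w, p, q, hp, hl', -⟩ := hv.exists_sub_chart d
  obtain ⟨z₁, s, l, hs, h₁, h₂⟩ := hl'.exists_pair k.left g
  obtain ⟨n, rfl, hn⟩ := Pair.exists_lift h𝒴.isGroupoidValued (Y.map p) (s ≫ k) l h₁.symm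
  refine Pair.hom_ext_of_isCov h𝒴 s hs (by rw [hl, hl]) ?_
  rw [hcomp, hcomp, hcomp, ← hn, h₂]
  simp only [hmap, hself]

end Transport

/-! ### Extension of sections by descent along charts. -/

section EssSurj

variable {C : Type u₁} [Category.{v₁} C] {A : Type u₂} [Category.{v₂} A]
  {𝒳 : PreStk.{v, u} C} {𝒴 : PreStk.{w, w'} C} {J : GrothendieckTopology C}
  {Y : A ⥤ Pair 𝒳 𝒴} {v : A}

/-- A pair `T` which is obtained by descent from a pullback of the value of `Y` at the atlas. -/
structure Chart (τ : TransportSystem J Y v) (T : Pair 𝒳 𝒴) where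
  /-- the covering -/
  src : Pair 𝒳 𝒴
  /-- the map of the covering -/
  m : src ⟶ T
  /-- the map to the value at the atlas -/
  c : src ⟶ Y.obj v
  isCov : Pair.IsCov J m
  lifts : LocallyLifts J m.left c.left
  tr_eq {x : Pair 𝒳 𝒴} (k₁ k₂ : x ⟶ src) (h : k₁ ≫ m = k₂ ≫ m) :
    τ.tr (k₁ ≫ c) (k₂ ≫ c).left = k₂ ≫ c

namespace Chart

variable {τ : TransportSystem J Y v} {T T' T'' : Pair 𝒳 𝒴} (D : Chart τ T) (D' : Chart τ T')
  (D'' : Chart τ T'')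

/-- The morphisms `t : z ⟶ T` and `b : z ⟶ Y v` correspond to each other by transport. -/
def Rel {z : Pair 𝒳 𝒴} (t : z ⟶ T) (b : z ⟶ Y.obj v) : Prop :=
  ∀ ⦃z' : Pair 𝒳 𝒴⦄ (r : z' ⟶ z) (k : z' ⟶ D.src), r ≫ t = k ≫ D.m →
    τ.tr (k ≫ D.c) (r ≫ b).left = r ≫ b

variable {D D' D''}

lemma Rel.comp {z z' : Pair 𝒳 𝒴} {t : z ⟶ T} {b : z ⟶ Y.obj v} (h : D.Rel t b) (r : z' ⟶ z) :
    D.Rel (r ≫ t) (r ≫ b) := by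
  intro z₁ r₁ k hk
  rw [← Category.assoc]
  exact h (r₁ ≫ r) k (by rw [Category.assoc, hk])

lemma rel_m_c : D.Rel D.m D.c := fun _ r k hk => D.tr_eq k r hk.symm

lemma Rel.tr {z : Pair 𝒳 𝒴} {t : z ⟶ T} {b : z ⟶ Y.obj v} (h : D.Rel t b)
    (g : z.pt ⟶ (Y.obj v).pt) : D.Rel t (τ.tr b g) := by
  intro z₁ r k hk
  rw [Pair.comp_left, τ.tr_left, τ.comp_tr, ← τ.tr_tr, h r k hk]

variable (h𝒴 : IsGroupoidStack J 𝒴)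

include h𝒴

/-- A converse to `tr_eq`: the lift of `k₁ ≫ m` through `m` over `k₂.left` has the same transport as
`k₂`, hence equals `k₂`. -/
lemma comp_m_eq {x : Pair 𝒳 𝒴} (k₁ k₂ : x ⟶ D.src) (h : k₁.left ≫ D.m.left = k₂.left ≫ D.m.left)
    (h' : τ.tr (k₁ ≫ D.c) (k₂ ≫ D.c).left = k₂ ≫ D.c) : k₁ ≫ D.m = k₂ ≫ D.m := by
  obtain ⟨k, hk, hk'⟩ := Pair.exists_lift h𝒴.isGroupoidValued D.m (k₁ ≫ D.m) k₂.left h.symm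
  have h₁ := D.tr_eq k₁ k hk'.symm
  have h₂ : k = k₂ := by
    refine Pair.hom_ext_of_comp h𝒴.isGroupoidValued D.c hk ?_
    rw [← h₁, ← h', Pair.comp_left, Pair.comp_left, hk]
  rw [← hk', h₂]

/-- Locally both arrows lift to the chart over one arrow in `𝒳`, where the relation makes their
composites with `c` equal to the restriction of `b`. -/
lemma Rel.eq {z : Pair 𝒳 𝒴} {t t' : z ⟶ T} {b : z ⟶ Y.obj v} (h : D.Rel t b) (h' : D.Rel t' b)
    (hl : t.left = t'.left) : t = t' := by
  obtain ⟨z', s, l, hs, h₁, h₂⟩ := D.lifts.exists_pair t.left b.left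
  obtain ⟨k, hk, hk'⟩ := Pair.exists_lift h𝒴.isGroupoidValued D.m (s ≫ t) l h₁.symm
  obtain ⟨k', hkl, hkl'⟩ := Pair.exists_lift h𝒴.isGroupoidValued D.m (s ≫ t') l
    (by rw [Pair.comp_left, ← hl, h₁])
  refine Pair.hom_ext_of_isCov h𝒴 s hs hl ?_
  rw [← hk', ← hkl']
  congr 1
  refine Pair.hom_ext_of_comp h𝒴.isGroupoidValued D.c (hk.trans hkl.symm) ?_
  have h₃ := h s k hk'.symm
  have h₄ := h' s k' hkl'.symm
  rw [τ.tr_eq_self _ _ (by rw [Pair.comp_left, Pair.comp_left, hk, h₂])] at h₃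
  rw [τ.tr_eq_self _ _ (by rw [Pair.comp_left, Pair.comp_left, hkl, h₂])] at h₄
  rw [h₃, h₄]

variable [HasPullbacks C] (h𝒳 : IsGroupoidValued 𝒳)

include h𝒳

lemma rel_of_isCov {z z' : Pair 𝒳 𝒴} {t : z ⟶ T} {b : z ⟶ Y.obj v} (r : z' ⟶ z)
    (hr : Pair.IsCov J r) (h : D.Rel (r ≫ t) (r ≫ b)) : D.Rel t b := by
  intro z₁ r' k hk
  obtain ⟨z₂, ρ, σ, hρ, hσ⟩ := Pair.exists_pullback h𝒳 h𝒴.isGroupoidValued r' r hr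
  refine Pair.hom_ext_of_isCov h𝒴 ρ hρ (τ.tr_left _ _) ?_
  have h₁ := h σ (ρ ≫ k) (by rw [← Category.assoc, ← hσ, Category.assoc, hk, Category.assoc])
  rw [← Category.assoc, ← hσ, Category.assoc, Category.assoc] at h₁
  rw [τ.comp_tr]
  exact h₁

/-- Locally `b` lifts through `c` to the source of the chart, and the composites with `m` glue by
`comp_m_eq`. Arrows to `T` over `f` are thus controlled by arrows to the value at `v`. -/
lemma exists_rel (D : Chart τ T) {z : Pair 𝒳 𝒴} (f : z.pt ⟶ T.pt) (b : z ⟶ Y.obj v) :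
    ∃ t : z ⟶ T, t.left = f ∧ D.Rel t b := by
  obtain ⟨z', s, l, hs, h₁, h₂⟩ := D.lifts.exists_pair f b.left
  obtain ⟨k, hk, hk'⟩ := Pair.exists_lift h𝒴.isGroupoidValued D.c (s ≫ b) l h₂.symm
  obtain ⟨t, ht, ht'⟩ := Pair.exists_desc h𝒳 h𝒴 s hs f (k ≫ D.m)
    (by rw [Pair.comp_left, hk, h₁]) (fun x k₁ k₂ hk₁₂ => by
      rw [← Category.assoc, ← Category.assoc]
      refine comp_m_eq h𝒴 _ _ ?_ ?_
      · have := congrArg (fun t => t.left ≫ f) hk₁₂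
        simp only [Pair.comp_left, Category.assoc] at this ⊢
        rw [hk, ← h₁, this]
      · have h₃ : (k₁ ≫ k) ≫ D.c = (k₂ ≫ k) ≫ D.c := by
          rw [Category.assoc, Category.assoc, hk', ← Category.assoc, hk₁₂, Category.assoc]
        rw [h₃, τ.tr_eq_self _ _ rfl])
  refine ⟨t, ht, rel_of_isCov h𝒴 h𝒳 s hs ?_⟩
  rw [ht', ← hk']
  exact rel_m_c.comp k

/-- A morphism between pairs with charts which is compatible with the transport. -/
lemma existsUnique_hom (D : Chart τ T) (D' : Chart τ T') (f : T.pt ⟶ T'.pt) :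
    ∃! κ : T ⟶ T', κ.left = f ∧
      ∀ ⦃z : Pair 𝒳 𝒴⦄ (t : z ⟶ T) (b : z ⟶ Y.obj v), D.Rel t b → D'.Rel (t ≫ κ) b := by
  -- On the chart, compatibility forces `κ` to be the arrow related to `D.c`; `tr_eq` and `Rel.eq`
  -- provide the gluing condition.
  obtain ⟨t', ht', hR⟩ := exists_rel h𝒴 h𝒳 D' (D.m.left ≫ f) D.c
  obtain ⟨κ, hκ, hκ'⟩ := Pair.exists_desc h𝒳 h𝒴 D.m D.isCov f t' ht' (fun x k₁ k₂ hk => by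
    have h₁ := (hR.comp k₁).tr (k₂ ≫ D.c).left
    rw [D.tr_eq k₁ k₂ hk] at h₁
    refine h₁.eq h𝒴 (hR.comp k₂) ?_
    have := congrArg (fun t => t.left ≫ f) hk
    simp only [Pair.comp_left, Category.assoc] at this ⊢
    rw [ht', this])
  refine ⟨κ, ⟨hκ, fun z t b h => ?_⟩, ?_⟩
  · obtain ⟨z', s, l, hs, h₁, h₂⟩ := D.lifts.exists_pair t.left b.left
    obtain ⟨k, hk, hk'⟩ := Pair.exists_lift h𝒴.isGroupoidValued D.m (s ≫ t) l h₁.symm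
    refine rel_of_isCov h𝒴 h𝒳 s hs ?_
    rw [← h s k hk'.symm, ← Category.assoc, ← hk', Category.assoc, hκ']
    exact (hR.comp k).tr _
  · rintro κ₁ ⟨h₁, h₂⟩
    refine Pair.hom_ext_of_isCov h𝒴 D.m D.isCov (h₁.trans hκ.symm) ?_
    refine (h₂ _ _ rel_m_c).eq h𝒴 ?_ ?_
    · rw [hκ']; exact hR
    · rw [Pair.comp_left, Pair.comp_left, h₁, hκ]

end Chart

lemma IsPairAtlas.exists_chart_over [HasPullbacks C] (hv : IsPairAtlas J Y v)
    (h𝒳 : IsGroupoidValued 𝒳) (h𝒴 : IsGroupoidStack J 𝒴) (τ : TransportSystem J Y v)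
    (e : Tot 𝒳) : ∃ y : 𝒴.obj (.mk (op e.base)), Nonempty (Chart τ ⟨e, y⟩) := by
  obtain ⟨a, c, p, hp, hl⟩ : ∃ (a : Pair 𝒳 𝒴) (c : a ⟶ Y.obj v) (p : a.pt ⟶ e),
      Tot.IsCovering J p.base ∧ LocallyLifts J p c.left := by
    obtain ⟨w, p, q, hp, hl⟩ := hv.exists_chart e
    exact ⟨(Y.obj v).pb q, (Y.obj v).pbHom q, p, hp, hl⟩
  -- Transport between arrows to the value at `v`, lifted through the cartesian arrow `c`, is the
  -- descent datum on the chart. The transport laws give its axioms.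
  choose σ hσ hσ' using fun (z : Pair 𝒳 𝒴) (k : z ⟶ a) (f : z.pt ⟶ a.pt) =>
    Pair.exists_lift h𝒴.isGroupoidValued c (τ.tr (k ≫ c) (f ≫ c.left)) f (τ.tr_left _ _).symm
  have hext {z : Pair 𝒳 𝒴} {l l' : z ⟶ a} (h : l.left = l'.left) (h' : l ≫ c = l' ≫ c) : l = l' :=
    Pair.hom_ext_of_comp h𝒴.isGroupoidValued c h h'
  obtain ⟨y, m, rfl, hm⟩ := Pair.exists_descent h𝒳 h𝒴 p hp (fun {z} k f _ => σ z k f)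
    (fun k f _ => hσ _ k f)
    (fun l k f _ k' f' _ h h' => by
      subst h h'
      refine hext (by rw [hσ, Pair.comp_left, hσ]) ?_
      rw [hσ', Category.assoc l (σ _ k f) c, hσ', τ.comp_tr, Category.assoc, Category.assoc])
    (fun k => by
      refine hext (hσ _ _ _) ?_
      rw [hσ']
      exact τ.tr_eq_self _ _ rfl)
    (fun k f f' _ _ _ => by
      refine hext (by rw [hσ, hσ]) ?_
      rw [hσ', hσ', τ.tr_tr, hσ'])
  refine ⟨y, ⟨⟨a, m, c, hp, hl, fun {x} k₁ k₂ h => ?_⟩⟩⟩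
  have h₁ : σ x k₁ k₂.left = k₂ := by
    refine Pair.hom_ext_of_comp h𝒴.isGroupoidValued m (hσ _ _ _) ?_
    exact (hm k₁ k₂.left (congrArg (fun t => t.left) h)).trans h
  refine (hσ' x k₁ k₂.left).symm.trans ?_
  rw [h₁]

/-- The original values already are descended objects, with the chart in `A` as covering.
Identifying the relation with transport makes the arrows `Y.map f` compatible. -/
lemma IsPairAtlas.exists_chart_sub (hv : IsPairAtlas J Y v) (h𝒴 : IsGroupoidStack J 𝒴)
    (τ : TransportSystem J Y v) (d : A) : ∃ D : Chart τ (Y.obj d),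
      ∀ ⦃z : Pair 𝒳 𝒴⦄ (t : z ⟶ Y.obj d) (b : z ⟶ Y.obj v), D.Rel t b ↔ τ.tr t b.left = b := by
  obtain ⟨w, p, q, hp, hl, -⟩ := hv.exists_sub_chart d
  refine ⟨⟨Y.obj w, Y.map p, Y.map q, hp, hl, fun {x} k₁ k₂ h => ?_⟩, fun z t b => ⟨fun h => ?_,
    fun h z' r k hk => ?_⟩⟩
  · rw [τ.tr_map, ← τ.tr_map k₁ p, h, τ.tr_map, Pair.comp_left, τ.tr_self]
  · obtain ⟨z', s, l, hs, h₁, h₂⟩ := hl.exists_pair t.left b.left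
    obtain ⟨k, -, hk⟩ := Pair.exists_lift h𝒴.isGroupoidValued (Y.map p) (s ≫ t) l h₁.symm
    refine Pair.hom_ext_of_isCov h𝒴 s hs (τ.tr_left _ _) ?_
    have h₃ := h s k hk.symm
    dsimp only at h₃
    rw [τ.tr_map] at h₃
    rw [τ.comp_tr, ← hk, τ.tr_map, ← h₃]
    simp only [Pair.comp_left]
  · dsimp only at hk ⊢
    rw [τ.tr_map, ← τ.tr_map k p, ← hk]
    conv_rhs => rw [← h]
    rw [τ.comp_tr, Pair.comp_left]

lemma essSurj_pre [HasPullbacks C] (h𝒳 : IsGroupoidValued 𝒳) (h𝒴 : IsGroupoidStack J 𝒴)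
    {j : A ⥤ Tot 𝒳} {v : A} (hv : IsAtlas J j v) :
    (Sec.pre j (Pseudofunctor.CoGrothendieck.forget 𝒳) 𝒴).EssSurj where
  mem_essImage y₀ := by
    have hY := hv.isPairAtlas y₀
    obtain ⟨τ⟩ := hY.nonempty_transportSystem h𝒳 h𝒴
    choose y D using hY.exists_chart_over h𝒳 h𝒴 τ
    replace D := fun e => (D e).some
    choose D' hD' using hY.exists_chart_sub h𝒴 τ
    -- Uniqueness of `κ` yields functoriality of the extension, whatever charts were chosen; the
    -- arrows `μ` compare it with the original section.
    choose κ hκ huniq using fun (e e' : Tot 𝒳) (u : e ⟶ e') =>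
      Chart.existsUnique_hom h𝒴 h𝒳 (D e) (D e') u
    choose μ hμ _ using fun (a : A) =>
      Chart.existsUnique_hom h𝒴 h𝒳 (D (j.obj a)) (D' a) (𝟙 _)
    let s : Sec (Pseudofunctor.CoGrothendieck.forget 𝒳) 𝒴 :=
      { fib := y
        map := fun u => (κ _ _ u).right
        map_base := fun u => by rw [(κ _ _ u).w, (hκ _ _ u).1]; rfl
        map_id := fun e => by
          have := huniq e e (𝟙 e) (𝟙 _) ⟨rfl, fun z t b h => by rwa [Category.comp_id]⟩
          rw [← this]; rfl
        map_comp := fun {a b c} f g => by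
          have := huniq a c (f ≫ g) (κ _ _ f ≫ κ _ _ g)
            ⟨by rw [Pair.comp_left, (hκ _ _ f).1, (hκ _ _ g).1], fun z t b h => by
              rw [← Category.assoc]; exact (hκ _ _ g).2 _ _ ((hκ _ _ f).2 _ _ h)⟩
          rw [← this]; rfl }
    refine ⟨s, ⟨Sec.isoOfHom h𝒴.isGroupoidValued
      { app := fun a => (μ a).right
        app_base := fun a => by rw [(μ a).w, (hμ a).1]; rfl
        naturality := fun {a b} f => ?_ }⟩⟩
    have := (Chart.existsUnique_hom h𝒴 h𝒳 (D (j.obj a)) (D' b) (j.map f)).unique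
      (y₁ := κ _ _ (j.map f) ≫ μ b) (y₂ := μ a ≫ y₀.subPair.map f)
      ⟨by rw [Pair.comp_left, (hκ _ _ _).1, (hμ b).1]; exact Category.comp_id _, fun z t b h => by
        rw [← Category.assoc]; exact (hμ _).2 _ _ ((hκ _ _ _).2 _ _ h)⟩
      ⟨by rw [Pair.comp_left, (hμ a).1]; exact Category.id_comp _, fun z t b h => by
        rw [← Category.assoc, hD', τ.tr_map, ← hD']
        exact (hμ _).2 _ _ h⟩
    exact congrArg (fun t => t.right) this

/-- Sections of a stack over the total category of `𝒳` are the same as sections over a subcategory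
containing an atlas. -/
theorem isEquivalence_pre [HasPullbacks C] (h𝒳 : IsGroupoidValued 𝒳) (h𝒴 : IsGroupoidStack J 𝒴)
    {j : A ⥤ Tot 𝒳} {v : A} (hv : IsAtlas J j v) :
    (Sec.pre j (Pseudofunctor.CoGrothendieck.forget 𝒳) 𝒴).IsEquivalence where
  faithful := faithful_pre h𝒴 hv
  full := full_pre h𝒳 h𝒴 hv
  essSurj := essSurj_pre h𝒳 h𝒴 hv

end EssSurj

/-! ### Morphisms of presheaves are sections over the total category. -/

section Transformations

variable {C : Type u₁} [Category.{v₁} C]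

namespace Tot

variable {𝒴 : PreStk.{w, w'} C}

lemma cart_id {S : C} (y : 𝒴.obj (.mk (op S))) : cart (𝟙 S) y = vert (pullId y).inv := by
  have h : vert (pullId y).inv ≫ vert (pullId y).hom = 𝟙 _ := by
    rw [← vert_comp, Iso.inv_hom_id, vert_id]
  rw [← Category.comp_id (vert (pullId y).inv), ← vert_pullId_hom_comp_cart, ← Category.assoc, h]
  exact (Category.id_comp _).symm

/-- The morphism of a fiber given by a morphism of the total category over an identity. -/
def down {S : C} {x y : 𝒴.obj (.mk (op S))} (m : mk x ⟶ mk y) (hm : m.base = 𝟙 S) : x ⟶ y :=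
  fiberOver m (𝟙 S) hm ≫ (pullId y).inv

@[simp]
lemma vert_down {S : C} {x y : 𝒴.obj (.mk (op S))} (m : mk x ⟶ mk y) (hm : m.base = 𝟙 S) :
    vert (down m hm) = m := by
  rw [down, vert_comp, ← cart_id]
  exact vert_fiberOver_comp_cart m (𝟙 S) hm

lemma pullComp_inv_eq {S T Z : C} (f : T ⟶ S) (g : Z ⟶ T) (y : 𝒴.obj (.mk (op S))) :
    (pullComp f g (g ≫ f) rfl y).inv =
      (𝒴.mapComp f.op.toLoc g.op.toLoc).hom.toNatTrans.app y :=
  congrArg (fun t => t.hom.toNatTrans.app y) (𝒴.mapComp'_eq_mapComp f.op.toLoc g.op.toLoc)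

end Tot

variable {𝓕 𝒢 ℋ : PreStk.{w, w'} C}

/-- The action of a morphism of presheaves on sections. -/
abbrev appObj (η : 𝓕 ⟶ 𝒢) {S : C} (x : 𝓕.obj (.mk (op S))) : 𝒢.obj (.mk (op S)) :=
  (η.app (.mk (op S))).toFunctor.obj x

/-- The naturality constraint of a morphism of presheaves. -/
def appPull (η : 𝓕 ⟶ 𝒢) {S T : C} (f : T ⟶ S) (x : 𝓕.obj (.mk (op S))) :
    appObj η (pull 𝓕 f x) ≅ pull 𝒢 f (appObj η x) :=
  (Cat.Hom.toNatIso (η.naturality f.op.toLoc)).app x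

/-- The morphism of total categories induced by a morphism of presheaves. -/
def totMap (η : 𝓕 ⟶ 𝒢) {a b : Tot 𝓕} (u : a ⟶ b) :
    Tot.mk (appObj η a.fiber) ⟶ Tot.mk (appObj η b.fiber) :=
  (Pseudofunctor.CoGrothendieck.map η).map u

lemma totMap_id (η : 𝓕 ⟶ 𝒢) (a : Tot 𝓕) : totMap η (𝟙 a) = 𝟙 _ :=
  (Pseudofunctor.CoGrothendieck.map η).map_id a

lemma totMap_comp (η : 𝓕 ⟶ 𝒢) {a b c : Tot 𝓕} (u : a ⟶ b) (u' : b ⟶ c) :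
    totMap η (u ≫ u') = totMap η u ≫ totMap η u' :=
  (Pseudofunctor.CoGrothendieck.map η).map_comp u u'

lemma totMap_eq (η : 𝓕 ⟶ 𝒢) {a b : Tot 𝓕} (u : a ⟶ b) :
    totMap η u = Tot.vert ((η.app (.mk (op a.base))).toFunctor.map (Tot.fiberOver u u.base rfl) ≫
        (appPull η u.base b.fiber).hom) ≫ Tot.cart u.base (appObj η b.fiber) := by
  rw [Tot.vert_comp_cart, Tot.fiberOver, eqToHom_refl, Category.comp_id]
  rfl

lemma map_pullId_comp_appPull (η : 𝓕 ⟶ 𝒢) {S : C} (y : 𝓕.obj (.mk (op S))) :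
    (η.app (.mk (op S))).toFunctor.map (Tot.pullId y).hom ≫ (appPull η (𝟙 S) y).hom =
      (Tot.pullId (appObj η y)).hom :=
  Tot.homMk_injective (a := Tot.mk (appObj η y)) (b := Tot.mk (appObj η y))
    (totMap_id η (Tot.mk y))

lemma totMap_vert (η : 𝓕 ⟶ 𝒢) {S : C} {x y : 𝓕.obj (.mk (op S))} (φ : x ⟶ y) :
    totMap η (Tot.vert φ) = Tot.vert ((η.app (.mk (op S))).toFunctor.map φ) := by
  refine congrArg (fun t => (Tot.homMk (𝟙 S) t : Tot.mk (appObj η x) ⟶ Tot.mk (appObj η y))) ?_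
  rw [← map_pullId_comp_appPull, ← Category.assoc, ← Functor.map_comp]
  rfl

lemma totMap_cart (η : 𝓕 ⟶ 𝒢) {S T : C} (f : T ⟶ S) (x : 𝓕.obj (.mk (op S))) :
    totMap η (Tot.cart f x) = Tot.vert (appPull η f x).hom ≫ Tot.cart f (appObj η x) := by
  rw [Tot.vert_comp_cart]
  refine congrArg (fun t => (Tot.homMk f t : Tot.mk (appObj η (pull 𝓕 f x)) ⟶
    Tot.mk (appObj η x))) ?_
  refine (congrArg (· ≫ _) ((η.app (.mk (op T))).toFunctor.map_id (pull 𝓕 f x))).trans ?_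
  exact Category.id_comp _

lemma modification_naturality {η θ : 𝓕 ⟶ 𝒢} (Γ : η ⟶ θ) {S T : C} (f : T ⟶ S)
    (x : 𝓕.obj (.mk (op S))) :
    (Γ.as.app (.mk (op T))).toNatTrans.app (pull 𝓕 f x) ≫ (appPull θ f x).hom =
      (appPull η f x).hom ≫
        (𝒢.map f.op.toLoc).toFunctor.map ((Γ.as.app (.mk (op S))).toNatTrans.app x) := by
  exact congrArg (fun t => t.toNatTrans.app x) (Γ.as.naturality f.op.toLoc)

lemma totMap_comp_vert {η θ : 𝓕 ⟶ 𝒢} (Γ : η ⟶ θ) {a b : Tot 𝓕} (u : a ⟶ b) :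
    totMap η u ≫ Tot.vert ((Γ.as.app (.mk (op b.base))).toNatTrans.app b.fiber) =
      Tot.vert ((Γ.as.app (.mk (op a.base))).toNatTrans.app a.fiber) ≫ totMap θ u := by
  rw [totMap_eq, totMap_eq, Category.assoc, ← Tot.vert_map_comp_cart, ← Tot.vert_comp_assoc,
    ← Tot.vert_comp_assoc, Category.assoc, ← modification_naturality, ← Category.assoc,
    ← Category.assoc, NatTrans.naturality]

/-- A morphism of presheaves, seen as a section over the total category. -/
def toSecObj (η : 𝓕 ⟶ 𝒢) : Sec (Pseudofunctor.CoGrothendieck.forget 𝓕) 𝒢 where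
  fib e := appObj η e.fiber
  map u := totMap η u
  map_base _ := rfl
  map_id e := totMap_id η e
  map_comp f g := totMap_comp η f g

variable (𝓕 𝒢) in
/-- Morphisms of presheaves, seen as sections over the total category. -/
def toSec : (𝓕 ⟶ 𝒢) ⥤ Sec (Pseudofunctor.CoGrothendieck.forget 𝓕) 𝒢 where
  obj := toSecObj
  map Γ :=
    { app e := Tot.vert ((Γ.as.app (.mk (op e.base))).toNatTrans.app e.fiber)
      app_base _ := rfl
      naturality u := totMap_comp_vert Γ u }
  map_id _ := Sec.hom_ext fun _ => Tot.vert_id _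
  map_comp _ _ := Sec.hom_ext fun _ => Tot.vert_comp _ _

instance : (toSec 𝓕 𝒢).Faithful where
  map_injective {η θ} Γ Γ' h := by
    refine Pseudofunctor.StrongTrans.homCategory.ext fun ⟨⟨S⟩⟩ => ?_
    refine Cat.Hom₂.ext (NatTrans.ext (funext fun x => ?_))
    exact Tot.vert_injective (congrArg (fun t => Sec.Hom.app t (Tot.mk x)) h)

/-- Naturality along vertical arrows makes each component a natural transformation, and naturality
along cartesian arrows is the modification axiom. -/
lemma exists_modification {η θ : 𝓕 ⟶ 𝒢}
    (φ : ∀ {S : C} (x : 𝓕.obj (.mk (op S))), Tot.mk (appObj η x) ⟶ Tot.mk (appObj θ x))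
    (hφ : ∀ {S : C} (x : 𝓕.obj (.mk (op S))), (φ x).base = 𝟙 S)
    (hnat : ∀ {a b : Tot 𝓕} (u : a ⟶ b), totMap η u ≫ φ b.fiber = φ a.fiber ≫ totMap θ u) :
    ∃ Γ : η ⟶ θ, ∀ {S : C} (x : 𝓕.obj (.mk (op S))),
      Tot.vert ((Γ.as.app (.mk (op S))).toNatTrans.app x) = φ x := by
  let Γ (S : C) : (η.app (.mk (op S))).toFunctor ⟶ (θ.app (.mk (op S))).toFunctor :=
    { app x := Tot.down (φ x) (hφ x)
      naturality x y u := by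
        apply Tot.vert_injective
        rw [Tot.vert_comp, Tot.vert_comp, Tot.vert_down, Tot.vert_down, ← totMap_vert,
          ← totMap_vert]
        exact hnat (Tot.vert u) }
  have hΓ {S : C} (x : 𝓕.obj (.mk (op S))) : Tot.vert ((Γ S).app x) = φ x := Tot.vert_down _ _
  have hΓ' {S T : C} (f : T ⟶ S) (x : 𝓕.obj (.mk (op S))) :
      (Γ T).app (pull 𝓕 f x) ≫ (appPull θ f x).hom =
        (appPull η f x).hom ≫ (𝒢.map f.op.toLoc).toFunctor.map ((Γ S).app x) := by
    apply Tot.eq_of_vert_comp_cart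
    rw [Tot.vert_comp, Category.assoc, ← totMap_cart, Tot.vert_comp, Category.assoc,
      Tot.vert_map_comp_cart, ← Category.assoc, ← totMap_cart, hΓ, hΓ]
    exact (hnat (Tot.cart f x)).symm
  refine ⟨⟨{ app := fun ⟨⟨S⟩⟩ => (Γ S).toCatHom₂, naturality := ?_ }⟩, hΓ⟩
  rintro ⟨⟨S⟩⟩ ⟨⟨T⟩⟩ ⟨f⟩
  refine Cat.Hom₂.ext (NatTrans.ext (funext fun x => ?_))
  exact hΓ' f.unop x

instance : (toSec 𝓕 𝒢).Full where
  map_surjective {η θ} φ := by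
    obtain ⟨Γ, hΓ⟩ := exists_modification (η := η) (θ := θ) (fun x => φ.app (Tot.mk x))
      (fun x => φ.app_base _) (fun u => φ.naturality u)
    exact ⟨Γ, Sec.hom_ext fun e => hΓ e.fiber⟩

namespace Sec

variable {𝓕 : PreStk.{v, u} C} {𝒢 : PreStk.{w, w'} C}

variable (h𝒢 : IsGroupoidValued 𝒢) (y : Sec (Pseudofunctor.CoGrothendieck.forget 𝓕) 𝒢)

/-- The value of a section. -/
def val {S : C} (x : 𝓕.obj (.mk (op S))) : 𝒢.obj (.mk (op S)) := y.fib (Tot.mk x)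

/-- The action of a section on morphisms. -/
def valMap {S T : C} {x : 𝓕.obj (.mk (op S))} {x' : 𝓕.obj (.mk (op T))} (u : Tot.mk x ⟶ Tot.mk x') :
    Tot.mk (y.val x) ⟶ Tot.mk (y.val x') := y.map u

lemma valMap_base {S T : C} {x : 𝓕.obj (.mk (op S))} {x' : 𝓕.obj (.mk (op T))}
    (u : Tot.mk x ⟶ Tot.mk x') : (y.valMap u).base = u.base := y.map_base u

lemma valMap_id {S : C} (x : 𝓕.obj (.mk (op S))) : y.valMap (𝟙 (Tot.mk x)) = 𝟙 _ := y.map_id _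

lemma valMap_comp {S T Z : C} {x : 𝓕.obj (.mk (op S))} {x' : 𝓕.obj (.mk (op T))}
    {x'' : 𝓕.obj (.mk (op Z))} (u : Tot.mk x ⟶ Tot.mk x') (u' : Tot.mk x' ⟶ Tot.mk x'') :
    y.valMap (u ≫ u') = y.valMap u ≫ y.valMap u' := y.map_comp _ _

/-- The action of a section on morphisms of a fiber. -/
def fiberMap {S : C} {x x' : 𝓕.obj (.mk (op S))} (φ : x ⟶ x') : y.val x ⟶ y.val x' :=
  Tot.down (y.valMap (Tot.vert φ)) ((y.valMap_base _).trans (Tot.vert_base φ))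

lemma vert_fiberMap {S : C} {x x' : 𝓕.obj (.mk (op S))} (φ : x ⟶ x') :
    Tot.vert (y.fiberMap φ) = y.valMap (Tot.vert φ) :=
  Tot.vert_down _ _

/-- The functor between fibers given by a section over the total category. -/
def fiberFunctor (S : C) : 𝓕.obj (.mk (op S)) ⥤ 𝒢.obj (.mk (op S)) where
  obj x := y.val x
  map φ := y.fiberMap φ
  map_id x := by
    apply Tot.vert_injective
    rw [vert_fiberMap, Tot.vert_id, Tot.vert_id, y.valMap_id]
  map_comp φ ψ := by
    apply Tot.vert_injective
    rw [vert_fiberMap, Tot.vert_comp, Tot.vert_comp, vert_fiberMap, vert_fiberMap, y.valMap_comp]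

/-- The comparison between the values of a section and pullbacks. -/
def fiberPull {S T : C} (f : T ⟶ S) (x : 𝓕.obj (.mk (op S))) :
    y.val (pull 𝓕 f x) ⟶ pull 𝒢 f (y.val x) :=
  Tot.fiberOver (y.valMap (Tot.cart f x)) f (y.valMap_base _)

lemma vert_fiberPull_comp_cart {S T : C} (f : T ⟶ S) (x : 𝓕.obj (.mk (op S))) :
    Tot.vert (y.fiberPull f x) ≫ Tot.cart f (y.val x) = y.valMap (Tot.cart f x) :=
  Tot.vert_fiberOver_comp_cart (y.valMap (Tot.cart f x)) f (y.valMap_base _)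

lemma fiberPull_naturality {S T : C} (f : T ⟶ S) {x x' : 𝓕.obj (.mk (op S))} (φ : x ⟶ x') :
    y.fiberMap ((𝓕.map f.op.toLoc).toFunctor.map φ) ≫ y.fiberPull f x' =
      y.fiberPull f x ≫ (𝒢.map f.op.toLoc).toFunctor.map (y.fiberMap φ) := by
  apply Tot.eq_of_vert_comp_cart
  rw [Tot.vert_comp, Tot.vert_comp, Category.assoc, Category.assoc, vert_fiberPull_comp_cart,
    Tot.vert_map_comp_cart, ← Category.assoc (Tot.vert (y.fiberPull f x)),
    vert_fiberPull_comp_cart, vert_fiberMap, vert_fiberMap, ← y.valMap_comp,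
    ← y.valMap_comp, Tot.vert_map_comp_cart]

lemma fiberPull_id {S : C} (x : 𝓕.obj (.mk (op S))) :
    y.fiberPull (𝟙 S) x ≫ (Tot.pullId (y.val x)).inv =
      y.fiberMap (Tot.pullId x).inv := by
  apply Tot.vert_injective
  rw [Tot.vert_comp, ← Tot.cart_id, vert_fiberPull_comp_cart, Tot.cart_id]
  exact (y.vert_fiberMap _).symm

-- The composition axiom for the transformation attached to `y`: after composing with cartesian
-- arrows, both sides become the value of `y` at a single arrow.
include h𝒢 in
lemma fiberPull_comp {S T Z : C} (f : T ⟶ S) (g : Z ⟶ T) (x : 𝓕.obj (.mk (op S))) :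
    y.fiberPull (g ≫ f) x ≫ (Tot.pullComp f g (g ≫ f) rfl (y.val x)).inv =
      y.fiberMap (Tot.pullComp f g (g ≫ f) rfl x).inv ≫
        y.fiberPull g (pull 𝓕 f x) ≫ (𝒢.map g.op.toLoc).toFunctor.map (y.fiberPull f x) := by
  apply Tot.eq_of_vert_comp_cart
  refine Tot.hom_ext_of_comp h𝒢 (Tot.cart f (y.val x)) rfl ?_
  simp only [Tot.vert_comp, Category.assoc]
  rw [Tot.vert_pullComp_inv_comp_cart, vert_fiberPull_comp_cart, Tot.vert_map_comp_cart_assoc,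
    vert_fiberPull_comp_cart, ← Category.assoc (Tot.vert (y.fiberPull g _)),
    vert_fiberPull_comp_cart, vert_fiberMap, ← y.valMap_comp, ← y.valMap_comp,
    Tot.vert_pullComp_inv_comp_cart]

end Sec

lemma comp_comp_eq_comp_id_comp {a b c d : C} (p : a ⟶ b) (q : b ⟶ c) (r : c ⟶ d) :
    p ≫ q ≫ r = p ≫ 𝟙 _ ≫ q ≫ 𝟙 _ ≫ r ≫ 𝟙 _ := by
  simp only [Category.id_comp, Category.comp_id]

/-- The values of a section on vertical arrows give functors between fibers. Its values on cartesian
arrows give the naturality constraints, invertible because the fibers of `𝒢` are groupoids. -/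
lemma essSurj_toSec (h𝒢 : IsGroupoidValued 𝒢) : (toSec 𝓕 𝒢).EssSurj where
  mem_essImage y := by
    have hiso {S T : C} (f : T ⟶ S) (x : 𝓕.obj (.mk (op S))) : IsIso (y.fiberPull f x) :=
      have := h𝒢 T
      IsGroupoid.all_isIso _
    let nat {S T : C} (f : T ⟶ S) : (𝓕.map f.op.toLoc).toFunctor ⋙ y.fiberFunctor T ≅
        y.fiberFunctor S ⋙ (𝒢.map f.op.toLoc).toFunctor :=
      NatIso.ofComponents (fun x => @asIso _ _ _ _ _ (hiso f x))
        (fun φ => y.fiberPull_naturality f φ)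
    let app (S : LocallyDiscrete Cᵒᵖ) : 𝓕.obj S ⟶ 𝒢.obj S :=
      (y.fiberFunctor S.as.unop).toCatHom
    let iso {a b : LocallyDiscrete Cᵒᵖ} (f : a ⟶ b) : 𝓕.map f ≫ app b ≅ app a ≫ 𝒢.map f :=
      Cat.Hom.isoMk (nat f.as.unop)
    let η : 𝓕 ⟶ 𝒢 :=
      { app := app
        naturality := iso
        naturality_naturality := by
          rintro a b f g φ
          obtain rfl := LocallyDiscrete.eq_of_hom φ
          obtain rfl : φ = 𝟙 _ := Subsingleton.elim _ _
          rw [PrelaxFunctor.map₂_id, PrelaxFunctor.map₂_id, Bicategory.id_whiskerRight,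
            Bicategory.whiskerLeft_id, Category.id_comp, Category.comp_id]
        naturality_id := by
          rintro ⟨⟨S⟩⟩
          refine Cat.Hom₂.ext (NatTrans.ext (funext fun x => ?_))
          refine (y.fiberPull_id x).trans ?_
          exact (Category.comp_id _).symm.trans (congrArg (_ ≫ ·) (Category.comp_id _).symm)
        naturality_comp := by
          rintro ⟨⟨S⟩⟩ ⟨⟨T⟩⟩ ⟨⟨Z⟩⟩ ⟨f⟩ ⟨g⟩
          refine Cat.Hom₂.ext (NatTrans.ext (funext fun x => ?_))
          have h := y.fiberPull_comp h𝒢 f.unop g.unop x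
          rw [Tot.pullComp_inv_eq, Tot.pullComp_inv_eq] at h
          exact h.trans (comp_comp_eq_comp_id_comp _ _ _) }
    refine ⟨η, ⟨Sec.isoOfHom h𝒢
      { app := fun _ => 𝟙 _
        app_base := fun _ => rfl
        naturality := fun {a b} u => ?_ }⟩⟩
    refine (Category.comp_id _).trans (Eq.trans ?_ (Category.id_comp _).symm)
    refine (totMap_eq η u).trans ?_
    rw [Tot.vert_comp, Category.assoc]
    refine (congrArg₂ (· ≫ ·) (y.vert_fiberMap (Tot.fiberOver u u.base rfl))
      (y.vert_fiberPull_comp_cart u.base b.fiber)).trans ?_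
    rw [← y.valMap_comp, Tot.vert_fiberOver_comp_cart]
    rfl

end Transformations

/-! ### Restriction of morphisms as restriction of sections. -/

section Restriction

variable {C : Type u₁} [Category.{v₁} C] {D : Type u₂} [Category.{v₂} D] {A : Type u₃}
  [Category.{v₃} A]

lemma isEquivalence_toSec {𝓕 𝒢 : PreStk.{w, w'} C} (h𝒢 : IsGroupoidValued 𝒢) :
    (toSec 𝓕 𝒢).IsEquivalence where
  essSurj := essSurj_toSec h𝒢

lemma map₂_app_eq_eqToHom (𝒳 : PreStk.{w, w'} C) {a b : LocallyDiscrete Cᵒᵖ} {f g : a ⟶ b}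
    (α : f ⟶ g) (x : 𝒳.obj a) (h : (𝒳.map f).toFunctor.obj x = (𝒳.map g).toFunctor.obj x) :
    (𝒳.map₂ α).toNatTrans.app x = eqToHom h := by
  obtain rfl := LocallyDiscrete.eq_of_hom α
  obtain rfl : α = 𝟙 _ := Subsingleton.elim _ _
  rw [PrelaxFunctor.map₂_id]
  rfl

/-- The total category of a restriction maps to the total category. -/
def totRestrict (ι : D ⥤ C) (𝒳 : PreStk.{w, w'} C) : Tot (restrict ι 𝒳) ⥤ Tot 𝒳 where
  obj e := ⟨ι.obj e.base, e.fiber⟩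
  map u := ⟨ι.map u.base, u.fiber⟩
  map_id e := by
    refine Pseudofunctor.CoGrothendieck.Hom.ext _ _ (ι.map_id _) ?_
    refine congrArg (_ ≫ ·) ?_
    exact map₂_app_eq_eqToHom 𝒳 _ _ _
  map_comp {a b c} f g := by
    refine Pseudofunctor.CoGrothendieck.Hom.ext _ _ (ι.map_comp _ _) ?_
    refine Eq.trans ?_ (Category.assoc _ _ _).symm
    refine congrArg (_ ≫ ·) ?_
    refine Eq.trans ?_ (Category.assoc _ _ _).symm
    refine congrArg (_ ≫ ·) ?_
    refine congrArg (_ ≫ ·) ?_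
    exact map₂_app_eq_eqToHom 𝒳 _ _ _

variable {ι : D ⥤ C} {𝒳 𝒴 : PreStk.{w, w'} C}

/-- The bases have to be compared separately, as `ι` need not be faithful. -/
lemma totRestrict_map_injective {a b : Tot (restrict ι 𝒳)} {u u' : a ⟶ b} (hb : u.base = u'.base)
    (h : (totRestrict ι 𝒳).map u = (totRestrict ι 𝒳).map u') : u = u' := by
  obtain ⟨f, α⟩ := u
  obtain ⟨f', β⟩ := u'
  obtain rfl : f = f' := hb
  congr 1
  exact Tot.homMk_injective (𝒴 := 𝒳) (a := (totRestrict ι 𝒳).obj a)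
    (b := (totRestrict ι 𝒳).obj b) h

lemma exists_totRestrict_map_eq {a b : Tot (restrict ι 𝒳)} (f : a.base ⟶ b.base)
    (n : (totRestrict ι 𝒳).obj a ⟶ (totRestrict ι 𝒳).obj b) (hn : n.base = ι.map f) :
    ∃ u : a ⟶ b, u.base = f ∧ (totRestrict ι 𝒳).map u = n := by
  obtain ⟨g, β⟩ := n
  obtain rfl : g = ι.map f := hn
  exact ⟨⟨f, β⟩, rfl, rfl⟩

/-- The map on homs of total categories induced by a restriction. -/
def totRestrictHom {S T : D} {x : 𝒳.obj (.mk (op (ι.obj S)))} {y : 𝒳.obj (.mk (op (ι.obj T)))}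
    (u : Tot.mk (𝒴 := restrict ι 𝒳) (S := S) x ⟶ Tot.mk (𝒴 := restrict ι 𝒳) (S := T) y) :
    Tot.mk x ⟶ Tot.mk y := (totRestrict ι 𝒳).map u

lemma totRestrictHom_vert {S : D} {x y : 𝒳.obj (.mk (op (ι.obj S)))} (φ : x ⟶ y) :
    totRestrictHom (ι := ι) (Tot.vert (𝒴 := restrict ι 𝒳) (S := S) φ) = Tot.vert φ := by
  refine Pseudofunctor.CoGrothendieck.Hom.ext _ _ (ι.map_id _) ?_
  refine Eq.trans ?_ (Category.assoc _ _ _).symm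
  refine congrArg (_ ≫ ·) ?_
  refine congrArg (_ ≫ ·) ?_
  exact map₂_app_eq_eqToHom 𝒳 _ _ _

/-- Sections of a restriction are sections over the composite functor. -/
def secRestrict (π : A ⥤ D) (ι : D ⥤ C) (𝒴 : PreStk.{w, w'} C) :
    Sec π (restrict ι 𝒴) ⥤ Sec (π ⋙ ι) 𝒴 where
  obj y :=
    { fib := y.fib
      map u := totRestrictHom (ι := ι) (y.map u)
      map_base u := congrArg ι.map (y.map_base u)
      map_id a := (congrArg (totRestrict ι 𝒴).map (y.map_id a)).trans
        ((totRestrict ι 𝒴).map_id _)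
      map_comp f g := (congrArg (totRestrict ι 𝒴).map (y.map_comp f g)).trans
        ((totRestrict ι 𝒴).map_comp _ _) }
  map φ :=
    { app a := totRestrictHom (ι := ι) (φ.app a)
      app_base a := (congrArg ι.map (φ.app_base a)).trans (ι.map_id _)
      naturality f := ((totRestrict ι 𝒴).map_comp _ _).symm.trans
        ((congrArg (totRestrict ι 𝒴).map (φ.naturality f)).trans
          ((totRestrict ι 𝒴).map_comp _ _)) }
  map_id _ := Sec.hom_ext fun _ => (totRestrict ι 𝒴).map_id _
  map_comp _ _ := Sec.hom_ext fun _ => (totRestrict ι 𝒴).map_comp _ _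

/-- Arrows over `f` in the total category of the restriction are the arrows over `ι.map f`. The base
of every arrow of a section is prescribed by `π`, so no condition on `ι` is needed. -/
lemma isEquivalence_secRestrict (π : A ⥤ D) (ι : D ⥤ C) (h𝒴 : IsGroupoidValued 𝒴) :
    (secRestrict π ι 𝒴).IsEquivalence where
  faithful := ⟨fun {y y'} φ ψ h => Sec.hom_ext fun a => totRestrict_map_injective
    ((φ.app_base a).trans (ψ.app_base a).symm) (congrArg (fun t => Sec.Hom.app t a) h)⟩
  full := ⟨fun {y y'} φ => by
    choose ψ hψ hψ' using fun a => exists_totRestrict_map_eq (ι := ι) (𝒳 := 𝒴)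
      (a := Tot.mk (y.fib a)) (b := Tot.mk (y'.fib a)) (𝟙 _) (φ.app a)
      ((φ.app_base a).trans (ι.map_id _).symm)
    refine ⟨{ app := ψ, app_base := hψ, naturality := fun {a b} f => ?_ }, Sec.hom_ext hψ'⟩
    refine totRestrict_map_injective ?_ ?_
    · rw [Tot.comp_base, Tot.comp_base, hψ, hψ]
      exact ((Category.comp_id _).trans ((y.map_base f).trans (y'.map_base f).symm)).trans
        (Category.id_comp _).symm
    · refine ((totRestrict ι 𝒴).map_comp _ _).trans (Eq.trans ?_
        ((totRestrict ι 𝒴).map_comp _ _).symm)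
      rw [hψ', hψ']
      exact φ.naturality f⟩
  essSurj := ⟨fun s => by
    choose ψ hψ hψ' using fun (a b : A) (f : a ⟶ b) =>
      exists_totRestrict_map_eq (ι := ι) (𝒳 := 𝒴) (a := ⟨π.obj a, s.fib a⟩)
      (b := ⟨π.obj b, s.fib b⟩) (π.map f) (s.map f) (s.map_base f)
    let y : Sec π (restrict ι 𝒴) :=
      { fib := s.fib
        map := fun f => ψ _ _ f
        map_base := fun f => hψ _ _ f
        map_id := fun a => totRestrict_map_injective ((hψ _ _ _).trans (π.map_id a))
          ((hψ' _ _ _).trans ((s.map_id a).trans ((totRestrict ι 𝒴).map_id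
            ⟨π.obj a, s.fib a⟩).symm))
        map_comp := fun f g => totRestrict_map_injective
          ((hψ _ _ _).trans ((π.map_comp f g).trans
            (congrArg₂ (· ≫ ·) (hψ _ _ f) (hψ _ _ g)).symm))
          ((hψ' _ _ _).trans ((s.map_comp f g).trans
            ((congrArg₂ (· ≫ ·) (hψ' _ _ f) (hψ' _ _ g)).symm.trans
              ((totRestrict ι 𝒴).map_comp _ _).symm))) }
    exact ⟨y, ⟨Sec.isoOfHom h𝒴
      { app := fun _ => 𝟙 _
        app_base := fun _ => rfl
        naturality := fun {a b} f => (Category.comp_id _).trans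
          ((hψ' a b f).trans (Category.id_comp _).symm) }⟩⟩⟩

/-- Restriction of morphisms corresponds to restriction of sections. -/
def toSecCompPre (ι : D ⥤ C) (𝒳 𝒴 : PreStk.{w, w'} C) :
    toSec 𝒳 𝒴 ⋙ Sec.pre (totRestrict ι 𝒳) (Pseudofunctor.CoGrothendieck.forget 𝒳) 𝒴 ≅
      restrictMor ι 𝒳 𝒴 ⋙ toSec (restrict ι 𝒳) (restrict ι 𝒴) ⋙
        secRestrict (Pseudofunctor.CoGrothendieck.forget (restrict ι 𝒳)) ι 𝒴 :=
  NatIso.ofComponents (fun η => Iso.refl _) (fun {η θ} Γ => by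
    refine (Category.comp_id _).trans (Eq.trans ?_ (Category.id_comp _).symm)
    refine Sec.hom_ext fun e => ?_
    exact (totRestrictHom_vert (ι := ι) (S := e.base)
      ((Γ.as.app (.mk (op (ι.obj e.base)))).toNatTrans.app e.fiber)).symm)

/-- Restriction to a subcategory containing an atlas is an equivalence. -/
theorem isEquivalence_restrictMor [HasPullbacks C] {J : GrothendieckTopology C}
    (h𝒳 : IsGroupoidValued 𝒳) (h𝒴 : IsGroupoidStack J 𝒴) {v : Tot (restrict ι 𝒳)}
    (hv : IsAtlas J (totRestrict ι 𝒳) v) : (restrictMor ι 𝒳 𝒴).IsEquivalence := by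
  have h₁ := isEquivalence_toSec (𝓕 := 𝒳) h𝒴.isGroupoidValued
  have h₂ := isEquivalence_pre h𝒳 h𝒴 hv
  have h₃ : IsGroupoidValued (restrict ι 𝒴) := fun S => h𝒴.isGroupoidValued (ι.obj S)
  have h₄ := isEquivalence_toSec (𝓕 := restrict ι 𝒳) h₃
  have h₅ := isEquivalence_secRestrict (Pseudofunctor.CoGrothendieck.forget (restrict ι 𝒳)) ι
    h𝒴.isGroupoidValued
  have h₀ : (toSec 𝒳 𝒴 ⋙ Sec.pre (totRestrict ι 𝒳)
    (Pseudofunctor.CoGrothendieck.forget 𝒳) 𝒴).IsEquivalence := inferInstance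
  have h₆ : (restrictMor ι 𝒳 𝒴 ⋙ toSec (restrict ι 𝒳) (restrict ι 𝒴) ⋙
      secRestrict (Pseudofunctor.CoGrothendieck.forget (restrict ι 𝒳)) ι 𝒴).IsEquivalence :=
    @Functor.isEquivalence_of_iso _ _ _ _ _ _ (toSecCompPre ι 𝒳 𝒴) h₀
  exact Functor.isEquivalence_of_comp_right _ (toSec (restrict ι 𝒳) (restrict ι 𝒴) ⋙
    secRestrict (Pseudofunctor.CoGrothendieck.forget (restrict ι 𝒳)) ι 𝒴)

end Restriction

/-! ### The presheaf of free groupoids on arrows to the values of `p`. -/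

section FreeStack

variable {C : Type u₁} [Category.{v₁} C] {B : Type u₂} [Category.{v₂} B]

/-- Morphisms from `T` to the values of `p`. -/
@[ext]
structure Arr (p : B ⥤ C) (T : C) where
  /-- the object -/
  right : B
  /-- the morphism -/
  hom : T ⟶ p.obj right

namespace Arr

variable {p : B ⥤ C}

/-- Morphisms of morphisms to the values of `p`. -/
@[ext]
structure Hom {T : C} (a b : Arr p T) where
  /-- the underlying morphism -/
  right : a.right ⟶ b.right
  w : a.hom ≫ p.map right = b.hom

instance (T : C) : Category (Arr p T) where
  Hom := Hom
  id a := ⟨𝟙 _, by rw [p.map_id, Category.comp_id]⟩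
  comp f g := ⟨f.right ≫ g.right, by rw [p.map_comp, ← Category.assoc, f.w, g.w]⟩
  id_comp _ := Hom.ext (Category.id_comp _)
  comp_id _ := Hom.ext (Category.comp_id _)
  assoc _ _ _ := Hom.ext (Category.assoc _ _ _)

@[simp] lemma id_right {T : C} (a : Arr p T) : Hom.right (𝟙 a) = 𝟙 _ := rfl

@[simp] lemma comp_right {T : C} {a b c : Arr p T} (f : a ⟶ b) (g : b ⟶ c) :
    (f ≫ g).right = f.right ≫ g.right := rfl

/-- Precomposition of a morphism to a value of `p`. -/
abbrev pull {T T' : C} (g : T' ⟶ T) (a : Arr p T) : Arr p T' := ⟨a.right, g ≫ a.hom⟩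

/-- Precomposition, as a functor. -/
def pullFunctor {T T' : C} (g : T' ⟶ T) : Arr p T ⥤ Arr p T' where
  obj a := a.pull g
  map f := ⟨f.right, (Category.assoc _ _ _).trans (congrArg (g ≫ ·) f.w)⟩

/-- The identity, between equal morphisms to a value of `p`. -/
def ofEq {T : C} {e : B} {f f' : T ⟶ p.obj e} (h : f = f') : Arr.mk e f ⟶ Arr.mk e f' :=
  ⟨𝟙 e, by rw [p.map_id, Category.comp_id, h]⟩

lemma ofEq_eq_eqToHom {T : C} {e : B} {f f' : T ⟶ p.obj e} (h : f = f') :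
    ofEq h = eqToHom (by rw [h]) := by
  subst h; rfl

lemma ofEq_comp_ofEq {T : C} {e : B} {f f' : T ⟶ p.obj e} (h : f = f') (h' : f' = f) :
    ofEq h ≫ ofEq h' = 𝟙 _ := by
  subst h
  exact Hom.ext (Category.comp_id _)

/-- Precomposition, on morphisms. -/
def pullMap {T T' : C} (g : T' ⟶ T) {a b : Arr p T} (φ : a ⟶ b) : a.pull g ⟶ b.pull g :=
  (pullFunctor g).map φ

/-- Iterated precomposition. -/
def pullPull {T T' T'' : C} (g : T' ⟶ T) (g' : T'' ⟶ T') (a : Arr p T) :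
    (a.pull g).pull g' ⟶ a.pull (g' ≫ g) :=
  ofEq (Category.assoc _ _ _).symm

/-- Precomposition with an identity. -/
def pullFunctorId (p : B ⥤ C) (T : C) : pullFunctor (p := p) (𝟙 T) ≅ 𝟭 _ :=
  NatIso.ofComponents (fun a => ⟨ofEq (Category.id_comp a.hom), ofEq (Category.id_comp a.hom).symm,
    ofEq_comp_ofEq _ _, ofEq_comp_ofEq _ _⟩)
    (fun f => Hom.ext ((Category.comp_id f.right).trans (Category.id_comp f.right).symm))

/-- Precomposition with a composition. -/
def pullFunctorComp (p : B ⥤ C) {T T' T'' : C} (g : T' ⟶ T) (g' : T'' ⟶ T') :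
    pullFunctor (p := p) (g' ≫ g) ≅ pullFunctor g ⋙ pullFunctor g' :=
  NatIso.ofComponents (fun a => ⟨ofEq (Category.assoc g' g a.hom),
    ofEq (Category.assoc g' g a.hom).symm, ofEq_comp_ofEq _ _, ofEq_comp_ofEq _ _⟩)
    (fun f => Hom.ext ((Category.comp_id f.right).trans (Category.id_comp f.right).symm))

/-- Equality on the nose, as for `pullFunctor_comp`, so that the free groupoids form a strict
functor and the coherence of the pseudofunctor comes for free. -/
lemma pullFunctor_id (p : B ⥤ C) (T : C) : pullFunctor (p := p) (𝟙 T) = 𝟭 _ :=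
  Functor.ext_of_iso (pullFunctorId p T)
    (fun a => Arr.ext rfl (heq_of_eq (Category.id_comp a.hom)))
    (fun a => ofEq_eq_eqToHom (Category.id_comp a.hom))

lemma pullFunctor_comp (p : B ⥤ C) {T T' T'' : C} (g : T' ⟶ T) (g' : T'' ⟶ T') :
    pullFunctor (p := p) (g' ≫ g) = pullFunctor g ⋙ pullFunctor g' :=
  Functor.ext_of_iso (pullFunctorComp p g g')
    (fun a => Arr.ext rfl (heq_of_eq (Category.assoc g' g a.hom)))
    (fun a => ofEq_eq_eqToHom (Category.assoc g' g a.hom))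

end Arr

/-- The strict presheaf of groupoids freely generated by `p`. -/
def freeFunctor (p : B ⥤ C) : Cᵒᵖ ⥤ Cat.{max u₂ v₁ v₂, max u₂ v₁} where
  obj T := Cat.of (FreeGroupoid (Arr p T.unop))
  map g := (FreeGroupoid.map (Arr.pullFunctor g.unop)).toCatHom
  map_id T := by
    refine Cat.ext ?_
    exact (congrArg FreeGroupoid.map (Arr.pullFunctor_id p T.unop)).trans (FreeGroupoid.map_id _)
  map_comp g g' := by
    refine Cat.ext ?_
    exact (congrArg FreeGroupoid.map (Arr.pullFunctor_comp p g.unop g'.unop)).trans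
      (FreeGroupoid.map_comp _ _)

/-- The presheaf of groupoids freely generated by `p`. -/
def freeStk (p : B ⥤ C) : PreStk.{max u₂ v₁ v₂, max u₂ v₁} C := (freeFunctor p).toPseudofunctor'

namespace freeStk

variable {p : B ⥤ C}

variable (p) in
lemma isGroupoidValued : IsGroupoidValued (freeStk p) := fun S =>
  inferInstanceAs (IsGroupoid (FreeGroupoid (Arr p S)))

/-- The object of the free groupoid given by a morphism to a value of `p`. -/
def pt {T : C} (a : Arr p T) : (freeStk p).obj (.mk (op T)) := FreeGroupoid.mk a

/-- The morphisms of the free groupoid given by the generators. -/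
def ptMap {T : C} {a b : Arr p T} (φ : a ⟶ b) : pt a ⟶ pt b := FreeGroupoid.homMk φ

lemma ptMap_id {T : C} (a : Arr p T) : ptMap (𝟙 a) = 𝟙 _ := (FreeGroupoid.of _).map_id a

lemma ptMap_comp {T : C} {a b c : Arr p T} (φ : a ⟶ b) (ψ : b ⟶ c) :
    ptMap (φ ≫ ψ) = ptMap φ ≫ ptMap ψ := (FreeGroupoid.of _).map_comp φ ψ

lemma eqToHom_pt {T : C} {e : B} {f f' : T ⟶ p.obj e} (h : f = f')
    (h' : pt (Arr.mk e f) = pt (Arr.mk e f')) : eqToHom h' = ptMap (Arr.ofEq h) := by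
  subst h
  exact (ptMap_id _).symm

lemma mapId_inv_app {T : C} (a : Arr p T) :
    ((freeStk p).mapId (.mk (op T))).inv.toNatTrans.app (pt a) =
      ptMap (Arr.ofEq (f := a.hom) (f' := 𝟙 T ≫ a.hom) (Category.id_comp _).symm) := by
  refine (Cat.eqToHom_app _ _ ((freeFunctor p).map_id (op T)).symm _).trans ?_
  exact eqToHom_pt (e := a.right) (Category.id_comp a.hom).symm _

lemma mapComp_inv_app {T T' T'' : C} (g : T' ⟶ T) (g' : T'' ⟶ T') (a : Arr p T) :
    ((freeStk p).mapComp g.op.toLoc g'.op.toLoc).inv.toNatTrans.app (pt a) =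
      ptMap (Arr.pullPull g g' a) := by
  refine (Cat.eqToHom_app _ _ ((freeFunctor p).map_comp g.op g'.op).symm _).trans ?_
  exact eqToHom_pt (e := a.right) (Category.assoc g' g a.hom).symm _

/-- The morphisms of the total category given by the generators. -/
def gen {T T' : C} {a : Arr p T'} {b : Arr p T} (g : T' ⟶ T) (u : a.right ⟶ b.right)
    (w : a.hom ≫ p.map u = g ≫ b.hom) : Tot.mk (pt a) ⟶ Tot.mk (pt b) :=
  Tot.homMk g (ptMap (b := b.pull g) ⟨u, w⟩)

lemma gen_congr {T T' : C} {a : Arr p T'} {b : Arr p T} {g g' : T' ⟶ T} {u u' : a.right ⟶ b.right}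
    (w : a.hom ≫ p.map u = g ≫ b.hom) (hg : g = g') (hu : u = u') :
    gen g u w = gen g' u' (by rw [← hg, ← hu, w]) := by
  subst hg hu; rfl

lemma gen_id {T : C} (a : Arr p T) (w : a.hom ≫ p.map (𝟙 _) = 𝟙 T ≫ a.hom) :
    gen (𝟙 T) (𝟙 _) w = 𝟙 (Tot.mk (pt a)) := by
  refine Pseudofunctor.CoGrothendieck.Hom.ext _ _ rfl ?_
  exact (mapId_inv_app a).symm.trans (Category.comp_id _).symm

lemma gen_comp {T T' T'' : C} {a : Arr p T''} {b : Arr p T'} {c : Arr p T} (g : T'' ⟶ T')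
    (g' : T' ⟶ T) (u : a.right ⟶ b.right) (u' : b.right ⟶ c.right)
    (w : a.hom ≫ p.map u = g ≫ b.hom) (w' : b.hom ≫ p.map u' = g' ≫ c.hom) :
    gen g u w ≫ gen g' u' w' = gen (g ≫ g') (u ≫ u') (by
      rw [p.map_comp, ← Category.assoc, w, Category.assoc, w', Category.assoc]) := by
  refine Pseudofunctor.CoGrothendieck.Hom.ext _ _ rfl ?_
  refine Eq.trans ?_ (Category.comp_id _).symm
  refine (congrArg (fun t => ptMap (b := b.pull g) ⟨u, w⟩ ≫
    ptMap (a := b.pull g) (b := (c.pull g').pull g)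
      ((Arr.pullFunctor g).map (X := b) (Y := c.pull g') ⟨u', w'⟩) ≫ t)
    (mapComp_inv_app g' g c)).trans ?_
  refine (congrArg (ptMap (b := b.pull g) ⟨u, w⟩ ≫ ·) (ptMap_comp _ _).symm).trans ?_
  refine (ptMap_comp _ _).symm.trans ?_
  refine congrArg ptMap (Arr.Hom.ext ?_)
  exact congrArg (u ≫ ·) (Category.comp_id u')

lemma vert_ptMap {T : C} {a b : Arr p T} (φ : a ⟶ b) :
    Tot.vert (ptMap φ) = gen (𝟙 T) φ.right (by rw [φ.w, Category.id_comp]) := by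
  refine Pseudofunctor.CoGrothendieck.Hom.ext _ _ rfl ?_
  refine Eq.trans ?_ (Category.comp_id _).symm
  refine (congrArg (ptMap φ ≫ ·) (mapId_inv_app b)).trans ?_
  refine (ptMap_comp _ _).symm.trans ?_
  refine congrArg ptMap (Arr.Hom.ext ?_)
  exact Category.comp_id φ.right

/-- The fiber component of a morphism of the total category. -/
def fiberHom {T T' : C} {a : Arr p T'} {b : Arr p T} (m : Tot.mk (pt a) ⟶ Tot.mk (pt b)) :
    pt a ⟶ pt (b.pull m.base) := m.fiber

/-- The canonical morphism from a pullback. -/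
def genCart {T T' : C} (g : T' ⟶ T) (b : Arr p T) : Tot.mk (pt (b.pull g)) ⟶ Tot.mk (pt b) :=
  gen (a := b.pull g) g (𝟙 b.right)
    ((congrArg ((g ≫ b.hom) ≫ ·) (p.map_id b.right)).trans (Category.comp_id _))

lemma vert_fiberHom_comp_genCart {T T' : C} {a : Arr p T'} {b : Arr p T}
    (m : Tot.mk (pt a) ⟶ Tot.mk (pt b)) : Tot.vert (fiberHom m) ≫ genCart m.base b = m := by
  refine (Tot.vert_comp_homMk (b := Tot.mk (pt b)) (fiberHom m) m.base _).trans ?_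
  refine Pseudofunctor.CoGrothendieck.Hom.ext _ _ rfl ?_
  refine congrArg (m.fiber ≫ ·) ?_
  exact ptMap_id _

/-- The generator underlying an object of the total category. -/
def arr {T : C} (x : (freeStk p).obj (.mk (op T))) : Arr p T :=
  (show FreeGroupoid (Arr p T) from x).as.as

end freeStk

/-- Components natural on generators are isomorphisms in the groupoid `G`, so the universal property
of the free groupoid extends them to a natural isomorphism. -/
lemma freeGroupoid_naturality {A : Type u₂} [Category.{v₂} A] {G : Type u₃} [Category.{v₃} G]
    [IsGroupoid G] (F F' : FreeGroupoid A ⥤ G)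
    (τ : ∀ X : A, F.obj (FreeGroupoid.mk X) ⟶ F'.obj (FreeGroupoid.mk X))
    (hτ : ∀ {X Y : A} (f : X ⟶ Y),
      F.map (FreeGroupoid.homMk f) ≫ τ Y = τ X ≫ F'.map (FreeGroupoid.homMk f))
    {X Y : A} (m : FreeGroupoid.mk X ⟶ FreeGroupoid.mk Y) : F.map m ≫ τ Y = τ X ≫ F'.map m := by
  let _ : Groupoid G := Groupoid.ofIsGroupoid
  have h (X : A) : IsIso (τ X) := IsGroupoid.all_isIso _
  have := (FreeGroupoid.liftNatIso F F'
    (NatIso.ofComponents (fun X => asIso (τ X)) hτ)).hom.naturality m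
  rw [FreeGroupoid.liftNatIso_hom_app, FreeGroupoid.liftNatIso_hom_app] at this
  exact this

end FreeStack

/-! ### The tautological section; full faithfulness of composition with it. -/

section FreeStackSections

variable {C : Type u₁} [Category.{v₁} C] {B : Type u₂} [Category.{v₂} B] {p : B ⥤ C}

namespace freeStk

lemma naturality_of_ptMap {T : C} {G : Type u₃} [Category.{v₃} G] [IsGroupoid G]
    (F F' : (freeStk p).obj (.mk (op T)) ⥤ G)
    (τ : ∀ a : Arr p T, F.obj (pt a) ⟶ F'.obj (pt a))
    (hτ : ∀ {a b : Arr p T} (φ : a ⟶ b), F.map (ptMap φ) ≫ τ b = τ a ≫ F'.map (ptMap φ))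
    {a b : Arr p T} (m : pt a ⟶ pt b) : F.map m ≫ τ b = τ a ≫ F'.map m :=
  freeGroupoid_naturality F F' τ hτ m

variable (p) in
/-- The objects of the tautological section. -/
abbrev self (e : B) : Arr p (p.obj e) := ⟨e, 𝟙 _⟩

/-- The morphisms of the tautological section. -/
def genSelf {e e' : B} (u : e ⟶ e') : Tot.mk (pt (self p e)) ⟶ Tot.mk (pt (self p e')) :=
  gen (p.map u) u ((Category.id_comp _).trans (Category.comp_id _).symm)

variable (p) in
/-- The tautological section of the presheaf of groupoids freely generated by `p`. -/
def taut : Sec p (freeStk p) where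
  fib e := pt (self p e)
  map u := genSelf u
  map_base _ := rfl
  map_id e := (gen_congr _ (p.map_id e) rfl).trans (gen_id (self p e)
    ((congrArg (𝟙 _ ≫ ·) (p.map_id e)).trans rfl))
  map_comp {a b c} u u' := by
    refine (gen_congr _ (p.map_comp u u') rfl).trans (Eq.symm ?_)
    exact gen_comp (a := self p a) (b := self p b) (c := self p c) (p.map u) (p.map u') u u' _ _

/-- The morphism from an object to the object of the tautological section it comes from. -/
def toTaut {T : C} (a : Arr p T) : Tot.mk (pt a) ⟶ Tot.mk (pt (self p a.right)) :=
  gen a.hom (𝟙 a.right) (congrArg (a.hom ≫ ·) (p.map_id a.right))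

lemma gen_comp_toTaut {T T' : C} {a : Arr p T'} {b : Arr p T} (g : T' ⟶ T)
    (u : a.right ⟶ b.right) (w : a.hom ≫ p.map u = g ≫ b.hom) :
    gen g u w ≫ toTaut b = toTaut a ≫ genSelf u := by
  refine (gen_comp (c := self p b.right) g b.hom u (𝟙 b.right) _ _).trans (Eq.trans ?_
    (gen_comp (b := self p a.right) (c := self p b.right) a.hom (p.map u) (𝟙 a.right) u
      _ _).symm)
  exact gen_congr _ w.symm ((Category.comp_id u).trans (Category.id_comp u).symm)

end freeStk

namespace Sec

variable {𝒦 : PreStk.{v, u} C} {𝒢 : PreStk.{w, w'} C}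

/-- The composition of a section of `𝒦` with a section over the total category of `𝒦`. -/
def preSec (t : Sec p 𝒦) (𝒢 : PreStk.{w, w'} C) :
    Sec (Pseudofunctor.CoGrothendieck.forget 𝒦) 𝒢 ⥤ Sec p 𝒢 where
  obj y :=
    { fib e := y.fib (Tot.mk (t.fib e))
      map u := y.map (t.map u)
      map_base u := (y.map_base _).trans (t.map_base u)
      map_id e := (congrArg y.map (t.map_id e)).trans (y.map_id _)
      map_comp u u' := (congrArg y.map (t.map_comp u u')).trans (y.map_comp _ _) }
  map φ :=
    { app e := φ.app (Tot.mk (t.fib e))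
      app_base e := φ.app_base _
      naturality u := φ.naturality _ }

/-- Isomorphic sections have isomorphic compositions. -/
def preSecIso (h𝒢 : IsGroupoidValued 𝒢) {t t' : Sec p 𝒦} (ψ : t ⟶ t') :
    preSec t 𝒢 ≅ preSec t' 𝒢 :=
  NatIso.ofComponents (fun y => isoOfHom h𝒢
    { app e := y.map (ψ.app e)
      app_base e := (y.map_base _).trans (ψ.app_base e)
      naturality u := (y.map_comp _ _).symm.trans
        ((congrArg y.map (ψ.naturality u)).trans (y.map_comp _ _)) })
    (fun φ => hom_ext fun e => (φ.naturality (ψ.app e)).symm)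

end Sec

namespace freeStk

variable {𝒢 : PreStk.{w, w'} C}

section FullyFaithful

variable (h𝒢 : IsGroupoidValued 𝒢)
include h𝒢

/-- Every object of the free presheaf has the arrow `toTaut` to a value of the tautological section,
and sections send it to a cartesian arrow. -/
lemma faithful_preSec_taut : (Sec.preSec (taut p) 𝒢).Faithful where
  map_injective {y y'} φ ψ h := by
    have key {T : C} (a : Arr p T) : φ.app (Tot.mk (pt a)) = ψ.app (Tot.mk (pt a)) := by
      refine Tot.hom_ext_of_comp h𝒢 (y'.map (toTaut a))
        ((φ.app_base _).trans (ψ.app_base _).symm) ?_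
      rw [← φ.naturality, ← ψ.naturality]
      exact congrArg (y.map (toTaut a) ≫ ·) (congrArg (fun t => Sec.Hom.app t a.right) h)
    exact Sec.hom_ext fun e => key (arr e.fiber)

lemma full_preSec_taut : (Sec.preSec (taut p) 𝒢).Full where
  map_surjective {y y'} m := by
    let mm (e : B) : Tot.mk (y.val (pt (self p e))) ⟶ Tot.mk (y'.val (pt (self p e))) := m.app e
    have hα {T : C} (a : Arr p T) : ∃ α : Tot.mk (y.val (pt a)) ⟶ Tot.mk (y'.val (pt a)),
        α.base = 𝟙 T ∧ α ≫ y'.valMap (toTaut a) = y.valMap (toTaut a) ≫ mm a.right := by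
      refine Tot.exists_lift (a := Tot.mk (y.val (pt a))) h𝒢 (y'.valMap (toTaut a))
        (y.valMap (toTaut a) ≫ mm a.right) (𝟙 T) ?_
      refine (Category.id_comp _).trans ((y'.valMap_base _).trans (Eq.symm ?_))
      refine (congrArg₂ (· ≫ ·) (y.valMap_base (toTaut a)) (m.app_base _)).trans ?_
      exact Category.comp_id _
    choose α hα₀ hα₁ using @hα
    have hgen {T T' : C} {a : Arr p T'} {b : Arr p T} (g : T' ⟶ T)
        (u : a.right ⟶ b.right) (w : a.hom ≫ p.map u = g ≫ b.hom) :
        y.valMap (gen g u w) ≫ α b = α a ≫ y'.valMap (gen g u w) := by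
      refine Tot.hom_ext_of_comp h𝒢 (y'.valMap (toTaut b)) ?_ ?_
      · rw [Tot.comp_base, Tot.comp_base, y.valMap_base, y'.valMap_base, hα₀, hα₀]
        exact (Category.comp_id _).trans (Category.id_comp _).symm
      · rw [Category.assoc, Category.assoc, hα₁, ← y'.valMap_comp, gen_comp_toTaut, y'.valMap_comp,
          ← Category.assoc (α a), hα₁, ← Category.assoc (y.valMap _), ← y.valMap_comp,
          gen_comp_toTaut, y.valMap_comp, Category.assoc, Category.assoc]
        exact congrArg (y.valMap (toTaut a) ≫ ·) (m.naturality u)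
    -- Vertical arrows are words in generators and their inverses, so naturality on generators
    -- suffices; a general arrow is a vertical arrow followed by the generator `genCart`.
    have hvert {T : C} {a b : Arr p T} (β : pt a ⟶ pt b) :
        y.valMap (Tot.vert β) ≫ α b = α a ≫ y'.valMap (Tot.vert β) := by
      have := h𝒢 T
      let δ (a : Arr p T) : y.val (pt a) ⟶ y'.val (pt a) := Tot.down (α a) (hα₀ a)
      have hδ {a b : Arr p T} (β : pt a ⟶ pt b) :
          y.valMap (Tot.vert β) ≫ α b = α a ≫ y'.valMap (Tot.vert β) ↔
            y.fiberMap β ≫ δ b = δ a ≫ y'.fiberMap β := by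
        rw [← y.vert_fiberMap, ← y'.vert_fiberMap, ← Tot.vert_down (α b) (hα₀ b),
          ← Tot.vert_down (α a) (hα₀ a), ← Tot.vert_comp, ← Tot.vert_comp]
        exact ⟨fun h => Tot.vert_injective h, fun h => congrArg Tot.vert h⟩
      refine (hδ β).mpr (naturality_of_ptMap (y.fiberFunctor T) (y'.fiberFunctor T) δ
        (fun {a b} φ => (hδ (ptMap φ)).mp ?_) β)
      rw [vert_ptMap]
      exact hgen _ _ _
    have hcart {T T' : C} (g : T' ⟶ T) (b : Arr p T) :
        y.valMap (genCart g b) ≫ α b = α (b.pull g) ≫ y'.valMap (genCart g b) := hgen _ _ _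
    have hnat {T T' : C} {a : Arr p T'} {b : Arr p T} (n : Tot.mk (pt a) ⟶ Tot.mk (pt b)) :
        y.valMap n ≫ α b = α a ≫ y'.valMap n := by
      rw [← vert_fiberHom_comp_genCart n, y.valMap_comp, y'.valMap_comp, Category.assoc, hcart,
        ← Category.assoc, hvert, Category.assoc]
    refine ⟨{ app := fun e => α (arr e.fiber), app_base := fun e => hα₀ (arr e.fiber),
              naturality := fun {e e'} n => hnat (a := arr e.fiber) (b := arr e'.fiber) n },
            Sec.hom_ext fun e => ?_⟩
    refine (Category.comp_id _).symm.trans ?_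
    have h : toTaut (Arr.mk e (𝟙 (p.obj e))) = 𝟙 _ := gen_id _ _
    have h' := hα₁ (Arr.mk e (𝟙 (p.obj e)))
    rw [h] at h'
    refine ((congrArg (α _ ≫ ·) (y'.valMap_id _)).symm.trans h').trans ?_
    refine (congrArg (· ≫ mm e) (y.valMap_id _)).trans ?_
    exact Category.id_comp _

end FullyFaithful

end freeStk

end FreeStackSections

/-! ### Extension of a section of `p` to the free presheaf. -/

section Extension

variable {C : Type u₁} [Category.{v₁} C] {B : Type u₂} [Category.{v₂} B] {p : B ⥤ C}
  {𝒢 : PreStk.{w, w'} C}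

namespace Sec

variable (s : Sec p 𝒢)

/-- The pullback of the value of a section. -/
def arrObj {T : C} (a : Arr p T) : 𝒢.obj (.mk (op T)) := pull 𝒢 a.hom (s.fib a.right)

/-- The canonical morphism to the value of a section. -/
def arrCart {T : C} (a : Arr p T) : Tot.mk (s.arrObj a) ⟶ Tot.mk (s.fib a.right) :=
  Tot.cart a.hom (s.fib a.right)

/-- The action on morphisms of the pullback of the values of a section. -/
def arrMap {T : C} {a b : Arr p T} (φ : a ⟶ b) : s.arrObj a ⟶ s.arrObj b :=
  Tot.fiberOver (b := Tot.mk (s.fib b.right)) (s.arrCart a ≫ s.map φ.right) b.hom (by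
    rw [Tot.comp_base, s.map_base]
    exact φ.w)

lemma vert_arrMap_comp_arrCart {T : C} {a b : Arr p T} (φ : a ⟶ b) :
    Tot.vert (s.arrMap φ) ≫ s.arrCart b = s.arrCart a ≫ s.map φ.right :=
  Tot.vert_fiberOver_comp_cart _ _ _

lemma eq_of_vert_comp_arrCart {T : C} {x : 𝒢.obj (.mk (op T))} {b : Arr p T}
    {φ ψ : x ⟶ s.arrObj b} (h : Tot.vert φ ≫ s.arrCart b = Tot.vert ψ ≫ s.arrCart b) : φ = ψ :=
  Tot.eq_of_vert_comp_cart h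

/-- The pullbacks of the values of a section, as a functor. -/
def arrFunctor (T : C) : Arr p T ⥤ 𝒢.obj (.mk (op T)) where
  obj a := s.arrObj a
  map φ := s.arrMap φ
  map_id a := by
    apply s.eq_of_vert_comp_arrCart
    rw [vert_arrMap_comp_arrCart, Arr.id_right, s.map_id, Category.comp_id, Tot.vert_id,
      Category.id_comp]
  map_comp φ ψ := by
    apply s.eq_of_vert_comp_arrCart
    rw [vert_arrMap_comp_arrCart, Arr.comp_right, s.map_comp, Tot.vert_comp, Category.assoc,
      vert_arrMap_comp_arrCart, ← Category.assoc, ← Category.assoc, vert_arrMap_comp_arrCart]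

/-- The pullback of the pullback of the value of a section. -/
def arrPull {T T' : C} (g : T' ⟶ T) (b : Arr p T) : s.arrObj (b.pull g) ⟶ pull 𝒢 g (s.arrObj b) :=
  (Tot.pullComp b.hom g (g ≫ b.hom) rfl (s.fib b.right)).inv

/-- The canonical morphism between pullbacks of the value of a section. -/
def arrPullHom {T T' : C} (g : T' ⟶ T) (b : Arr p T) :
    Tot.mk (s.arrObj (b.pull g)) ⟶ Tot.mk (s.arrObj b) :=
  Tot.vert (s.arrPull g b) ≫ Tot.cart g (s.arrObj b)

@[simp] lemma arrPullHom_base {T T' : C} (g : T' ⟶ T) (b : Arr p T) :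
    (s.arrPullHom g b).base = g := Category.id_comp g

lemma arrPullHom_comp_arrCart {T T' : C} (g : T' ⟶ T) (b : Arr p T) :
    s.arrPullHom g b ≫ s.arrCart b = s.arrCart (b.pull g) := by
  rw [arrPullHom, Category.assoc]
  exact Tot.vert_pullComp_inv_comp_cart b.hom g (g ≫ b.hom) rfl (s.fib b.right)

variable (h𝒢 : IsGroupoidValued 𝒢)

/-- The extension of a section to the free groupoids. -/
def extFunctor (T : C) : (freeStk p).obj (.mk (op T)) ⥤ 𝒢.obj (.mk (op T)) :=
  have := h𝒢 T
  let _ : Groupoid (𝒢.obj (.mk (op T))) := Groupoid.ofIsGroupoid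
  FreeGroupoid.lift (s.arrFunctor T)

/-- The action of the extension of a section on the morphisms of the free groupoids. -/
def extFiberMap {T : C} {a b : Arr p T} (β : freeStk.pt a ⟶ freeStk.pt b) :
    s.arrObj a ⟶ s.arrObj b := (s.extFunctor h𝒢 T).map β

lemma extFiberMap_ptMap {T : C} {a b : Arr p T} (φ : a ⟶ b) :
    s.extFiberMap h𝒢 (freeStk.ptMap φ) = s.arrMap φ :=
  have := h𝒢 T
  let _ : Groupoid (𝒢.obj (.mk (op T))) := Groupoid.ofIsGroupoid
  FreeGroupoid.lift_map_homMk (s.arrFunctor T) φ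

lemma extFiberMap_comp {T : C} {a b c : Arr p T} (β : freeStk.pt a ⟶ freeStk.pt b)
    (γ : freeStk.pt b ⟶ freeStk.pt c) :
    s.extFiberMap h𝒢 (β ≫ γ) = s.extFiberMap h𝒢 β ≫ s.extFiberMap h𝒢 γ :=
  (s.extFunctor h𝒢 T).map_comp β γ

end Sec

namespace freeStk

/-- The pullback of morphisms of the free groupoids. -/
def pullMap {T T' : C} (g : T' ⟶ T) {a b : Arr p T} (β : pt a ⟶ pt b) :
    pt (a.pull g) ⟶ pt (b.pull g) := ((freeStk p).map g.op.toLoc).toFunctor.map β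

lemma fiberHom_comp {T T' T'' : C} {a : Arr p T''} {b : Arr p T'} {c : Arr p T}
    (m : Tot.mk (pt a) ⟶ Tot.mk (pt b)) (m' : Tot.mk (pt b) ⟶ Tot.mk (pt c)) :
    fiberHom (m ≫ m') = fiberHom m ≫ pullMap m.base (fiberHom m') ≫
      ptMap (Arr.pullPull m'.base m.base c) := by
  refine congrArg (fun t => fiberHom m ≫ pullMap m.base (fiberHom m') ≫ t) ?_
  exact mapComp_inv_app m'.base m.base c

end freeStk

namespace Sec

open freeStk

variable (s : Sec p 𝒢) (h𝒢 : IsGroupoidValued 𝒢)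

include h𝒢 in
lemma arrMap_comp_arrPull {T T' : C} (g : T' ⟶ T) {a b : Arr p T} (φ : a ⟶ b) :
    s.arrMap (Arr.pullMap g φ) ≫ s.arrPull g b =
      s.arrPull g a ≫ (𝒢.map g.op.toLoc).toFunctor.map (s.arrMap φ) := by
  apply Tot.eq_of_vert_comp_cart
  refine Tot.hom_ext_of_comp h𝒢 (s.arrCart b) rfl ?_
  have h : (Tot.vert (s.arrMap (Arr.pullMap g φ)) ≫ s.arrPullHom g b) ≫ s.arrCart b =
      (s.arrPullHom g a ≫ Tot.vert (s.arrMap φ)) ≫ s.arrCart b := by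
    rw [Category.assoc, Category.assoc, vert_arrMap_comp_arrCart, arrPullHom_comp_arrCart,
      vert_arrMap_comp_arrCart, ← Category.assoc, arrPullHom_comp_arrCart]
    rfl
  rw [arrPullHom, arrPullHom, Category.assoc (Tot.vert (s.arrPull g a)),
    ← Tot.vert_map_comp_cart] at h
  rw [Tot.vert_comp, Tot.vert_comp, Category.assoc (Tot.vert (s.arrPull g a)),
    Category.assoc (Tot.vert (s.arrMap (Arr.pullMap g φ)))]
  exact h

/-- Compatibility with base change is known for generators by `arrMap_comp_arrPull` and spreads to
the free groupoid. -/
lemma extFiberMap_pullMap_comp_arrPull {T T' : C} (g : T' ⟶ T) {a b : Arr p T} (β : pt a ⟶ pt b) :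
    s.extFiberMap h𝒢 (pullMap g β) ≫ s.arrPull g b =
      s.arrPull g a ≫ (𝒢.map g.op.toLoc).toFunctor.map (s.extFiberMap h𝒢 β) := by
  have := h𝒢 T'
  refine naturality_of_ptMap
    (((freeStk p).map g.op.toLoc).toFunctor ⋙ s.extFunctor h𝒢 T')
    (s.extFunctor h𝒢 T ⋙ (𝒢.map g.op.toLoc).toFunctor)
    (fun a => s.arrPull g a) (fun {a b} φ => ?_) β
  refine (congrArg (· ≫ s.arrPull g b) (s.extFiberMap_ptMap h𝒢
    (Arr.pullMap g φ))).trans ?_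
  refine (s.arrMap_comp_arrPull h𝒢 g φ).trans ?_
  exact congrArg (fun t => s.arrPull g a ≫ (𝒢.map g.op.toLoc).toFunctor.map t)
    (s.extFiberMap_ptMap h𝒢 φ).symm

lemma vert_extFiberMap_comp_arrPullHom {T T' : C} (g : T' ⟶ T) {a b : Arr p T} (β : pt a ⟶ pt b) :
    Tot.vert (s.extFiberMap h𝒢 (pullMap g β)) ≫ s.arrPullHom g b =
      s.arrPullHom g a ≫ Tot.vert (s.extFiberMap h𝒢 β) := by
  rw [arrPullHom, arrPullHom, ← Category.assoc, ← Tot.vert_comp,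
    extFiberMap_pullMap_comp_arrPull, Tot.vert_comp, Category.assoc, Category.assoc,
    Tot.vert_map_comp_cart]

/-- The action of the extension of a section on morphisms. -/
def extMap {T T' : C} {a : Arr p T'} {b : Arr p T} (m : Tot.mk (pt a) ⟶ Tot.mk (pt b)) :
    Tot.mk (s.arrObj a) ⟶ Tot.mk (s.arrObj b) :=
  Tot.vert (s.extFiberMap h𝒢 (fiberHom m)) ≫ s.arrPullHom m.base b

lemma extMap_base {T T' : C} {a : Arr p T'} {b : Arr p T} (m : Tot.mk (pt a) ⟶ Tot.mk (pt b)) :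
    (s.extMap h𝒢 m).base = m.base := by
  rw [extMap, Tot.comp_base, arrPullHom_base]
  exact Category.id_comp _

lemma extMap_gen {T T' : C} {a : Arr p T'} {b : Arr p T} (g : T' ⟶ T) (u : a.right ⟶ b.right)
    (h : a.hom ≫ p.map u = g ≫ b.hom) :
    s.extMap h𝒢 (gen g u h) ≫ s.arrCart b = s.arrCart a ≫ s.map u := by
  have h₁ : s.extMap h𝒢 (gen g u h) = Tot.vert (s.arrMap (b := b.pull g) ⟨u, h⟩) ≫
      s.arrPullHom g b :=
    congrArg (fun t => Tot.vert t ≫ s.arrPullHom g b) (s.extFiberMap_ptMap h𝒢 (b := b.pull g) ⟨u, h⟩)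
  rw [h₁, Category.assoc, arrPullHom_comp_arrCart]
  exact s.vert_arrMap_comp_arrCart (b := b.pull g) ⟨u, h⟩

lemma extMap_id {T : C} (a : Arr p T) : s.extMap h𝒢 (𝟙 (Tot.mk (pt a))) = 𝟙 _ := by
  refine Tot.hom_ext_of_comp h𝒢 (s.arrCart a) (s.extMap_base h𝒢 _) ?_
  rw [← gen_id a ((congrArg (a.hom ≫ ·) (p.map_id a.right)).trans
    ((Category.comp_id _).trans (Category.id_comp _).symm)), extMap_gen, s.map_id,
    Category.id_comp, Category.comp_id]

lemma extMap_comp {T T' T'' : C} {a : Arr p T''} {b : Arr p T'} {c : Arr p T}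
    (m : Tot.mk (pt a) ⟶ Tot.mk (pt b)) (m' : Tot.mk (pt b) ⟶ Tot.mk (pt c)) :
    s.extMap h𝒢 (m ≫ m') = s.extMap h𝒢 m ≫ s.extMap h𝒢 m' := by
  -- Coherence of iterated pullbacks: composed with the cartesian arrow to the value of `s`, both
  -- sides are the canonical arrow.
  have h : Tot.vert (s.arrMap (Arr.pullPull m'.base m.base c)) ≫
      s.arrPullHom (m.base ≫ m'.base) c =
      s.arrPullHom m.base (c.pull m'.base) ≫ s.arrPullHom m'.base c := by
    refine Tot.hom_ext_of_comp h𝒢 (s.arrCart c) ?_ ?_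
    · rw [Tot.comp_base, Tot.comp_base, arrPullHom_base, arrPullHom_base, arrPullHom_base]
      exact Category.id_comp _
    · rw [Category.assoc, Category.assoc, arrPullHom_comp_arrCart, arrPullHom_comp_arrCart,
        arrPullHom_comp_arrCart, vert_arrMap_comp_arrCart]
      exact (congrArg (_ ≫ ·) (s.map_id c.right)).trans (Category.comp_id _)
  refine (congrArg (fun t => Tot.vert (s.extFiberMap h𝒢 t) ≫ s.arrPullHom (m.base ≫ m'.base) c)
    (fiberHom_comp m m')).trans ?_
  rw [extFiberMap_comp, extFiberMap_comp, extFiberMap_ptMap, Tot.vert_comp, Tot.vert_comp,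
    Category.assoc, Category.assoc, h, ← Category.assoc (Tot.vert
      (s.extFiberMap h𝒢 (pullMap m.base (fiberHom m')))), vert_extFiberMap_comp_arrPullHom, extMap,
    extMap, Category.assoc, Category.assoc]

/-- The extension of a section to the presheaf of groupoids freely generated by `p`. -/
def ext : Sec (Pseudofunctor.CoGrothendieck.forget (freeStk p)) 𝒢 where
  fib e := s.arrObj (arr e.fiber)
  map {e e'} m := s.extMap h𝒢 (a := arr e.fiber) (b := arr e'.fiber) m
  map_base {e e'} m := s.extMap_base h𝒢 (a := arr e.fiber) (b := arr e'.fiber) m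
  map_id e := s.extMap_id h𝒢 (arr e.fiber)
  map_comp {e e' e''} m m' := s.extMap_comp h𝒢 (a := arr e.fiber) (b := arr e'.fiber)
    (c := arr e''.fiber) m m'

/-- The extension of a section restricts to the section. -/
def extIso : (preSec (taut p) 𝒢).obj (s.ext h𝒢) ≅ s :=
  isoOfHom h𝒢
    { app e := s.arrCart (self p e)
      app_base _ := rfl
      naturality u := s.extMap_gen h𝒢 (a := self p _) (b := self p _) (p.map u) u
        ((Category.id_comp _).trans (Category.comp_id _).symm) }

end Sec

/-- The presheaf of groupoids freely generated by `p` represents sections over `p`. -/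
theorem freeStk.isEquivalence_preSec_taut (h𝒢 : IsGroupoidValued 𝒢) :
    (Sec.preSec (freeStk.taut p) 𝒢).IsEquivalence where
  faithful := freeStk.faithful_preSec_taut h𝒢
  full := freeStk.full_preSec_taut h𝒢
  essSurj := ⟨fun s => ⟨s.ext h𝒢, ⟨s.extIso h𝒢⟩⟩⟩

end Extension

/-! ### Left Kan extensions and their stackification. -/

section KanExtension

lemma leftUnitor_inv_whiskerRight_associator_naturality {A : Type u₁} [Bicategory.{v₁, w} A]
    {a b c : A} (f : a ⟶ b) (g : b ⟶ a) (e : 𝟙 a ⟶ f ≫ g) {h h' : a ⟶ c} (G : h ⟶ h') :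
    G ≫ (λ_ h').inv ≫ e ▷ h' ≫ (α_ f g h').hom =
      ((λ_ h).inv ≫ e ▷ h ≫ (α_ f g h).hom) ≫ f ◁ g ◁ G := by
  simp only [Bicategory.leftUnitor_inv_naturality_assoc, Category.assoc,
    Bicategory.whisker_exchange_assoc, Bicategory.comp_whiskerLeft, Iso.inv_hom_id,
    Category.comp_id]

/-- Restriction along `ι` and precomposition correspond to the composition of sections. -/
def restrictMorPrecompCompToSec {C : Type u₁} [Category.{v₁} C] {D : Type u₂} [Category.{v₂} D]
    (ι : D ⥤ C) {𝓕 : PreStk.{w, w'} D} {𝒦 : PreStk.{w, w'} C} (η : 𝓕 ⟶ restrict ι 𝒦)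
    (𝒢 : PreStk.{w, w'} C) :
    (restrictMor ι 𝒦 𝒢 ⋙ Bicategory.precomp (restrict ι 𝒢) η) ⋙ toSec 𝓕 (restrict ι 𝒢) ⋙
        secRestrict (Pseudofunctor.CoGrothendieck.forget 𝓕) ι 𝒢 ≅
      toSec 𝒦 𝒢 ⋙ Sec.preSec ((secRestrict (Pseudofunctor.CoGrothendieck.forget 𝓕) ι 𝒦).obj
        ((toSec 𝓕 (restrict ι 𝒦)).obj η)) 𝒢 := by
  have h (θ : 𝒦 ⟶ 𝒢) {a b : Tot 𝓕} (u : a ⟶ b) :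
      totMap (η ≫ (restrictMor ι 𝒦 𝒢).obj θ) u =
        totMap ((restrictMor ι 𝒦 𝒢).obj θ) (totMap η u) :=
    (Category.comp_id _).symm.trans (((Pseudofunctor.CoGrothendieck.mapCompIso η
      ((restrictMor ι 𝒦 𝒢).obj θ)).hom.naturality u).trans (Category.id_comp _))
  refine NatIso.ofComponents (fun θ =>
    { hom :=
        { app := fun _ => 𝟙 _
          app_base := fun _ => rfl
          naturality := fun u => (Category.comp_id _).trans
            ((congrArg (totRestrictHom (ι := ι)) (h θ u)).trans (Category.id_comp _).symm) }
      inv :=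
        { app := fun _ => 𝟙 _
          app_base := fun _ => rfl
          naturality := fun u => (Category.comp_id _).trans
            ((congrArg (totRestrictHom (ι := ι)) (h θ u)).symm.trans (Category.id_comp _).symm) }
      hom_inv_id := Sec.hom_ext fun _ => Category.comp_id _
      inv_hom_id := Sec.hom_ext fun _ => Category.comp_id _ }) (fun {θ θ'} Γ =>
    Sec.hom_ext fun e => (Category.comp_id _).trans
      (Eq.trans ?_ (Category.id_comp _).symm))
  exact totRestrictHom_vert (ι := ι) (S := e.base)
      ((Γ.as.app (.mk (op (ι.obj e.base)))).toNatTrans.app (appObj η e.fiber))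

variable {C : Type (u + 1)} [Category.{u} C] {D : Type (u + 1)} [Category.{u} D]

/-- Left Kan extensions of presheaves of groupoids exist. -/
theorem exists_isLeftKanExtension (ι : D ⥤ C)
    (𝓕 : PreStk.{max w (u + 1), max w (u + 1)} D) :
    ∃ (𝒦 : PreStk.{max w (u + 1), max w (u + 1)} C) (η : 𝓕 ⟶ restrict ι 𝒦),
      IsLeftKanExtension ι η := by
  let p : Tot 𝓕 ⥤ C := Pseudofunctor.CoGrothendieck.forget 𝓕 ⋙ ι
  -- The objects and arrows of the total category of `𝓕` fit into the universe `max w (u + 1)`, so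
  -- the free groupoids do too.
  let 𝒦 : PreStk.{max w (u + 1), max w (u + 1)} C := freeStk p
  have h𝒦 : IsGroupoidValued 𝒦 := freeStk.isGroupoidValued p
  have h𝒦' : IsGroupoidValued (restrict ι 𝒦) := fun S => h𝒦 (ι.obj S)
  have h₁ := isEquivalence_toSec (𝓕 := 𝓕) h𝒦'
  have h₂ := isEquivalence_secRestrict (Pseudofunctor.CoGrothendieck.forget 𝓕) ι h𝒦
  have h₃ : (toSec 𝓕 (restrict ι 𝒦) ⋙
    secRestrict (Pseudofunctor.CoGrothendieck.forget 𝓕) ι 𝒦).EssSurj := inferInstance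
  -- The unit is the morphism that corresponds to the tautological section.
  obtain ⟨η, ⟨e⟩⟩ := h₃.mem_essImage (freeStk.taut p)
  refine ⟨𝒦, η, h𝒦, fun 𝒢 h𝒢 => ?_⟩
  have h𝒢' : IsGroupoidValued (restrict ι 𝒢) := fun S => h𝒢 (ι.obj S)
  have h₄ := isEquivalence_toSec (𝓕 := 𝒦) h𝒢
  have h₅ := isEquivalence_toSec (𝓕 := 𝓕) h𝒢'
  have h₆ := isEquivalence_secRestrict (Pseudofunctor.CoGrothendieck.forget 𝓕) ι h𝒢
  have h₇ := freeStk.isEquivalence_preSec_taut (p := p) h𝒢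
  have h₈ := @Functor.isEquivalence_of_iso _ _ _ _ _ _ (Sec.preSecIso h𝒢 e.inv) h₇
  have h₉ : (toSec 𝒦 𝒢 ⋙ Sec.preSec ((secRestrict (Pseudofunctor.CoGrothendieck.forget 𝓕) ι 𝒦).obj
        ((toSec 𝓕 (restrict ι 𝒦)).obj η)) 𝒢).IsEquivalence :=
    @Functor.isEquivalence_trans _ _ _ _ _ _ _ _ h₄ h₈
  have h := @Functor.isEquivalence_of_iso _ _ _ _ _ _ (restrictMorPrecompCompToSec ι η 𝒢).symm h₉
  exact Functor.isEquivalence_of_comp_right _ (toSec 𝓕 (restrict ι 𝒢) ⋙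
    secRestrict (Pseudofunctor.CoGrothendieck.forget 𝓕) ι 𝒢)

/-- A stack `𝒳` such that restricting morphisms from `𝒳` to stacks is an equivalence is a sheafified
left Kan extension of its restriction. -/
theorem isSheafifiedLeftKanExtension_id (J : GrothendieckTopology C) (ι : D ⥤ C)
    {𝒳 : PreStk.{max w (u + 1), max w (u + 1)} C} (h𝒳 : IsGroupoidStack J 𝒳)
    (h : ∀ 𝒴 : PreStk.{max w (u + 1), max w (u + 1)} C, IsGroupoidStack J 𝒴 →
      (restrictMor ι 𝒳 𝒴).IsEquivalence) :
    IsSheafifiedLeftKanExtension J ι (𝟙 (restrict ι 𝒳)) := by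
  obtain ⟨𝒦, η, hη⟩ := exists_isLeftKanExtension.{w} ι (restrict ι 𝒳)
  have h₁ := hη.isEquivalence 𝒳 h𝒳.isGroupoidValued
  -- The comparison `θ` is the adjoint of the identity, so `e` is the required compatibility of
  -- units.
  obtain ⟨θ, ⟨e⟩⟩ := h₁.essSurj.mem_essImage (𝟙 (restrict ι 𝒳))
  refine ⟨𝒦, η, θ, hη, ⟨h𝒳, fun 𝒴 h𝒴 => ?_⟩, ⟨e⟩⟩
  have h₂ := hη.isEquivalence 𝒴 h𝒴.isGroupoidValued
  -- Composition with `θ`, followed by the equivalence of the Kan extension, is restriction to `D`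
  -- up to `e`; two-out-of-three concludes.
  let i : restrictMor ι 𝒳 𝒴 ≅ Bicategory.precomp 𝒴 θ ⋙
      restrictMor ι 𝒦 𝒴 ⋙ Bicategory.precomp (restrict ι 𝒴) η := by
    refine NatIso.ofComponents (fun ψ => (λ_ ((restrictMor ι 𝒳 𝒴).obj ψ)).symm ≪≫
      Bicategory.whiskerRightIso e.symm _ ≪≫ α_ _ _ _) ?_
    intro ψ ψ' Γ
    exact leftUnitor_inv_whiskerRight_associator_naturality η ((restrictMor ι 𝒦 𝒳).obj θ) e.inv
      ((restrictMor ι 𝒳 𝒴).map Γ)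
  have h₃ := @Functor.isEquivalence_of_iso _ _ _ _ _ _ i (h 𝒴 h𝒴)
  exact Functor.isEquivalence_of_comp_right _ (restrictMor ι 𝒦 𝒴 ⋙
    Bicategory.precomp (restrict ι 𝒴) η)

end KanExtension

/-! ### Smooth atlases of algebraic stacks are atlases in the abstract sense. -/

section SmoothAtlases

variable {C : Type u₁} [Category.{v₁} C] {𝒳 : PreStk.{w, w'} C}

namespace Tot

section Over

variable {S : C} {M N : 𝒳.obj (.mk (op S))}

variable (M) in
/-- The canonical morphism between pullbacks to objects over `S`. -/
def overMap {Z Z' : Over S} (l : Z' ⟶ Z) : mk (pull 𝒳 Z'.hom M) ⟶ mk (pull 𝒳 Z.hom M) :=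
  vert (pullComp Z.hom l.left Z'.hom (Over.w l) M).inv ≫ cart l.left (pull 𝒳 Z.hom M)

@[simp] lemma overMap_base {Z Z' : Over S} (l : Z' ⟶ Z) : (overMap M l).base = l.left :=
  Category.id_comp l.left

lemma overMap_comp_cart {Z Z' : Over S} (l : Z' ⟶ Z) :
    overMap M l ≫ cart Z.hom M = cart Z'.hom M := by
  rw [overMap, Category.assoc]
  exact vert_pullComp_inv_comp_cart Z.hom l.left Z'.hom (Over.w l) M

/-- A section of the presheaf of morphisms from `M` to `N`, seen in the total category. -/
def ofHomSection {Z : Over S} (β : (𝒳.presheafHom M N).obj (op Z)) :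
    mk (pull 𝒳 Z.hom M) ⟶ mk N :=
  vert (show pull 𝒳 Z.hom M ⟶ pull 𝒳 Z.hom N from β) ≫ cart Z.hom N

@[simp] lemma ofHomSection_base {Z : Over S} (β : (𝒳.presheafHom M N).obj (op Z)) :
    (ofHomSection β).base = Z.hom :=
  Category.id_comp Z.hom

lemma ofHomSection_injective {Z : Over S} {β β' : (𝒳.presheafHom M N).obj (op Z)}
    (h : ofHomSection β = ofHomSection β') : β = β' :=
  eq_of_vert_comp_cart h

lemma exists_ofHomSection_eq {Z : Over S} (n : mk (pull 𝒳 Z.hom M) ⟶ mk N) (hn : n.base = Z.hom) :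
    ∃ β : (𝒳.presheafHom M N).obj (op Z), ofHomSection β = n :=
  ⟨fiberOver n Z.hom hn, vert_fiberOver_comp_cart n Z.hom hn⟩

/-- Translates restriction in the sheaf of morphisms into composition in the total category. -/
lemma ofHomSection_map {Z Z' : Over S} (l : Z' ⟶ Z) (β : (𝒳.presheafHom M N).obj (op Z)) :
    ofHomSection ((𝒳.presheafHom M N).map l.op β) = overMap M l ≫ ofHomSection β := by
  have h : ((𝒳.presheafHom M N).map l.op β : pull 𝒳 Z'.hom M ⟶ pull 𝒳 Z'.hom N) =
      (pullComp Z.hom l.left Z'.hom (Over.w l) M).inv ≫ (𝒳.map l.left.op.toLoc).toFunctor.map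
        (show pull 𝒳 Z.hom M ⟶ pull 𝒳 Z.hom N from β) ≫
          (pullComp Z.hom l.left Z'.hom (Over.w l) N).hom := rfl
  rw [ofHomSection, h, vert_comp, vert_comp, Category.assoc, Category.assoc,
    vert_pullComp_hom_comp_cart, vert_map_comp_cart_assoc, overMap, ofHomSection, Category.assoc]

end Over

end Tot

section Refinement

open Tot

variable (U : C ⥤ Scheme.{u}) [HasBinaryProducts C] {V T : C} {v : 𝒳.obj (.mk (op V))}
  {t : 𝒳.obj (.mk (op T))}

/-- The fiber product of a morphism to `V × T` and the chart given by an étale atlas of the sheaf of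
isomorphisms. -/
lemma exists_refinement (h𝒳 : IsGroupoidValued 𝒳) {W : Over (V ⨯ T)}
    (α : (𝒳.presheafHom (pull 𝒳 prod.fst v) (pull 𝒳 prod.snd t)).obj (op W))
    (hα : IsEtaleAtlas (Over.forget (V ⨯ T) ⋙ U)
      (𝒳.presheafHom (pull 𝒳 prod.fst v) (pull 𝒳 prod.snd t)) α)
    {p : mk (pull 𝒳 W.hom (pull 𝒳 prod.fst v)) ⟶ mk t}
    (hp : p = ofHomSection α ≫ cart prod.snd t)
    {q : mk (pull 𝒳 W.hom (pull 𝒳 prod.fst v)) ⟶ mk v}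
    (hq : q = cart W.hom (pull 𝒳 prod.fst v) ≫ cart prod.fst v)
    {z : Tot 𝒳} (f : z ⟶ mk t) (g : z ⟶ mk v) :
    ∃ (z' : Tot 𝒳) (s : z' ⟶ z) (h : z' ⟶ mk (pull 𝒳 W.hom (pull 𝒳 prod.fst v))),
      Etale (U.map s.base) ∧ Surjective (U.map s.base) ∧ s ≫ f = h ≫ p ∧ s ≫ g = h ≫ q ∧
      ∀ (y : Tot 𝒳) (k : y ⟶ z) (l : y ⟶ mk (pull 𝒳 W.hom (pull 𝒳 prod.fst v))),
        k ≫ f = l ≫ p → k ≫ g = l ≫ q → ∃ m : y ⟶ z', m ≫ s = k ∧ m ≫ h = l := by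
  let M : 𝒳.obj (.mk (op (V ⨯ T))) := pull 𝒳 prod.fst v
  let Z : Over (V ⨯ T) := Over.mk (prod.lift g.base f.base)
  let c (Y : Over (V ⨯ T)) : mk (pull 𝒳 Y.hom M) ⟶ mk v := cart Y.hom M ≫ cart prod.fst v
  have hc {Y Y' : Over (V ⨯ T)} (l : Y' ⟶ Y) : overMap M l ≫ c Y = c Y' := by
    rw [← Category.assoc, overMap_comp_cart]
  have hZg : Z.hom ≫ prod.fst = g.base := prod.lift_fst _ _
  have hZf : Z.hom ≫ prod.snd = f.base := prod.lift_snd _ _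
  have hpb : p.base = W.hom ≫ prod.snd := by
    rw [hp, comp_base, ofHomSection_base]; rfl
  have hqb : q.base = W.hom ≫ prod.fst := by rw [hq]; rfl
  -- Through `g`, the object `z` is identified with the pullback of `v` along `Z`; then `f` becomes
  -- a section `β` of the sheaf of morphisms over `Z`.
  obtain ⟨δ, hδ, hδ'⟩ := exists_lift h𝒳 (a := mk (pull 𝒳 Z.hom M)) g (c Z) (𝟙 _)
    ((Category.id_comp _).trans hZg.symm)
  obtain ⟨γ, hγ, hγ'⟩ := exists_lift h𝒳 (b := mk (pull 𝒳 Z.hom M)) (c Z) g (𝟙 _)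
    ((Category.id_comp _).trans hZg)
  have hγδ : γ ≫ δ = 𝟙 _ := by
    refine hom_ext_of_comp h𝒳 g ?_ ?_
    · rw [comp_base, hγ, hδ]; exact Category.id_comp _
    · rw [Category.assoc, hδ', hγ', Category.id_comp]
  obtain ⟨n, hn, hn'⟩ := exists_lift h𝒳 (cart prod.snd t) (δ ≫ f) Z.hom (by
    rw [comp_base, hδ]
    exact hZf.trans (Category.id_comp _).symm)
  obtain ⟨β, hβ⟩ := exists_ofHomSection_eq n hn
  obtain ⟨Z₁, a, b, hab, hb, hb'⟩ := hα Z β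
  -- `Z₁` is the fiber product of `Z` with the étale atlas `W`, hence étale and surjective over `Z`;
  -- its pullback of `v` is the refinement.
  have hsb : (overMap M b ≫ δ).base = b.left := by
    rw [comp_base, overMap_base, hδ]; exact Category.comp_id _
  refine ⟨mk (pull 𝒳 Z₁.hom M), overMap M b ≫ δ, overMap M a, ?_, ?_, ?_, ?_, ?_⟩
  · rw [hsb]; exact hb
  · rw [hsb]; exact hb'
  · rw [Category.assoc, ← hn', ← hβ, ← Category.assoc, ← ofHomSection_map, ← hab.comm,
      ofHomSection_map, Category.assoc, hp]
  · rw [Category.assoc, hδ', hc, hq]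
    exact (hc a).symm
  intro y k l hf hg
  have hkl : k.base ≫ Z.hom = l.base ≫ W.hom := by
    apply prod.hom_ext
    · rw [Category.assoc, Category.assoc, hZg, ← hqb]
      exact congrArg (fun t => t.base) hg
    · rw [Category.assoc, Category.assoc, hZf, ← hpb]
      exact congrArg (fun t => t.base) hf
  let Z₂ : Over (V ⨯ T) := Over.mk (k.base ≫ Z.hom)
  let a' : Z₂ ⟶ W := Over.homMk l.base hkl.symm
  let b' : Z₂ ⟶ Z := Over.homMk k.base rfl
  obtain ⟨e, he, he'⟩ := exists_lift h𝒳 (a := mk (pull 𝒳 Z₂.hom M)) (k ≫ g) (c Z₂) (𝟙 _) (by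
    refine (Category.id_comp _).trans ?_
    exact (congrArg (k.base ≫ ·) hZg.symm).trans (Category.assoc _ _ _).symm)
  have hb₂ : overMap M b' = e ≫ k ≫ γ := by
    refine hom_ext_of_comp h𝒳 (c Z) ?_ ?_
    · rw [comp_base, comp_base, he, hγ, overMap_base]
      exact ((Category.id_comp _).trans (Category.comp_id _)).symm
    · rw [Category.assoc, Category.assoc, hγ', he', hc]
  have ha₂ : overMap M a' = e ≫ l := by
    refine hom_ext_of_comp h𝒳 q ?_ ?_
    · rw [comp_base, he, overMap_base]
      exact (Category.id_comp _).symm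
    · rw [Category.assoc, ← hg, he', hq]
      exact hc a'
  -- The universal property of `Z₁` gives the arrow between bases, which then lifts because arrows
  -- of the total category are cartesian.
  obtain ⟨L, ⟨hLa, hLb⟩, -⟩ := hab.existsUnique Z₂ a' b' (by
    apply ofHomSection_injective
    refine hom_ext_of_comp h𝒳 (cart prod.snd t) ?_ ?_
    · rw [ofHomSection_base, ofHomSection_base]
    · rw [ofHomSection_map, ofHomSection_map, Category.assoc, ← hp, Category.assoc, hβ, hn']
      refine (congrArg (· ≫ p) ha₂).trans (Eq.trans ?_ (congrArg (· ≫ δ ≫ f) hb₂).symm)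
      rw [Category.assoc, ← hf, Category.assoc, Category.assoc, ← Category.assoc γ, hγδ,
        Category.id_comp])
  obtain ⟨m, hm, hm'⟩ := exists_lift h𝒳 (b := mk (pull 𝒳 Z₁.hom M)) (c Z₁) (k ≫ g) L.left (by
    refine (Category.assoc L.left Z₁.hom prod.fst).symm.trans ?_
    rw [Over.w L]
    exact (Category.assoc _ _ _).trans (congrArg (k.base ≫ ·) hZg))
  refine ⟨m, hom_ext_of_comp h𝒳 g ?_ ?_, hom_ext_of_comp h𝒳 q ?_ ?_⟩
  · rw [comp_base, hm, hsb]
    exact congrArg (fun t => t.left) hLb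
  · rw [Category.assoc, Category.assoc, hδ', hc, hm']
  · rw [comp_base, hm, overMap_base]
    exact congrArg (fun t => t.left) hLa
  · rw [Category.assoc, ← hg, ← hm', hq]
    exact congrArg (m ≫ ·) (hc a)

end Refinement

section FullSubcategory

instance {D : Type u₂} [Category.{v₂} D] (ι : D ⥤ C) [ι.Faithful] :
    (totRestrict ι 𝒳).Faithful where
  map_injective h := totRestrict_map_injective
    (ι.map_injective (congrArg (fun t => t.base) h)) h

instance {D : Type u₂} [Category.{v₂} D] (ι : D ⥤ C) [ι.Full] :
    (totRestrict ι 𝒳).Full where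
  map_surjective n := by
    obtain ⟨f, hf⟩ := ι.map_surjective n.base
    obtain ⟨u, -, hu⟩ := exists_totRestrict_map_eq f n hf.symm
    exact ⟨u, hu⟩

variable (U : C ⥤ Scheme.{u}) [HasBinaryProducts C] {J : GrothendieckTopology C}

/-- A smooth atlas with a property inherited by smooth coverings is an atlas. -/
theorem isAtlas_of_isSmoothAtlas (P : ObjectProperty C) (h𝒳 : IsGroupoidValued 𝒳)
    (hJ : ∀ {X Y : C} (f : X ⟶ Y), Smooth (U.map f) → Surjective (U.map f) → Tot.IsCovering J f)
    (hP : ∀ {X Y : C} (f : X ⟶ Y), Smooth (U.map f) → Surjective (U.map f) → P Y → P X)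
    {V : C} {v : 𝒳.obj (.mk (op V))} (hv : IsSmoothAtlas U 𝒳 v) (hV : P V) :
    IsAtlas J (totRestrict P.ι 𝒳) ⟨⟨V, hV⟩, v⟩ := by
  have key (e : Tot 𝒳) : ∃ (w : Tot 𝒳) (p : w ⟶ e) (q : w ⟶ Tot.mk v),
      Smooth (U.map p.base) ∧ Surjective (U.map p.base) ∧ ∀ {z : Tot 𝒳} (f : z ⟶ e)
      (g : z ⟶ Tot.mk v), ∃ (z' : Tot 𝒳) (s : z' ⟶ z) (h : z' ⟶ w),
        Etale (U.map s.base) ∧ Surjective (U.map s.base) ∧ s ≫ f = h ≫ p ∧ s ≫ g = h ≫ q ∧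
        ∀ (y : Tot 𝒳) (k : y ⟶ z) (l : y ⟶ w), k ≫ f = l ≫ p → k ≫ g = l ≫ q →
          ∃ m : y ⟶ z', m ≫ s = k ∧ m ≫ h = l := by
    obtain ⟨W, α, hα, hs, hs'⟩ := hv e.base e.fiber
    have hb : (Tot.ofHomSection α ≫ Tot.cart prod.snd e.fiber).base = W.hom ≫ prod.snd := by
      rw [Tot.comp_base, Tot.ofHomSection_base]; rfl
    refine ⟨_, Tot.ofHomSection α ≫ Tot.cart prod.snd e.fiber, Tot.cart W.hom _ ≫
      Tot.cart prod.fst v, ?_, ?_, fun f g => exists_refinement U h𝒳 α hα rfl rfl f g⟩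
    · rw [hb]; exact hs
    · rw [hb]; exact hs'
  have hl {e w : Tot 𝒳} {p : w ⟶ e} {q : w ⟶ Tot.mk v} (h : ∀ {z : Tot 𝒳} (f : z ⟶ e)
      (g : z ⟶ Tot.mk v), ∃ (z' : Tot 𝒳) (s : z' ⟶ z) (h : z' ⟶ w),
        Etale (U.map s.base) ∧ Surjective (U.map s.base) ∧ s ≫ f = h ≫ p ∧ s ≫ g = h ≫ q ∧
        ∀ (y : Tot 𝒳) (k : y ⟶ z) (l : y ⟶ w), k ≫ f = l ≫ p → k ≫ g = l ≫ q →
          ∃ m : y ⟶ z', m ≫ s = k ∧ m ≫ h = l) : LocallyLifts J p q := by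
    intro z f g
    obtain ⟨z', s, h, h₁, h₂, h₃, h₄, -⟩ := h f g
    exact ⟨z', s, h, hJ s.base inferInstance h₂, h₃, h₄⟩
  refine ⟨fun e => ?_, fun d => ?_⟩
  · obtain ⟨w, p, q, h₁, h₂, h⟩ := key e
    exact ⟨w, p, q, hJ p.base h₁ h₂, hl h⟩
  · obtain ⟨w, p, q, h₁, h₂, h⟩ := key ((totRestrict P.ι 𝒳).obj d)
    -- The chart is smooth and surjective over `d`, and below the refinement is étale and surjective
    -- over `a`, so both inherit `P`; fullness turns their arrows into arrows of the subcategory.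
    have hw : P w.base := hP p.base h₁ h₂ d.base.property
    let w₀ : Tot (restrict P.ι 𝒳) := ⟨⟨w.base, hw⟩, w.fiber⟩
    obtain ⟨p₀, rfl⟩ := (totRestrict P.ι 𝒳).map_surjective (X := w₀) (Y := d) p
    obtain ⟨q₀, rfl⟩ := (totRestrict P.ι 𝒳).map_surjective (X := w₀) (Y := ⟨⟨V, hV⟩, v⟩) q
    refine ⟨w₀, p₀, q₀, hJ _ h₁ h₂, hl h, fun a α β => ?_⟩
    obtain ⟨z', s, k, h₃, h₄, h₅, h₆, h₇⟩ := h ((totRestrict P.ι 𝒳).map α)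
      ((totRestrict P.ι 𝒳).map β)
    have hz' : P z'.base := hP s.base inferInstance h₄ a.base.property
    let a₀ : Tot (restrict P.ι 𝒳) := ⟨⟨z'.base, hz'⟩, z'.fiber⟩
    obtain ⟨s₀, rfl⟩ := (totRestrict P.ι 𝒳).map_surjective (X := a₀) (Y := a) s
    obtain ⟨k₀, rfl⟩ := (totRestrict P.ι 𝒳).map_surjective (X := a₀) (Y := w₀) k
    refine ⟨a₀, s₀, k₀, (totRestrict P.ι 𝒳).map_injective ?_,
      (totRestrict P.ι 𝒳).map_injective ?_, h₇⟩
    · rw [Functor.map_comp, Functor.map_comp]; exact h₅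
    · rw [Functor.map_comp, Functor.map_comp]; exact h₆

end FullSubcategory

end SmoothAtlases

/-! ### Schemes with a smooth-local property, and smooth schemes over `𝔽_p`. -/

section Schemes

/-- A smooth surjection is a smooth covering with one member. -/
lemma IsSmoothLocal.of_smooth_of_surjective {P : ObjectProperty Scheme.{u}} (hP : IsSmoothLocal P)
    {X Y : Scheme.{u}} (f : X ⟶ Y) [Smooth f] [Surjective f] (hY : P Y) : P X :=
  (hP Y (Scheme.Cover.mkOfCovers PUnit.{u + 1} (fun _ => X) (fun _ => f)
    (fun y => ⟨⟨⟩, f.surjective y⟩) (fun _ => ‹_›))).mp hY ⟨⟩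

lemma isCovering_etaleF {p : ℕ} {X Y : SchF.{u} p} (f : X ⟶ Y) [Smooth f.left]
    [Surjective f.left] : Tot.IsCovering (etaleF p) f := by
  rw [Tot.IsCovering, GrothendieckTopology.mem_over_iff, Sieve.overEquiv_generate]
  refine Scheme.etaleTopology.superset_covering (Sieve.generate_mono ?_)
    (generate_singleton_mem_etaleTopology f.left)
  rintro _ _ ⟨⟩
  exact ⟨X, f, 𝟙 _, Presieve.singleton_self f, (Category.id_comp _).symm⟩

lemma smF_of_smooth {p : ℕ} {X Y : SchF.{u} p} (f : X ⟶ Y) [Smooth f.left] (hY : smF p Y) :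
    smF p X := by
  have : Smooth Y.hom := hY
  have h : Smooth (f.left ≫ Y.hom) := inferInstance
  rw [Over.w f] at h
  exact h

lemma isEquivalence_restrictMor_of_isAlgStk {P : ObjectProperty Scheme.{u}} (hP : IsSmoothLocal P)
    {𝒳 𝒴 : SchPreStk.{w, w', u}} (h𝒳 : IsAlgStk P 𝒳) (h𝒴 : IsStk 𝒴) :
    (restrictMor P.ι 𝒳 𝒴).IsEquivalence := by
  obtain ⟨h, V, v, hv, hV⟩ := h𝒳
  have h₀ := h.isGroupoidStack.isGroupoidValued
  refine isEquivalence_restrictMor h₀ h𝒴 (isAtlas_of_isSmoothAtlas (𝟭 Scheme.{u}) P h₀ ?_ ?_ hv hV)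
  · intro X Y f hf hf'
    exact @generate_singleton_mem_etaleTopology _ _ f hf hf'
  · intro X Y f hf hf'
    exact @IsSmoothLocal.of_smooth_of_surjective _ hP _ _ f hf hf'

lemma isEquivalence_restrictMor_of_isSmoothAlgStkF {p : ℕ} {𝒳 𝒴 : PreStk.{w, w'} (SchF.{u} p)}
    (h𝒳 : IsSmoothAlgStkF p 𝒳) (h𝒴 : IsGroupoidStack (etaleF p) 𝒴) :
    (restrictMor (smF p).ι 𝒳 𝒴).IsEquivalence := by
  obtain ⟨h, V, v, hv, hV⟩ := h𝒳
  have h₀ := h.isGroupoidStack.isGroupoidValued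
  refine isEquivalence_restrictMor h₀ h𝒴
    (isAtlas_of_isSmoothAtlas (Over.forget (specF p)) (smF p) h₀ ?_ ?_ hv hV)
  · intro X Y f hf hf'
    exact @isCovering_etaleF _ _ _ f hf hf'
  · intro X Y f hf hf'
    exact @smF_of_smooth _ _ _ f hf

end Schemes

end StackyYoneda

end

theorem mainTheorem6 :
    (∀ P : ObjectProperty Scheme.{u}, IsSmoothLocal P →
      (∀ 𝒳 : SchPreStk.{w, w', u}, IsAlgStk P 𝒳 →
        ∀ 𝒴 : SchPreStk.{w, w', u}, IsStk 𝒴 → (restrictMor P.ι 𝒳 𝒴).IsEquivalence) ∧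
      (∀ 𝒳 : SchPreStk.{max w (u + 1), max w (u + 1), u}, IsAlgStk P 𝒳 →
        IsSheafifiedLeftKanExtension Scheme.etaleTopology P.ι (𝟙 (restrict P.ι 𝒳)))) ∧
    (∀ p : ℕ, p.Prime →
      (∀ 𝒳 𝒴 : PreStk.{w, w'} (SchF.{u} p), IsSmoothAlgStkF p 𝒳 → IsSmoothAlgStkF p 𝒴 →
        (restrictMor (smF p).ι 𝒳 𝒴).IsEquivalence) ∧
      (∀ 𝒳 : PreStk.{max w (u + 1), max w (u + 1)} (SchF.{u} p), IsSmoothAlgStkF p 𝒳 →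
        IsSheafifiedLeftKanExtension (etaleF p) (smF p).ι (𝟙 (restrict (smF p).ι 𝒳)))) := by
  refine ⟨fun P hP => ⟨fun 𝒳 h𝒳 𝒴 h𝒴 => isEquivalence_restrictMor_of_isAlgStk hP h𝒳 h𝒴,
      fun 𝒳 h𝒳 => isSheafifiedLeftKanExtension_id.{w, u} _ _ h𝒳.1.isGroupoidStack
        fun 𝒴 h𝒴 => isEquivalence_restrictMor_of_isAlgStk hP h𝒳 h𝒴⟩,
    fun p _ => ⟨fun 𝒳 𝒴 h𝒳 h𝒴 => isEquivalence_restrictMor_of_isSmoothAlgStkF h𝒳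
      h𝒴.1.isGroupoidStack,
      fun 𝒳 h𝒳 => isSheafifiedLeftKanExtension_id.{w, u} _ _ h𝒳.1.isGroupoidStack
        fun 𝒴 h𝒴 => isEquivalence_restrictMor_of_isSmoothAlgStkF h𝒳 h𝒴⟩⟩
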